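/- **Setting.** Let $\Omega\subset\mathbb R^d$ ($d\ge1$) be open, convex and bounded, $T>0$, $0<\alpha<1$; $(\cdot,\cdot)$ and $\|\cdot\|$ are the inner product and norm of $L^2(\Omega)$. Assume: (H1) $u_0\in H^2(\Omega)\cap H^1_0(\Omega)$, and $f:[0,T]\to L^2(\Omega)$ is (strongly) measurable and bounded; $f^n:=f(t_n)$. (H2) $M:\bar\Omega\times[0,T]\times(0,\infty)\to(0,\infty)$ is Lipschitz continuous with constant $L_M$, i.e. $|M(x,t,s)-M(x',t',s')|\le L_M(|x-x'|+|t-t'|+|s-s'|)$, and there is $m_0>0$ with $M\ge m_0$ and $m_0-4L_MK^2>0$, where $K=\|\nabla u_0\|+\|f\|_{L^\infty(0,T;L^2(\Omega))}$. The continuous extension of $M$ to $s=0$ is still denoted $M$. (H3) $b_2$ (with values in the symmetric positive definite $d\times d$ matrices), $b_1$ ($\mathbb R^d$-valued) and $b_0$ (real-valued) are smooth on $\bar\Omega\times[0,T]\times[0,T]$. Put $$B(t,s,v,w)=(b_2(\cdot,t,s)\nabla v,\nabla w)+(\nabla\cdot(b_1(\cdot,t,s)v),w)+(b_0(\cdot,t,s)v,w).$$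 **Space discretization.** A mesh $\mathbb T_h$ is a finite conforming (face-to-face) family of closed $d$-simplices contained in $\bar\Omega$, with union $\bar\Omega_h$. $X_h$ is the space of continuous functions on $\bar\Omega$ that are affine on each simplex of $\mathbb T_h$ and vanish on $\partial\Omega$ and on $\bar\Omega\setminus\bar\Omega_h$. For $\gamma,h>0$, the mesh is called $(\gamma,h)$-regular (shape regular and quasi-uniform) if every simplex has diameter at most $h$ and contains a ball of radius $h/\gamma$, and every point of $\Omega\setminus\bar\Omega_h$ has distance at most $\gamma h$ from $\partial\Omega$. (The last condition is void if $\bar\Omega_h=\bar\Omega$.) **Scheme $(E_\alpha)$.** Let $N\ge1$, $k=T/N$, $t_n=nk$, $a_i=(i+1)^{1-\alpha}-i^{1-\alpha}$ and $$\mathbb D^\alpha_tu^n=\frac{k^{-\alpha}}{\Gamma(2-\alpha)}\sum_{j=1}^na_{n-j}(u^j-u^{j-1}).$$ For $k\le1$ let $m_1=\lfloor k^{-1/2}\rfloor$, $k_1=m_1k$, let $j_n$ be the largest even integer with $j_nk_1<t_n$, and let $\bar t^n_j=jk_1$ for $0\le j\le j_n$, $\bar t^n_j=j_nk_1+(j-j_n)k$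 for $j_n\le j\le J_n$, where $\bar t^n_{J_n}=t_{n-1}$. The weights $w_{nj}$ are defined by $$\sum_{j=0}^{n-1}w_{nj}g(t_j)=\frac{k_1}3\sum_{j=1}^{j_n/2}\big[g(\bar t^n_{2j})+4g(\bar t^n_{2j-1})+g(\bar t^n_{2j-2})\big]+\frac k2\sum_{j=j_n+1}^{J_n}\big[g(\bar t^n_j)+g(\bar t^n_{j-1})\big]+k\,g(\bar t^n_{J_n}).$$ A solution of $(E_\alpha)$ consists of $u_h^0,\dots,u_h^N\in X_h$ such that for all $v_h\in X_h$: * initial value: $(M(\cdot,0,\|\nabla u_0\|^2)\nabla(u_0-u_h^0),\nabla v_h)=0$; * $n=1$: $(\mathbb D^\alpha_tu_h^1,v_h)+(M(\cdot,t_1,\|\nabla u_h^1\|^2)\nabla u_h^1,\nabla v_h)=(f^1,v_h)+kB(t_1,t_0,u_h^0,v_h)$; * $2\le n\le N$: with $\bar u_h^{n-1}=2u_h^{n-1}-u_h^{n-2}$, $$(\mathbb D^\alpha_tu_h^n,v_h)+(M(\cdot,t_n,\|\nabla\bar u_h^{n-1}\|^2)\nabla u_h^n,\nabla v_h)=(f^n,v_h)+\sum_{j=1}^{n-1}w_{nj}B(t_n,t_j,u_h^j,v_h).$$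 **Theorem.** Assume (H1)–(H3). 1. For every mesh and every $N\ge1$ with $k=T/N\le1$, the scheme $(E_\alpha)$ has a solution. Moreover, for $2\le n\le N$ and any given $u_h^0,\dots,u_h^{n-1}\in X_h$, the equation for $u_h^n$ has exactly one solution in $X_h$; it is a linear system, of the form $\mathcal A_n(u_h^n,v_h)=\ell_n(v_h)$ for all $v_h\in X_h$ with $\ell_n$ a linear functional and $$\mathcal A_n(w,v)=\frac{k^{-\alpha}}{\Gamma(2-\alpha)}a_0(w,v)+(M(\cdot,t_n,\|\nabla\bar u_h^{n-1}\|^2)\nabla w,\nabla v),$$ and its matrix with respect to any basis of $X_h$ is (symmetric) positive definite. 2. For every $\gamma>0$ there is $k_0\in(0,1]$, depending only on $\gamma$ and the data $(\Omega,T,\alpha,M,b_0,b_1,b_2,f,u_0)$ and not on $h$ or $N$, such that for every $h>0$, every $(\gamma,h)$-regular mesh and every $N\ge1$ with $k=T/N<k_0$, the scheme $(E_\alpha)$ has exactly one solution $u_h^0,\dots,u_h^N$. -/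

import Mathlib

open MeasureTheory Set Filter Topology
open scoped ContDiff

namespace KirchhoffFEM

noncomputable section

/-- The space `ℝ^d` with its Euclidean norm. -/
abbrev Pt (d : ℕ) := EuclideanSpace ℝ (Fin d)

/-! ### Sobolev spaces -/

/-- `φ ∈ C_c^∞(Ω)`. -/
def IsTest {d : ℕ} (Ω : Set (Pt d)) (φ : Pt d → ℝ) : Prop :=
  ContDiff ℝ ∞ φ ∧ HasCompactSupport φ ∧ tsupport φ ⊆ Ω

/-- `u ∈ H¹(Ω)` with weak gradient `G`: both are square integrable on `Ω`, and
`∫_Ω u ∂ᵢφ = -∫_Ω Gᵢ φ` for all test functions `φ` and all `i`. -/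
def MemH1 {d : ℕ} (Ω : Set (Pt d)) (u : Pt d → ℝ) (G : Pt d → Pt d) : Prop :=
  MemLp u 2 (volume.restrict Ω) ∧ MemLp G 2 (volume.restrict Ω) ∧
    ∀ φ : Pt d → ℝ, IsTest Ω φ → ∀ i : Fin d,
      ∫ x in Ω, u x * gradient φ x i = -∫ x in Ω, G x i * φ x

/-- `u ∈ H²(Ω)` with weak gradient `G`: `u ∈ H¹(Ω)`, and every component of `G` is in `H¹(Ω)`. -/
def MemH2 {d : ℕ} (Ω : Set (Pt d)) (u : Pt d → ℝ) (G : Pt d → Pt d) : Prop :=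
  MemH1 Ω u G ∧ ∀ i : Fin d, ∃ H : Pt d → Pt d, MemH1 Ω (fun x => G x i) H

/-- `u ∈ H¹₀(Ω)` with weak gradient `G`: `u ∈ H¹(Ω)` is a limit in the norm of `H¹(Ω)` of
test functions. -/
def MemH10 {d : ℕ} (Ω : Set (Pt d)) (u : Pt d → ℝ) (G : Pt d → Pt d) : Prop :=
  MemH1 Ω u G ∧ ∃ φ : ℕ → Pt d → ℝ, (∀ n, IsTest Ω (φ n)) ∧
    Tendsto (fun n => eLpNorm (φ n - u) 2 (volume.restrict Ω)) atTop (𝓝 0) ∧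
    Tendsto (fun n => eLpNorm (gradient (φ n) - G) 2 (volume.restrict Ω)) atTop (𝓝 0)

/-! ### Triangulations and the finite element space -/

/-- A conforming (face-to-face) finite simplicial mesh inside `Ω̄`: a finite simplicial complex all
of whose faces are faces of `d`-simplices. The meshed region `K.space` may be all of `Ω̄` (this is
only possible for a polytope) or, for a curved boundary, a polyhedral region inscribed in `Ω̄`. -/
structure Mesh {d : ℕ} (Ω : Set (Pt d)) where
  /-- the underlying simplicial complex -/
  K : Geometry.SimplicialComplex ℝ (Pt d)
  finite : K.faces.Finite
  pure : ∀ s ∈ K.faces, ∃ t ∈ K.faces, s ⊆ t ∧ t.card = d + 1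
  subset : K.space ⊆ closure Ω

namespace Mesh

variable {d : ℕ} {Ω : Set (Pt d)}

/-- The elements of the mesh, given by their `d + 1` vertices. -/
def elements (𝓣 : Mesh Ω) : Set (Finset (Pt d)) := {t | t ∈ 𝓣.K.faces ∧ t.card = d + 1}

/-- Shape regular and quasi-uniform with mesh size `h` and regularity constant `γ`: every
element has diameter at most `h` and contains a ball of radius `h / γ`, and the mesh fills `Ω` up
to a boundary layer of width `γ * h` (up to nothing, if it is a triangulation of `Ω̄`). -/
def Regular (𝓣 : Mesh Ω) (γ h : ℝ) : Prop :=
  0 < h ∧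
  (∀ t ∈ 𝓣.elements, Metric.diam (convexHull ℝ (t : Set (Pt d))) ≤ h ∧
    ∃ c : Pt d, Metric.ball c (h / γ) ⊆ convexHull ℝ (t : Set (Pt d))) ∧
  ∀ x ∈ Ω, x ∉ 𝓣.K.space → Metric.infDist x (frontier Ω) ≤ γ * h

/-- The finite element space `X_h`: continuous functions that are affine on each element
and vanish on `∂Ω`. They are extended by zero to the part of `Ω` that is not meshed and to the
complement of `Ω`. -/
def space (𝓣 : Mesh Ω) : Submodule ℝ (Pt d → ℝ) where
  carrier := {v | Continuous v ∧
    (∀ t ∈ 𝓣.elements, ∃ a : Pt d →ᵃ[ℝ] ℝ, EqOn v a (convexHull ℝ (t : Set (Pt d)))) ∧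
    ∀ x, x ∉ Ω ∨ x ∉ 𝓣.K.space → v x = 0}
  add_mem' := by
    rintro v w ⟨hv, hv', hv0⟩ ⟨hw, hw', hw0⟩
    refine ⟨hv.add hw, fun t ht => ?_, fun x hx => by simp [hv0 x hx, hw0 x hx]⟩
    obtain ⟨a, ha⟩ := hv' t ht
    obtain ⟨b, hb⟩ := hw' t ht
    exact ⟨a + b, fun x hx => by simp [ha hx, hb hx]⟩
  zero_mem' := ⟨continuous_const, fun _ _ => ⟨0, fun _ _ => by simp⟩, fun _ _ => rfl⟩
  smul_mem' := by
    rintro c v ⟨hv, hv', hv0⟩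
    refine ⟨hv.const_smul c, fun t ht => ?_, fun x hx => by simp [hv0 x hx]⟩
    obtain ⟨a, ha⟩ := hv' t ht
    exact ⟨c • a, fun x hx => by simp [ha hx]⟩

end Mesh

/-! ### The problem and its hypotheses -/

/-- The data of the initial-boundary value problem; what is required of them is stated by the
predicates below. -/
structure Problem (d : ℕ) where
  /-- the domain -/
  Ω : Set (Pt d)
  /-- the final time -/
  T : ℝ
  /-- the order of the fractional derivative -/
  α : ℝ
  /-- the diffusion coefficient `M(x,t,s)` -/
  M : Pt d → ℝ → ℝ → ℝ
  /-- the coefficients of the memory operator -/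
  b₂ : Pt d → ℝ → ℝ → Matrix (Fin d) (Fin d) ℝ
  b₁ : Pt d → ℝ → ℝ → Fin d → ℝ
  b₀ : Pt d → ℝ → ℝ → ℝ
  /-- the source term -/
  f : ℝ → Lp ℝ 2 (volume.restrict Ω)
  /-- the initial value and its weak gradient -/
  u₀ : Pt d → ℝ
  G₀ : Pt d → Pt d

namespace Problem

variable {d : ℕ} (P : Problem d)

/-- `‖∇u₀‖²` -/
def initSq : ℝ := ∫ x in P.Ω, ‖P.G₀ x‖ ^ 2

/-- `K = ‖∇u₀‖ + ‖f‖_{L^∞(0,T;L²(Ω))}` -/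
def K : ℝ := √P.initSq + (eLpNorm P.f ⊤ (volume.restrict (Icc 0 P.T))).toReal

/-- Standing assumptions on the domain, the time interval and the fractional order. -/
def Standing : Prop :=
  0 < d ∧ IsOpen P.Ω ∧ Convex ℝ P.Ω ∧ Bornology.IsBounded P.Ω ∧ 0 < P.T ∧ 0 < P.α ∧ P.α < 1

/-- `u₀ ∈ H²(Ω) ∩ H¹₀(Ω)` and `f ∈ L^∞(0,T;L²(Ω))`. Since the scheme evaluates `f` at the time
nodes, `f` is a function on `[0,T]` that is bounded everywhere. -/
def H1 : Prop :=
  MemH2 P.Ω P.u₀ P.G₀ ∧ MemH10 P.Ω P.u₀ P.G₀ ∧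
  AEStronglyMeasurable P.f (volume.restrict (Icc 0 P.T)) ∧
  ∃ C : ℝ, ∀ t ∈ Icc 0 P.T, ‖P.f t‖ ≤ C

/-- `M` is Lipschitz continuous with constant `L`, `M ≥ m₀ > 0`, and `m₀ - 4 L K² > 0`. The
values at `s = 0` are those of the continuous extension of `M` from `s > 0`. -/
def H2 : Prop :=
  ∃ m₀ L : ℝ, 0 < m₀ ∧ 0 ≤ L ∧
    (∀ x ∈ closure P.Ω, ∀ t ∈ Icc 0 P.T, ∀ s ∈ Ici (0 : ℝ), m₀ ≤ P.M x t s) ∧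
    (∀ x ∈ closure P.Ω, ∀ t ∈ Icc 0 P.T, ∀ s ∈ Ici (0 : ℝ),
      ∀ x' ∈ closure P.Ω, ∀ t' ∈ Icc 0 P.T, ∀ s' ∈ Ici (0 : ℝ),
        |P.M x t s - P.M x' t' s'| ≤ L * (‖x - x'‖ + |t - t'| + |s - s'|)) ∧
    0 < m₀ - 4 * L * P.K ^ 2

/-- `Ω̄ × [0,T] × [0,T]` -/
def cylinder : Set (Pt d × ℝ × ℝ) := closure P.Ω ×ˢ Icc 0 P.T ×ˢ Icc 0 P.T

/-- `b₂` is symmetric positive definite, and all coefficients are smooth. -/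
def H3 : Prop :=
  (∀ p ∈ P.cylinder, (P.b₂ p.1 p.2.1 p.2.2).PosDef) ∧
  (∀ i j, ContDiffOn ℝ ∞ (fun p : Pt d × ℝ × ℝ => P.b₂ p.1 p.2.1 p.2.2 i j) P.cylinder) ∧
  (∀ j, ContDiffOn ℝ ∞ (fun p : Pt d × ℝ × ℝ => P.b₁ p.1 p.2.1 p.2.2 j) P.cylinder) ∧
  ContDiffOn ℝ ∞ (fun p : Pt d × ℝ × ℝ => P.b₀ p.1 p.2.1 p.2.2) P.cylinder

/-! ### Forms on the finite element space

Finite element functions are differentiable almost everywhere, and their classical gradient is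
their weak gradient. -/

/-- `(v, w)` -/
def ip (v w : Pt d → ℝ) : ℝ := ∫ x in P.Ω, v x * w x

/-- `‖∇v‖²` -/
def gradSq (v : Pt d → ℝ) : ℝ := ∫ x in P.Ω, ‖gradient v x‖ ^ 2

/-- `(M(x,t,μ) ∇v, ∇w)` -/
def diffusion (t μ : ℝ) (v w : Pt d → ℝ) : ℝ :=
  ∫ x in P.Ω, P.M x t μ * inner ℝ (gradient v x) (gradient w x)

/-- `B(t,s,v,w) = (b₂(x,t,s)∇v, ∇w) + (∇·(b₁(x,t,s)v), w) + (b₀(x,t,s)v, w)` -/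
def B (t s : ℝ) (v w : Pt d → ℝ) : ℝ :=
  (∫ x in P.Ω, ∑ i, ∑ j, P.b₂ x t s i j * gradient v x j * gradient w x i) +
  (∫ x in P.Ω, (∑ j, fderiv ℝ (fun y => P.b₁ y t s j * v y) x (EuclideanSpace.single j 1)) * w x) +
  ∫ x in P.Ω, P.b₀ x t s * v x * w x

/-! ### The linearized L1 Galerkin scheme -/

/-- The time step `k = T / N`. -/
def step (N : ℕ) : ℝ := P.T / N

/-- The nodes `t_n = n k`. -/
def node (N n : ℕ) : ℝ := n * P.step N

/-- `a_i = (i+1)^{1-α} - i^{1-α}` -/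
def a (i : ℕ) : ℝ := ((i : ℝ) + 1) ^ (1 - P.α) - (i : ℝ) ^ (1 - P.α)

/-- `k^{-α} / Γ(2-α)` -/
def l1Const (N : ℕ) : ℝ := (P.step N) ^ (-P.α) / Real.Gamma (2 - P.α)

/-- The L1 approximation `(k^{-α} / Γ(2-α)) ∑_{j=1}^n a_{n-j} (u^j - u^{j-1})`. -/
def l1Deriv (N n : ℕ) (u : ℕ → Pt d → ℝ) : Pt d → ℝ :=
  P.l1Const N • ∑ j ∈ Finset.Icc 1 n, P.a (n - j) • (u j - u (j - 1))

end Problem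

/-- `m₁ = [k^{-1/2}]` -/
def simpsonStride (k : ℝ) : ℕ := ⌊k ^ (-(1 / 2) : ℝ)⌋₊

/-- `j_n`, the largest even integer `j` with `j k₁ < t_n`, where `k₁ = m₁ k` and `t_n = n k`. -/
def simpsonEnd (k : ℝ) (n : ℕ) : ℕ :=
  sSup {j : ℕ | Even j ∧ (j : ℝ) * (simpsonStride k * k) < n * k}

/-- The index `i` for which the `j`-th quadrature point is `t_i = i k`: the points are `j k₁` for
`j ≤ j_n`, and from there on they advance by `k`. -/
def simpsonIndex (k : ℝ) (n j : ℕ) : ℕ :=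
  if j ≤ simpsonEnd k n then j * simpsonStride k
  else simpsonEnd k n * simpsonStride k + (j - simpsonEnd k n)

/-- `J_n`, the number of the last quadrature point, which is `t_{n-1}`. -/
def simpsonLast (k : ℝ) (n : ℕ) : ℕ :=
  simpsonEnd k n + (n - 1 - simpsonEnd k n * simpsonStride k)

/-- The modified Simpson rule on `[0, t_n]`, for a function given by its values `g i` at `t_i`. -/
def simpson (k : ℝ) (n : ℕ) (g : ℕ → ℝ) : ℝ :=
  (simpsonStride k * k) / 3 * ∑ j ∈ Finset.Icc 1 (simpsonEnd k n / 2),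
      (g (simpsonIndex k n (2 * j)) + 4 * g (simpsonIndex k n (2 * j - 1))
        + g (simpsonIndex k n (2 * j - 2))) +
  k / 2 * ∑ j ∈ Finset.Icc (simpsonEnd k n + 1) (simpsonLast k n),
      (g (simpsonIndex k n j) + g (simpsonIndex k n (j - 1))) +
  k * g (simpsonIndex k n (simpsonLast k n))

/-- The quadrature weight `w_{nj}`, the coefficient of `g(t_j)` in the rule. -/
def simpsonWeight (k : ℝ) (n j : ℕ) : ℝ := simpson k n (Pi.single j 1)

namespace Problem

variable {d : ℕ} (P : Problem d) (𝓣 : Mesh P.Ω) (N : ℕ)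

/-- The initial value is the modified Ritz–Volterra projection of `u₀` at time `0`:
`(M(x,0,‖∇u₀‖²) ∇(u₀ - u_h^0), ∇v) = 0` for all `v ∈ X_h`. -/
def InitialStep (u : ℕ → 𝓣.space) : Prop :=
  ∀ v : 𝓣.space, ∫ x in P.Ω, P.M x 0 P.initSq *
    inner ℝ (P.G₀ x - gradient (u 0 : Pt d → ℝ) x) (gradient (v : Pt d → ℝ) x) = 0

/-- The equation of the scheme for `n = 1`. -/
def FirstStep (u : ℕ → 𝓣.space) : Prop :=
  ∀ v : 𝓣.space,
    P.ip (P.l1Deriv N 1 fun j => (u j : Pt d → ℝ)) v +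
      P.diffusion (P.node N 1) (P.gradSq (u 1)) (u 1) v =
    P.ip (P.f (P.node N 1)) v + P.step N * P.B (P.node N 1) (P.node N 0) (u 0) v

/-- `‖∇(2u^{n-1} - u^{n-2})‖²` -/
def extrapolatedSq (n : ℕ) (u : ℕ → 𝓣.space) : ℝ :=
  P.gradSq (2 • u (n - 1) - u (n - 2) : 𝓣.space)

/-- The equation of the scheme for `n ≥ 2`. -/
def LaterStep (n : ℕ) (u : ℕ → 𝓣.space) : Prop :=
  ∀ v : 𝓣.space,
    P.ip (P.l1Deriv N n fun j => (u j : Pt d → ℝ)) v +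
      P.diffusion (P.node N n) (P.extrapolatedSq 𝓣 n u) (u n) v =
    P.ip (P.f (P.node N n)) v +
      ∑ j ∈ Finset.Icc 1 (n - 1),
        simpsonWeight (P.step N) n j * P.B (P.node N n) (P.node N j) (u j) v

/-- The form that multiplies the unknown `u^n` in the equation for `n ≥ 2`:
`(k^{-α} / Γ(2-α)) a_0 (v,w) + (M(x,t_n,‖∇(2u^{n-1} - u^{n-2})‖²)∇v,∇w)`. -/
def systemForm (n : ℕ) (u : ℕ → 𝓣.space) (v w : 𝓣.space) : ℝ :=
  P.l1Const N * P.a 0 * P.ip v w + P.diffusion (P.node N n) (P.extrapolatedSq 𝓣 n u) v w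

/-- A finite sequence `u^0, …, u^N`, continued by zero. -/
def extend {N : ℕ} {X : Type*} [Zero X] (u : Fin (N + 1) → X) (n : ℕ) : X :=
  if h : n < N + 1 then u ⟨n, h⟩ else 0

/-- `u_h^0, …, u_h^N` solve the linearized L1 Galerkin scheme. -/
def IsSolution (u : Fin (N + 1) → 𝓣.space) : Prop :=
  P.InitialStep 𝓣 (extend u) ∧ P.FirstStep 𝓣 N (extend u) ∧
    ∀ n, 2 ≤ n → n ≤ N → P.LaterStep 𝓣 N n (extend u)

end Problem

end

end KirchhoffFEM

/-! Only the step n = 1 is nonlinear. The Ritz projection defining u_h^0 and every step n ≥ 2 are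
linear problems for a symmetric form that is positive definite on the finite-dimensional space X_h:
M ≥ m₀, and by Poincaré ‖∇v‖ = 0 forces v = 0. In a step n ≥ 2 the memory sum involves earlier
values only, so it goes to the right-hand side whatever the quadrature weights are.

Existence for n = 1 (`exists_kirchhoff`): the nonlinearity depends on u only through the number s =
‖∇u‖². Freeze s, solve the linear problem for w(s), and find s with ‖∇w(s)‖² = s by the intermediate
value theorem; w(s) is bounded and s ↦ ‖∇w(s)‖ is Lipschitz.

Uniqueness for n = 1: write κ = k^{-α}/Γ(2-α). If two solutions have gradient norms at most ρ, their
difference e satisfies κ‖e‖² + m₀‖∇e‖² ≤ 2Lρ²‖∇e‖² (`firstStep_sub_le`). There are two regimes,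
separated by a threshold h₀ that depends on γ and the data only.

On fine meshes, h < h₀, it suffices that 2Lρ² < m₀. The smallness assumption gives this with room to
spare for ρ = ‖∇u₀‖, so one needs ‖∇u_h^1‖ ≤ ‖∇u₀‖ + ε (`exists_gn_firstStep_le`). Test with δ =
u_h^1 - u_h^0, which produces κ‖δ‖², and replace ∇u_h^0 by ∇φ for a test function φ near u₀ in H¹.
The error is small because the Ritz projections converge uniformly over regular meshes. In (M∇φ,∇δ)
integrate by parts, using that M is Lipschitz in x: the result is at most C_φ‖δ‖, which κ‖δ‖²
absorbs once k is small. Hence ‖∇δ‖ is small.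

On coarse meshes, h ≥ h₀, the inverse inequality gives ‖∇e‖² ≤ c h₀⁻²‖e‖², and a large κ absorbs
2LR²‖∇e‖², where R bounds ‖∇u_h^1‖ independently of mesh and step (`exists_firstStep_bound`). That
bound cannot use an upper bound for M, since M(x,t,s) may grow with s = ‖∇u_h^1‖²; it uses only the
lower bound m₀ and the oscillation of M in x, which is bounded uniformly in s
(`le_diffusion_of_le`). -/

namespace KirchhoffFEM

/-! ### The `L²` seminorm of a vector-valued function -/

section L2

variable {α : Type*} [MeasurableSpace α] {μ : Measure α}
variable {E F : Type*} [NormedAddCommGroup E] [NormedAddCommGroup F]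

/-- The `L²` seminorm `(∫ ‖f‖²)^{1/2}` as a real number. -/
noncomputable def nrm (μ : Measure α) (f : α → E) : ℝ := √(∫ x, ‖f x‖ ^ 2 ∂μ)

lemma nrm_nonneg (f : α → E) : 0 ≤ nrm μ f := Real.sqrt_nonneg _

lemma sq_nrm (f : α → E) : nrm μ f ^ 2 = ∫ x, ‖f x‖ ^ 2 ∂μ :=
  Real.sq_sqrt (integral_nonneg fun _ => by positivity)

lemma nrm_congr {f g : α → E} (h : f =ᵐ[μ] g) : nrm μ f = nrm μ g := by
  unfold nrm
  congr 1
  exact integral_congr_ae (h.mono fun x hx => by simp only [hx])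

lemma nrm_eq_eLpNorm {f : α → E} (hf : MemLp f 2 μ) : nrm μ f = (eLpNorm f 2 μ).toReal := by
  rw [hf.eLpNorm_eq_integral_rpow_norm (by norm_num) (by norm_num)]
  rw [ENNReal.toReal_ofReal (by positivity)]
  simp only [ENNReal.toReal_ofNat, Real.rpow_two, nrm, Real.sqrt_eq_rpow, one_div]

lemma nrm_add_le {f g : α → E} (hf : MemLp f 2 μ) (hg : MemLp g 2 μ) :
    nrm μ (fun x => f x + g x) ≤ nrm μ f + nrm μ g := by
  have h := eLpNorm_add_le hf.1 hg.1 (by norm_num : (1 : ENNReal) ≤ 2)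
  change nrm μ (f + g) ≤ _
  rw [nrm_eq_eLpNorm hf, nrm_eq_eLpNorm hg, nrm_eq_eLpNorm (hf.add hg),
    ← ENNReal.toReal_add hf.eLpNorm_ne_top hg.eLpNorm_ne_top]
  exact ENNReal.toReal_mono (ENNReal.add_ne_top.2 ⟨hf.eLpNorm_ne_top, hg.eLpNorm_ne_top⟩) h

lemma nrm_neg (f : α → E) : nrm μ (fun x => - f x) = nrm μ f := by simp [nrm]

lemma nrm_sub_comm (f g : α → E) : nrm μ (fun x => f x - g x) = nrm μ (fun x => g x - f x) := by
  simp only [nrm, norm_sub_rev]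

lemma nrm_sub_le {f g h : α → E} (hf : MemLp f 2 μ) (hg : MemLp g 2 μ) (hh : MemLp h 2 μ) :
    nrm μ (fun x => f x - h x) ≤ nrm μ (fun x => f x - g x) + nrm μ (fun x => g x - h x) := by
  have := nrm_add_le (hf.sub hg) (hg.sub hh)
  simp only [Pi.sub_apply, sub_add_sub_cancel] at this
  exact this

/-- A function bounded by a constant times a product of two square integrable functions is
integrable, with the Cauchy–Schwarz bound for its integral. -/
lemma l2_bound {f : α → E} {g : α → F} {h : α → ℝ} (hf : MemLp f 2 μ) (hg : MemLp g 2 μ)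
    (hh : AEStronglyMeasurable h μ) {C : ℝ} (hC : 0 ≤ C)
    (hb : ∀ᵐ x ∂μ, |h x| ≤ C * (‖f x‖ * ‖g x‖)) :
    Integrable h μ ∧ |∫ x, h x ∂μ| ≤ C * (nrm μ f * nrm μ g) := by
  have hi : Integrable (fun x => ‖f x‖ * ‖g x‖) μ := hf.norm.integrable_mul hg.norm
  refine ⟨(hi.const_mul C).mono' hh hb, ?_⟩
  calc |∫ x, h x ∂μ| ≤ ∫ x, C * (‖f x‖ * ‖g x‖) ∂μ :=
        norm_integral_le_of_norm_le (f := h) (hi.const_mul C) hb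
    _ = C * ∫ x, ‖f x‖ * ‖g x‖ ∂μ := integral_const_mul _ _
    _ ≤ C * (nrm μ f * nrm μ g) := by
        gcongr
        have := integral_mul_le_Lp_mul_Lq_of_nonneg (μ := μ) Real.HolderConjugate.two_two
          (f := fun x => ‖f x‖) (g := fun x => ‖g x‖) (ae_of_all _ fun _ => norm_nonneg _)
          (ae_of_all _ fun _ => norm_nonneg _) (by simpa using hf.norm) (by simpa using hg.norm)
        simpa only [nrm, Real.sqrt_eq_rpow, Real.rpow_two] using this

lemma integrable_sq_norm {f : α → E} (hf : MemLp f 2 μ) : Integrable (fun x => ‖f x‖ ^ 2) μ := by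
  have := hf.norm.integrable_mul hf.norm
  simp only [sq]
  exact this

lemma nrm_mono {f : α → E} {g : α → F} (hg : MemLp g 2 μ)
    (h : ∀ᵐ x ∂μ, ‖f x‖ ≤ ‖g x‖) : nrm μ f ≤ nrm μ g := by
  refine Real.sqrt_le_sqrt (integral_mono_of_nonneg (ae_of_all _ fun _ => by positivity)
    (integrable_sq_norm hg) (h.mono fun x hx => ?_))
  show ‖f x‖ ^ 2 ≤ ‖g x‖ ^ 2
  gcongr

lemma nrm_le_of_bound [IsFiniteMeasure μ] {f : α → E} {C : ℝ} (hC : 0 ≤ C)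
    (h : ∀ᵐ x ∂μ, ‖f x‖ ≤ C) : nrm μ f ≤ C * √(μ.real univ) := by
  have : nrm μ f ≤ nrm μ (fun _ : α => C) := nrm_mono (memLp_const C) (h.mono fun x hx => by
    rwa [Real.norm_of_nonneg hC])
  refine this.trans (le_of_eq ?_)
  simp only [nrm, integral_const, smul_eq_mul, Real.norm_eq_abs, sq_abs]
  rw [mul_comm, Real.sqrt_mul (by positivity), Real.sqrt_sq hC]

end L2

/-! ### Continuous functions that are Lipschitz on each piece of a finite closed cover -/

/-- As z decreases to x, one of the finitely many pieces must occur for z arbitrarily close to x;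
being closed, it also contains x. So the lower right slope of g at x is at most K, and the mean
value inequality in its liminf form applies. -/
lemma sub_le_of_closed_cover {ι : Type*} [Finite ι] {s : ι → Set ℝ} {g : ℝ → ℝ} {K : ℝ}
    (hg : Continuous g) (hs : ∀ i, IsClosed (s i)) (hcov : ∀ x, ∃ i, x ∈ s i)
    (hK : ∀ i, ∀ x ∈ s i, ∀ y ∈ s i, g y - g x ≤ K * |y - x|) : g 1 - g 0 ≤ K := by
  have key := image_le_of_liminf_slope_right_le_deriv_boundary (f := g) (a := 0) (b := 1)
    (B := fun t => g 0 + K * t) (B' := fun _ => K) hg.continuousOn (by simp) (by fun_prop)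
    (fun x _ => by
      have := ((hasDerivAt_id x).const_mul K).const_add (g 0)
      rw [mul_one] at this
      exact this.hasDerivWithinAt)
    (fun x _ r hr => by
      have h1 : ∃ᶠ z in 𝓝[>] x, ∃ i, z ∈ s i ∧ x < z :=
        (eventually_mem_nhdsWithin.mono fun z hz => (hcov z).imp fun i hi => ⟨hi, hz⟩).frequently
      have h2 : ∃ i, ∃ᶠ z in 𝓝[>] x, z ∈ s i ∧ x < z := by
        by_contra hcon
        simp only [not_exists, not_frequently] at hcon
        exact h1 ((eventually_all.2 hcon).mono fun z hz => not_exists.2 hz)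
      obtain ⟨i, hi⟩ := h2
      have hx : x ∈ s i := by
        refine (hs i).mem_of_frequently_of_tendsto (hi.mono fun z hz => hz.1)
          (tendsto_id.mono_left nhdsWithin_le_nhds)
      refine hi.mono fun z hz => ?_
      have h3 := hK i x hx z hz.1
      have h4 : 0 < z - x := sub_pos.2 hz.2
      rw [abs_of_pos h4] at h3
      rw [slope_def_field]
      exact lt_of_le_of_lt ((div_le_iff₀ h4).2 h3) hr)
    (right_mem_Icc.2 zero_le_one)
  norm_num at key
  linarith

/-- Restriction to the segment between two points reduces this to the one-dimensional case. -/
lemma lipschitzWith_of_closed_cover {E ι : Type*} [NormedAddCommGroup E] [NormedSpace ℝ E]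
    [Finite ι] {s : ι → Set E} {f : E → ℝ} {K : NNReal} (hf : Continuous f)
    (hs : ∀ i, IsClosed (s i)) (hcov : ∀ x, ∃ i, x ∈ s i) (hK : ∀ i, LipschitzOnWith K f (s i)) :
    LipschitzWith K f := by
  refine LipschitzWith.of_le_add_mul K fun x y => ?_
  have hc : Continuous (fun t : ℝ => AffineMap.lineMap y x t) := AffineMap.lineMap_continuous
  have := sub_le_of_closed_cover (s := fun i => (fun t : ℝ => AffineMap.lineMap y x t) ⁻¹' s i)
    (g := fun t : ℝ => f (AffineMap.lineMap y x t)) (K := K * dist x y) (hf.comp hc)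
    (fun i => (hs i).preimage hc) (fun t => hcov _) (fun i t ht t' ht' => by
      have h := (hK i).dist_le_mul _ ht' _ ht
      rw [Real.dist_eq, dist_lineMap_lineMap, Real.dist_eq, dist_comm y x] at h
      calc _ ≤ _ := le_abs_self _
        _ ≤ _ := h
        _ = _ := by ring)
  simp only [AffineMap.lineMap_apply_one, AffineMap.lineMap_apply_zero] at this
  linarith

/-! ### Admissible functions -/

/-- Lipschitz functions that vanish outside `Ω`. -/
def Adm {d : ℕ} (Ω : Set (Pt d)) (v : Pt d → ℝ) : Prop :=
  (∃ C, LipschitzWith C v) ∧ ∀ x, x ∉ Ω → v x = 0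

lemma affineMap_lipschitz {d : ℕ} (a : Pt d →ᵃ[ℝ] ℝ) :
    LipschitzWith ‖LinearMap.toContinuousLinearMap a.linear‖₊ a := by
  refine LipschitzWith.of_dist_le_mul fun x y => ?_
  have h1 : a x - a y = LinearMap.toContinuousLinearMap a.linear (x - y) := by
    have := a.linearMap_vsub x y
    simp only [vsub_eq_sub] at this
    simpa using this.symm
  rw [dist_eq_norm, h1, dist_eq_norm]
  exact ContinuousLinearMap.le_opNorm _ _

/-! ### Finite element functions are Lipschitz, and X_h is finite-dimensional -/

namespace Mesh

variable {d : ℕ} {Ω : Set (Pt d)} (𝓣 : Mesh Ω)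

lemma elements_finite : 𝓣.elements.Finite := 𝓣.finite.subset fun _ h => h.1

lemma mem_space_iff {x : Pt d} :
    x ∈ 𝓣.K.space ↔ ∃ t ∈ 𝓣.elements, x ∈ convexHull ℝ (t : Set (Pt d)) := by
  rw [Geometry.SimplicialComplex.mem_space_iff]
  constructor
  · rintro ⟨s, hs, hx⟩
    obtain ⟨t, ht, hst, hc⟩ := 𝓣.pure s hs
    exact ⟨t, ⟨ht, hc⟩, convexHull_mono (by exact_mod_cast hst) hx⟩
  · rintro ⟨t, ht, hx⟩
    exact ⟨t, ht.1, hx⟩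

lemma isClosed_hull (t : Finset (Pt d)) : IsClosed (convexHull ℝ (t : Set (Pt d))) :=
  t.finite_toSet.isClosed_convexHull ℝ

lemma isClosed_space : IsClosed 𝓣.K.space := by
  unfold Geometry.SimplicialComplex.space
  exact 𝓣.finite.isClosed_biUnion fun t _ => isClosed_hull t

/-- The elements, together with the closure of the region that is not meshed. -/
def pieces : Option 𝓣.elements → Set (Pt d)
  | none => closure 𝓣.K.spaceᶜ
  | some t => convexHull ℝ (t.1 : Set (Pt d))

lemma isClosed_pieces (i) : IsClosed (𝓣.pieces i) := by
  cases i with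
  | none => exact isClosed_closure
  | some t => exact isClosed_hull _

lemma exists_mem_pieces (x : Pt d) : ∃ i, x ∈ 𝓣.pieces i := by
  by_cases hx : x ∈ 𝓣.K.space
  · obtain ⟨t, ht, hx⟩ := 𝓣.mem_space_iff.1 hx
    exact ⟨some ⟨t, ht⟩, hx⟩
  · exact ⟨none, subset_closure hx⟩

/-- A finite element function is affine on each element and zero on the closure of the unmeshed
region, and these are finitely many closed pieces covering the whole space. Global Lipschitz
continuity is what later permits integration by parts on all of ℝ^d without boundary terms. -/
lemma adm (v : 𝓣.space) : Adm Ω v := by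
  obtain ⟨v, hv, hv', hv0⟩ := v
  refine ⟨?_, fun x hx => hv0 x (Or.inl hx)⟩
  have : Finite 𝓣.elements := 𝓣.elements_finite
  have h : ∀ i, ∃ C, LipschitzOnWith C v (𝓣.pieces i) := by
    rintro (_ | ⟨t, ht⟩)
    · refine ⟨0, LipschitzOnWith.of_dist_le_mul fun x hx y hy => ?_⟩
      have h0 : ∀ x ∈ closure 𝓣.K.spaceᶜ, v x = 0 := fun x hx =>
        closure_minimal (fun y hy => hv0 y (Or.inr hy)) (isClosed_singleton.preimage hv) hx
      rw [h0 x hx, h0 y hy]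
      simp
    · obtain ⟨a, ha⟩ := hv' t ht
      exact ⟨_, fun x hx y hy => by
        rw [ha hx, ha hy]; exact (affineMap_lipschitz a) x y⟩
  choose C hC using h
  have := Fintype.ofFinite 𝓣.elements
  exact ⟨∑ i, C i, lipschitzWith_of_closed_cover hv 𝓣.isClosed_pieces 𝓣.exists_mem_pieces fun i =>
    (hC i).weaken (Finset.single_le_sum (fun _ _ => zero_le) (Finset.mem_univ i))⟩

lemma eq_of_eq_on_vertices {a b : Pt d →ᵃ[ℝ] ℝ} (s : Set (Pt d))
    (h : ∀ p ∈ s, a p = b p) {x : Pt d} (hx : x ∈ convexHull ℝ s) : a x = b x := by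
  have : Convex ℝ {x | (a - b) x ∈ ({0} : Set ℝ)} := (convex_singleton (0 : ℝ)).affine_preimage (a - b)
  have h2 := convexHull_min (fun p hp => by simp [h p hp]) this hx
  simpa [sub_eq_zero] using h2

/-- Evaluation at the finitely many vertices is injective on X_h. -/
instance : FiniteDimensional ℝ 𝓣.space := by
  let V := ⋃ t ∈ 𝓣.elements, (t : Set (Pt d))
  have hV : V.Finite := 𝓣.elements_finite.biUnion fun t _ => t.finite_toSet
  have : Finite V := hV
  let ev : 𝓣.space →ₗ[ℝ] (V → ℝ) :=
    { toFun := fun v p => (v : Pt d → ℝ) p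
      map_add' := fun _ _ => rfl
      map_smul' := fun _ _ => rfl }
  refine FiniteDimensional.of_injective ev ((injective_iff_map_eq_zero ev).2 fun v hv => ?_)
  ext x
  by_cases hx : x ∈ 𝓣.K.space
  · obtain ⟨t, ht, hx⟩ := 𝓣.mem_space_iff.1 hx
    obtain ⟨a, ha⟩ := v.2.2.1 t ht
    rw [ha hx]
    have := eq_of_eq_on_vertices (a := a) (b := 0) t (fun p hp => ?_) hx
    · simpa using this
    rw [← ha (subset_convexHull ℝ _ hp)]
    exact congrFun hv ⟨p, mem_biUnion ht hp⟩
  · exact v.2.2.2 x (Or.inr hx)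

end Mesh

/-! ### Gradients of admissible functions -/

lemma measurable_gradient {d : ℕ} (v : Pt d → ℝ) : Measurable (gradient v) :=
  (InnerProductSpace.toDual ℝ (Pt d)).symm.continuous.measurable.comp (measurable_fderiv ℝ v)

lemma norm_gradient {d : ℕ} (v : Pt d → ℝ) (x : Pt d) : ‖gradient v x‖ = ‖fderiv ℝ v x‖ :=
  LinearIsometryEquiv.norm_map _ _

lemma gradient_apply {d : ℕ} (v : Pt d → ℝ) (x : Pt d) (i : Fin d) :
    gradient v x i = fderiv ℝ v x (EuclideanSpace.single i 1) := by
  rw [← inner_gradient_left, EuclideanSpace.inner_single_right]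
  simp

namespace Adm

variable {d : ℕ} {Ω : Set (Pt d)} {v w : Pt d → ℝ}

lemma continuous (hv : Adm Ω v) : Continuous v := hv.1.choose_spec.continuous

lemma hasCompactSupport (hΩ : Bornology.IsBounded Ω) (hv : Adm Ω v) : HasCompactSupport v :=
  HasCompactSupport.of_support_subset_isCompact hΩ.isCompact_closure fun x hx =>
    subset_closure (by_contra fun h => hx (hv.2 x h))

lemma ae_differentiableAt (hv : Adm Ω v) : ∀ᵐ x, DifferentiableAt ℝ v x :=
  hv.1.choose_spec.ae_differentiableAt

lemma memLp (hΩ : Bornology.IsBounded Ω) (hv : Adm Ω v) : MemLp v 2 (volume.restrict Ω) :=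
  (hv.continuous.memLp_of_hasCompactSupport (hv.hasCompactSupport hΩ)).restrict _

lemma exists_gradient_le (hv : Adm Ω v) : ∃ C : ℝ, ∀ x, ‖gradient v x‖ ≤ C := by
  obtain ⟨C, hC⟩ := hv.1
  exact ⟨C, fun x => (norm_gradient v x).trans_le (norm_fderiv_le_of_lipschitz ℝ hC)⟩

lemma memLp_gradient (hΩ : Bornology.IsBounded Ω) (hv : Adm Ω v) :
    MemLp (gradient v) 2 (volume.restrict Ω) := by
  obtain ⟨C, hC⟩ := hv.exists_gradient_le
  have : IsFiniteMeasure (volume.restrict Ω) :=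
    isFiniteMeasure_restrict.2 hΩ.measure_lt_top.ne
  exact MemLp.of_bound (measurable_gradient v).aestronglyMeasurable C (ae_of_all _ hC)

lemma gradient_add (hv : Adm Ω v) (hw : Adm Ω w) :
    ∀ᵐ x, gradient (v + w) x = gradient v x + gradient w x := by
  filter_upwards [hv.ae_differentiableAt, hw.ae_differentiableAt] with x h1 h2
  simp [gradient, fderiv_add h1 h2]

lemma gradient_sub (hv : Adm Ω v) (hw : Adm Ω w) :
    ∀ᵐ x, gradient (v - w) x = gradient v x - gradient w x := by
  filter_upwards [hv.ae_differentiableAt, hw.ae_differentiableAt] with x h1 h2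
  simp [gradient, fderiv_sub h1 h2]

lemma gradient_smul (c : ℝ) (hv : Adm Ω v) :
    ∀ᵐ x, gradient (c • v) x = c • gradient v x := by
  filter_upwards [hv.ae_differentiableAt] with x h1
  simp [gradient, fderiv_const_smul h1]

end Adm

/-! ### Integration by parts for admissible functions -/

variable {d : ℕ} {Ω : Set (Pt d)}

/-- The bound on g is needed only on Ω: in the product rule, g can always be evaluated at a point of
Ω, because ψ vanishes at the other points. -/
lemma lipschitzWith_mul_of_support {g ψ : Pt d → ℝ} {A B C D : NNReal} (hg : LipschitzWith C g)
    (hψ : LipschitzWith D ψ) (hA : ∀ x ∈ Ω, |g x| ≤ A) (hB : ∀ x, |ψ x| ≤ B)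
    (h0 : ∀ x, x ∉ Ω → ψ x = 0) : LipschitzWith (A * D + B * C) fun x => g x * ψ x := by
  have key : ∀ x ∈ Ω, ∀ y, |g x * ψ x - g y * ψ y| ≤ (A * D + B * C) * dist x y := by
    intro x hx y
    have h1 := hg.dist_le_mul x y
    have h2 := hψ.dist_le_mul x y
    rw [Real.dist_eq] at h1 h2
    calc |g x * ψ x - g y * ψ y| = |g x * (ψ x - ψ y) + ψ y * (g x - g y)| := by ring_nf
      _ ≤ |g x| * |ψ x - ψ y| + |ψ y| * |g x - g y| := by
          rw [← abs_mul, ← abs_mul]; exact abs_add_le _ _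
      _ ≤ A * (D * dist x y) + B * (C * dist x y) := by
          gcongr
          · exact hA x hx
          · exact hB y
      _ = _ := by ring
  refine LipschitzWith.of_dist_le_mul fun x y => ?_
  rw [Real.dist_eq]
  push_cast
  by_cases hx : x ∈ Ω
  · exact key x hx y
  by_cases hy : y ∈ Ω
  · rw [abs_sub_comm, dist_comm]
    exact key y hy x
  rw [h0 x hx, h0 y hy]
  simp only [mul_zero, sub_zero, abs_zero]
  positivity

lemma Adm.exists_abs_le (hΩ : Bornology.IsBounded Ω) {v : Pt d → ℝ} (hv : Adm Ω v) :
    ∃ B : NNReal, ∀ x, |v x| ≤ B := by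
  obtain ⟨B, hB⟩ := hv.continuous.bounded_above_of_compact_support (hv.hasCompactSupport hΩ)
  exact ⟨B.toNNReal, fun x => (hB x).trans (Real.le_coe_toNNReal B)⟩

lemma Adm.lineDeriv_eq {v : Pt d → ℝ} (hv : Adm Ω v) (i : Fin d) :
    ∀ᵐ x, lineDeriv ℝ v x (EuclideanSpace.single i 1) = gradient v x i := by
  filter_upwards [hv.ae_differentiableAt] with x hx
  rw [gradient_apply, hx.lineDeriv_eq_fderiv]

lemma abs_coord_le (x : Pt d) (i : Fin d) : |x i| ≤ ‖x‖ := PiLp.norm_apply_le x i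

/-- Poincaré's inequality. -/
lemma poincare (hd : 0 < d) (hΩ : Bornology.IsBounded Ω) :
    ∃ C : ℝ, 0 ≤ C ∧ ∀ v : Pt d → ℝ, Adm Ω v →
      nrm (volume.restrict Ω) v ≤ C * nrm (volume.restrict Ω) (gradient v) := by
  obtain ⟨R, hR0, hR⟩ := hΩ.exists_pos_norm_le
  refine ⟨2 * R, by positivity, fun v hv => ?_⟩
  let i : Fin d := ⟨0, hd⟩
  let e : Pt d := EuclideanSpace.single i 1
  -- Since ∂ᵢxᵢ = 1, integration by parts gives ∫ v² = -∫ 2 xᵢ v ∂ᵢv, and |xᵢ| ≤ R on Ω yields ‖v‖²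
  -- ≤ 2R ‖v‖ ‖∇v‖. The extension of v by zero is Lipschitz with compact support, so no boundary
  -- term occurs.
  let f : Pt d → ℝ := fun x => x i
  have hf : LipschitzWith 1 f := LipschitzWith.of_dist_le_mul fun x y => by
    rw [Real.dist_eq, dist_eq_norm, NNReal.coe_one, one_mul]
    exact abs_coord_le (x - y) i
  obtain ⟨B, hB⟩ := hv.exists_abs_le hΩ
  obtain ⟨C, hC⟩ := hv.1
  have hg := lipschitzWith_mul_of_support (Ω := Ω) hC hC (fun x _ => hB x) hB hv.2
  have hgc : HasCompactSupport fun x => v x * v x := (hv.hasCompactSupport hΩ).mul_left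
  have ibp := LipschitzWith.integral_lineDeriv_mul_eq (μ := volume) hf hg hgc e
  have h1 : ∀ x, lineDeriv ℝ f x e = 1 := fun x => by
    have : HasLineDerivAt ℝ f 1 x e := by
      have h : (fun t : ℝ => f (x + t • e)) = fun t => x i + t := by
        ext t; simp [f, e]
      unfold HasLineDerivAt
      rw [h]
      simpa using (hasDerivAt_id (0 : ℝ)).const_add (x i)
    exact this.lineDeriv
  have h2 : ∀ᵐ x, lineDeriv ℝ (fun x => v x * v x) x (-e) * f x = -(2 * v x * gradient v x i * x i) := by
    filter_upwards [hv.ae_differentiableAt] with x hx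
    rw [(hx.fun_mul hx).lineDeriv_eq_fderiv, fderiv_fun_mul hx hx]
    simp only [map_neg, gradient_apply, e, f, add_apply,
      smul_apply, smul_eq_mul]
    ring
  simp only [h1, one_mul] at ibp
  rw [integral_congr_ae h2, ← setIntegral_eq_integral_of_forall_compl_eq_zero (s := Ω)
    (f := fun x => v x * v x) (fun x hx => by simp [hv.2 x hx]),
    ← setIntegral_eq_integral_of_forall_compl_eq_zero (s := Ω)
    (f := fun x => -(2 * v x * gradient v x i * x i)) (fun x hx => by simp [hv.2 x hx])] at ibp
  have h3 := l2_bound (μ := volume.restrict Ω) (hv.memLp hΩ) (hv.memLp_gradient hΩ)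
    (h := fun x => -(2 * v x * gradient v x i * x i)) (C := 2 * R)
    (((((hv.continuous.measurable.const_mul 2).mul
      ((EuclideanSpace.proj (𝕜 := ℝ) i).continuous.measurable.comp (measurable_gradient v))).mul
      (EuclideanSpace.proj (𝕜 := ℝ) i).continuous.measurable).neg).aestronglyMeasurable)
    (by positivity) (by
      have hcl : ∀ᵐ x ∂(volume.restrict Ω), ‖x‖ ≤ R := by
        have h5 : MeasurableSet {x : Pt d | ‖x‖ ≤ R} := measurableSet_le measurable_norm measurable_const
        exact ae_restrict_of_ae_restrict_of_subset (fun x hx => hR x hx)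
          (ae_restrict_mem h5)
      filter_upwards [hcl] with x hx
      rw [abs_neg, abs_mul, abs_mul, abs_mul, abs_two, Real.norm_eq_abs]
      have h4 := abs_coord_le (gradient v x) i
      have h5 := (abs_coord_le x i).trans hx
      calc 2 * |v x| * |gradient v x i| * |x i| ≤ 2 * |v x| * ‖gradient v x‖ * R := by gcongr
        _ = _ := by ring)
  rw [← ibp] at h3
  have h4 : nrm (volume.restrict Ω) v ^ 2 ≤
      2 * R * (nrm (volume.restrict Ω) v * nrm (volume.restrict Ω) (gradient v)) := by
    rw [sq_nrm]
    refine le_trans (le_of_eq ?_) ((le_abs_self _).trans h3.2)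
    simp only [Real.norm_eq_abs, sq, abs_mul_abs_self]
  rcases (nrm_nonneg (μ := volume.restrict Ω) v).eq_or_lt with h | h
  · rw [← h]
    exact mul_nonneg (by positivity) (nrm_nonneg _)
  · refine le_of_mul_le_mul_left ?_ h
    nlinarith

/-- A test function has a weak divergence `∇·(g∇φ)` that is bounded in terms of a bound and a
Lipschitz constant of `g`. -/
lemma IsTest.flux_bound (hΩ : Bornology.IsBounded Ω) (hΩm : MeasurableSet Ω)
    {φ : Pt d → ℝ} (hφ : IsTest Ω φ) (A L : NNReal) :
    ∃ C : ℝ, 0 ≤ C ∧ ∀ g : Pt d → ℝ, (∀ x ∈ Ω, |g x| ≤ A) → LipschitzOnWith L g Ω →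
      ∀ v, Adm Ω v →
        |∫ x in Ω, g x * inner ℝ (gradient φ x) (gradient v x)| ≤
          C * nrm (volume.restrict Ω) v := by
  have hφs : ∀ x, x ∉ Ω → fderiv ℝ φ x = 0 := fun x hx => by
    have : x ∉ tsupport (fderiv ℝ φ) := fun h => hx (hφ.2.2 (tsupport_fderiv_subset ℝ h))
    exact image_eq_zero_of_notMem_tsupport this
  let ψ : Fin d → Pt d → ℝ := fun i x => fderiv ℝ φ x (EuclideanSpace.single i 1)
  have hψc : ∀ i, ContDiff ℝ 1 (ψ i) := fun i =>
    (hφ.1.fderiv_right (m := 1) (by norm_cast)).clm_apply contDiff_const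
  have hψs : ∀ i, HasCompactSupport (ψ i) := fun i =>
    (hφ.2.1.fderiv (𝕜 := ℝ)).comp_left (g := fun T : Pt d →L[ℝ] ℝ => T (EuclideanSpace.single i 1))
      (by simp)
  have hψa : ∀ i, Adm Ω (ψ i) := fun i =>
    ⟨(hψc i).lipschitzWith_of_hasCompactSupport (hψs i) (by norm_num),
      fun x hx => by simp [ψ, hφs x hx]⟩
  choose B hB using fun i => (hψa i).exists_abs_le hΩ
  choose D hD using fun i => (hψa i).1
  have : IsFiniteMeasure (volume.restrict Ω) := isFiniteMeasure_restrict.2 hΩ.measure_lt_top.ne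
  let n1 := nrm (volume.restrict Ω) (fun _ => (1 : ℝ))
  -- The constant is fixed before g is: the coefficient to which this applies depends on the
  -- discrete solution, and only its bounds A and L are uniform.
  refine ⟨∑ i, (A * D i + B i * L : NNReal) * n1,
    Finset.sum_nonneg fun i _ => mul_nonneg (by positivity) (nrm_nonneg _), fun g hgA hgL v hv => ?_⟩
  -- Integration by parts takes place on the whole space, so g is replaced by a global Lipschitz
  -- extension. The extension need not obey the bound A outside Ω, but ∂ᵢφ vanishes there.
  obtain ⟨G, hG, hGe⟩ := hgL.extend_real
  have hF : ∀ i, LipschitzWith (A * D i + B i * L) fun x => G x * ψ i x := fun i =>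
    lipschitzWith_mul_of_support (Ω := Ω) hG (hD i) (fun x hx => by rw [← hGe hx]; exact hgA x hx)
      (hB i) (hψa i).2
  have hFa : ∀ i, Adm Ω fun x => G x * ψ i x := fun i =>
    ⟨⟨_, hF i⟩, fun x hx => by simp [(hψa i).2 x hx]⟩
  obtain ⟨Cv, hCv⟩ := hv.1
  have hcv : Measurable (gradient v) := measurable_gradient v
  have hmi : ∀ i : Fin d, Measurable fun x => gradient v x i := fun i =>
    (EuclideanSpace.proj (𝕜 := ℝ) i).continuous.measurable.comp hcv
  have e1 : ∀ x, g x * inner ℝ (gradient φ x) (gradient v x) =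
      g x * ∑ i, ψ i x * gradient v x i := fun x => by
    congr 1
    simp only [PiLp.inner_apply, ψ, ← gradient_apply, RCLike.inner_apply, conj_trivial]
    exact Finset.sum_congr rfl fun i _ => mul_comm _ _
  have e3 : ∫ x in Ω, g x * inner ℝ (gradient φ x) (gradient v x) =
      ∫ x in Ω, ∑ i, (G x * ψ i x) * gradient v x i :=
    setIntegral_congr_fun hΩm fun x hx => by
      beta_reduce
      rw [e1, hGe hx, Finset.mul_sum]
      simp only [mul_assoc]
  rw [e3, integral_finsetSum]
  swap
  · intro i _
    refine (l2_bound ((hFa i).memLp hΩ) (hv.memLp_gradient hΩ)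
      (((hFa i).continuous.measurable.mul (hmi i)).aestronglyMeasurable) zero_le_one
      (ae_of_all _ fun x => ?_)).1
    rw [one_mul, Pi.mul_apply, abs_mul]
    refine mul_le_mul le_rfl ?_ (abs_nonneg _) (norm_nonneg _)
    exact abs_coord_le _ i
  rw [Finset.sum_mul]
  refine (Finset.abs_sum_le_sum_abs _ _).trans (Finset.sum_le_sum fun i _ => ?_)
  rw [setIntegral_eq_integral_of_forall_compl_eq_zero
    (fun x hx => by simp [(hψa i).2 x hx])]
  have e4 : ∫ x, (G x * ψ i x) * gradient v x i =
      ∫ x, lineDeriv ℝ v x (EuclideanSpace.single i 1) * (G x * ψ i x) :=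
    integral_congr_ae ((hv.lineDeriv_eq i).mono fun x hx => by simp only [hx, mul_comm])
  rw [e4, LipschitzWith.integral_lineDeriv_mul_eq (μ := volume) hCv (hF i)
    ((hFa i).hasCompactSupport hΩ), ← setIntegral_eq_integral_of_forall_compl_eq_zero (s := Ω)
    (fun x hx => by simp [hv.2 x hx]), mul_assoc]
  refine (l2_bound (memLp_const (1 : ℝ)) (hv.memLp hΩ)
    (((measurable_lineDeriv (hFa i).continuous).mul
      hv.continuous.measurable).aestronglyMeasurable) (by positivity) (ae_of_all _ fun x => ?_)).2
  rw [Pi.mul_apply, abs_mul, norm_one, one_mul]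
  refine mul_le_mul ?_ le_rfl (abs_nonneg _) (NNReal.coe_nonneg _)
  · have := norm_lineDeriv_le_of_lipschitz ℝ (hF i) (x₀ := x) (v := -EuclideanSpace.single i (1 : ℝ))
    simpa using this

/-! ### Bilinear forms on the finite element space -/

namespace Problem

variable {d : ℕ} (P : Problem d)

/-- The norm of `L²(Ω)`. -/
noncomputable def nr {E : Type*} [NormedAddCommGroup E] (F : Pt d → E) : ℝ :=
  nrm (volume.restrict P.Ω) F

lemma nr_nonneg {E : Type*} [NormedAddCommGroup E] (F : Pt d → E) : 0 ≤ P.nr F := nrm_nonneg F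

lemma sq_nr_gradient (v : Pt d → ℝ) : P.nr (gradient v) ^ 2 = P.gradSq v := sq_nrm _

lemma gradSq_nonneg (v : Pt d → ℝ) : 0 ≤ P.gradSq v := by
  rw [← sq_nr_gradient]; positivity

lemma ip_self (v : Pt d → ℝ) : P.ip v v = P.nr v ^ 2 := by
  unfold nr
  rw [sq_nrm]
  simp only [ip, Real.norm_eq_abs, sq, abs_mul_abs_self]

lemma ip_comm (v w : Pt d → ℝ) : P.ip v w = P.ip w v := by
  simp only [ip, mul_comm]

/-- Bounded measurable coefficients. -/
def IsCoeff (g : Pt d → ℝ) (A : ℝ) : Prop :=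
  0 ≤ A ∧ AEStronglyMeasurable g (volume.restrict P.Ω) ∧ ∀ᵐ x ∂(volume.restrict P.Ω), |g x| ≤ A

variable {P} in
lemma IsCoeff.bound {g : Pt d → ℝ} {A : ℝ} (hg : P.IsCoeff g A) {F G : Pt d → Pt d}
    (hF : MemLp F 2 (volume.restrict P.Ω)) (hG : MemLp G 2 (volume.restrict P.Ω)) :
    Integrable (fun x => g x * inner ℝ (F x) (G x)) (volume.restrict P.Ω) ∧
      |∫ x in P.Ω, g x * inner ℝ (F x) (G x)| ≤ A * (P.nr F * P.nr G) := by
  refine l2_bound hF hG (hg.2.1.mul (hF.1.inner hG.1)) hg.1 (hg.2.2.mono fun x hx => ?_)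
  rw [Pi.mul_apply, abs_mul]
  exact mul_le_mul hx (abs_real_inner_le_norm _ _) (abs_nonneg _) hg.1

lemma ip_bound {v w : Pt d → ℝ} (hv : MemLp v 2 (volume.restrict P.Ω))
    (hw : MemLp w 2 (volume.restrict P.Ω)) :
    Integrable (fun x => v x * w x) (volume.restrict P.Ω) ∧ |P.ip v w| ≤ P.nr v * P.nr w := by
  have := l2_bound hv hw (hv.1.mul hw.1) zero_le_one (ae_of_all _ fun x => by
    rw [Pi.mul_apply, abs_mul, one_mul]; exact le_rfl)
  rw [one_mul] at this
  exact this

variable (𝓣 : Mesh P.Ω)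

/-- `(v, w)` as a bilinear form on the finite element space. -/
noncomputable def ipForm (hb : Bornology.IsBounded P.Ω) : 𝓣.space →ₗ[ℝ] 𝓣.space →ₗ[ℝ] ℝ :=
  have hi (v w : 𝓣.space) := (P.ip_bound ((𝓣.adm v).memLp hb) ((𝓣.adm w).memLp hb)).1
  LinearMap.mk₂ ℝ (fun v w => P.ip v w)
    (fun u v w => by
      rw [ip, ip, ip, ← integral_add (hi u w) (hi v w)]
      exact integral_congr_ae (ae_of_all _ fun x => by simp [add_mul]))
    (fun c v w => by
      rw [ip, ip, smul_eq_mul, ← integral_const_mul]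
      exact integral_congr_ae (ae_of_all _ fun x => by simp [mul_assoc]))
    (fun u v w => by
      rw [ip, ip, ip, ← integral_add (hi u v) (hi u w)]
      exact integral_congr_ae (ae_of_all _ fun x => by simp [mul_add]))
    (fun c v w => by
      rw [ip, ip, smul_eq_mul, ← integral_const_mul]
      exact integral_congr_ae (ae_of_all _ fun x => by simp [mul_left_comm]))

/-- `(g F, ∇w)` as a linear functional on the finite element space. -/
noncomputable def fluxForm (hb : Bornology.IsBounded P.Ω) {g : Pt d → ℝ} {A : ℝ}
    (hg : P.IsCoeff g A) {F : Pt d → Pt d} (hF : MemLp F 2 (volume.restrict P.Ω)) :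
    𝓣.space →ₗ[ℝ] ℝ where
  toFun w := ∫ x in P.Ω, g x * inner ℝ (F x) (gradient (w : Pt d → ℝ) x)
  map_add' v w := by
    rw [← integral_add (hg.bound hF ((𝓣.adm v).memLp_gradient hb)).1
      (hg.bound hF ((𝓣.adm w).memLp_gradient hb)).1]
    refine integral_congr_ae ?_
    filter_upwards [ae_restrict_of_ae ((𝓣.adm v).gradient_add (𝓣.adm w))] with x hx
    rw [Submodule.coe_add, hx, inner_add_right, mul_add]
  map_smul' c w := by
    rw [RingHom.id_apply, smul_eq_mul, ← integral_const_mul]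
    refine integral_congr_ae ?_
    filter_upwards [ae_restrict_of_ae ((𝓣.adm w).gradient_smul c)] with x hx
    rw [Submodule.coe_smul, hx, inner_smul_right, mul_left_comm]

/-- `(g ∇v, ∇w)` as a bilinear form on the finite element space. -/
noncomputable def gradForm (hb : Bornology.IsBounded P.Ω) {g : Pt d → ℝ} {A : ℝ}
    (hg : P.IsCoeff g A) : 𝓣.space →ₗ[ℝ] 𝓣.space →ₗ[ℝ] ℝ where
  toFun v := P.fluxForm 𝓣 hb hg ((𝓣.adm v).memLp_gradient hb)
  map_add' u v := by
    ext w
    simp only [fluxForm, LinearMap.coe_mk, AddHom.coe_mk, LinearMap.add_apply]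
    rw [← integral_add (hg.bound ((𝓣.adm u).memLp_gradient hb) ((𝓣.adm w).memLp_gradient hb)).1
      (hg.bound ((𝓣.adm v).memLp_gradient hb) ((𝓣.adm w).memLp_gradient hb)).1]
    refine integral_congr_ae ?_
    filter_upwards [ae_restrict_of_ae ((𝓣.adm u).gradient_add (𝓣.adm v))] with x hx
    rw [Submodule.coe_add, hx, inner_add_left, mul_add]
  map_smul' c v := by
    ext w
    simp only [fluxForm, LinearMap.coe_mk, AddHom.coe_mk, LinearMap.smul_apply, RingHom.id_apply,
      smul_eq_mul]
    rw [← integral_const_mul]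
    refine integral_congr_ae ?_
    filter_upwards [ae_restrict_of_ae ((𝓣.adm v).gradient_smul c)] with x hx
    rw [Submodule.coe_smul, hx, inner_smul_left, mul_left_comm]
    rfl

lemma gradForm_apply (hb : Bornology.IsBounded P.Ω) {g : Pt d → ℝ} {A : ℝ}
    (hg : P.IsCoeff g A) (v w : 𝓣.space) : P.gradForm 𝓣 hb hg v w =
      ∫ x in P.Ω, g x * inner ℝ (gradient (v : Pt d → ℝ) x) (gradient (w : Pt d → ℝ) x) := rfl

lemma gradForm_comm (hb : Bornology.IsBounded P.Ω) {g : Pt d → ℝ} {A : ℝ}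
    (hg : P.IsCoeff g A) (v w : 𝓣.space) :
    P.gradForm 𝓣 hb hg v w = P.gradForm 𝓣 hb hg w v := by
  simp only [gradForm_apply, real_inner_comm]

lemma abs_gradForm_le (hb : Bornology.IsBounded P.Ω) {g : Pt d → ℝ} {A : ℝ}
    (hg : P.IsCoeff g A) (v w : 𝓣.space) : |P.gradForm 𝓣 hb hg v w| ≤
      A * (P.nr (gradient (v : Pt d → ℝ)) * P.nr (gradient (w : Pt d → ℝ))) :=
  (hg.bound ((𝓣.adm v).memLp_gradient hb) ((𝓣.adm w).memLp_gradient hb)).2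

variable {P} in
lemma IsCoeff.le_integral {g : Pt d → ℝ} {A m : ℝ} (hg : P.IsCoeff g A)
    (hm : ∀ᵐ x ∂(volume.restrict P.Ω), m ≤ g x) {F : Pt d → Pt d}
    (hF : MemLp F 2 (volume.restrict P.Ω)) :
    m * P.nr F ^ 2 ≤ ∫ x in P.Ω, g x * inner ℝ (F x) (F x) := by
  unfold nr
  rw [sq_nrm, ← integral_const_mul]
  refine integral_mono_ae ((integrable_sq_norm hF).const_mul m) (hg.bound hF hF).1 ?_
  filter_upwards [hm] with x hx
  rw [real_inner_self_eq_norm_sq]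
  gcongr

/-- Ellipticity of `(g ∇v, ∇w)`. -/
lemma le_gradForm (hb : Bornology.IsBounded P.Ω) {g : Pt d → ℝ} {A m : ℝ}
    (hg : P.IsCoeff g A) (hm : ∀ᵐ x ∂(volume.restrict P.Ω), m ≤ g x) (v : 𝓣.space) :
    m * P.nr (gradient (v : Pt d → ℝ)) ^ 2 ≤ P.gradForm 𝓣 hb hg v v :=
  hg.le_integral hm ((𝓣.adm v).memLp_gradient hb)

variable {𝓣} in
-- A continuous nonnegative function with zero integral vanishes everywhere; v² is one, as v is
-- continuous and zero outside Ω.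
lemma eq_zero_of_nr_eq_zero (hb : Bornology.IsBounded P.Ω) (v : 𝓣.space)
    (h : P.nr (v : Pt d → ℝ) = 0) : v = 0 := by
  have h1 : ∫ x in P.Ω, (v : Pt d → ℝ) x ^ 2 = 0 := by
    have := sq_nrm (μ := volume.restrict P.Ω) (v : Pt d → ℝ)
    change P.nr _ ^ 2 = _ at this
    rw [h] at this
    simpa using this.symm
  rw [setIntegral_eq_integral_of_forall_compl_eq_zero
    (fun x hx => by simp [(𝓣.adm v).2 x hx])] at h1
  have hc := (𝓣.adm v).continuous
  ext x
  by_contra hx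
  have h3 : HasCompactSupport fun x => (v : Pt d → ℝ) x ^ 2 :=
    ((𝓣.adm v).hasCompactSupport hb).comp_left (g := fun t : ℝ => t ^ 2) (by simp)
  have := (hc.pow 2).integral_pos_of_hasCompactSupport_nonneg_nonzero (μ := volume) (x := x) h3
    (fun x => sq_nonneg _) (pow_ne_zero 2 hx)
  exact this.ne' h1

end Problem

/-- A bilinear form on a finite-dimensional space with `A v v > 0` for `v ≠ 0` represents every
linear functional. -/
lemma existsUnique_of_pos {V : Type*} [AddCommGroup V] [Module ℝ V] [FiniteDimensional ℝ V]
    (A : V →ₗ[ℝ] V →ₗ[ℝ] ℝ) (hA : ∀ v, v ≠ 0 → 0 < A v v) (ℓ : V →ₗ[ℝ] ℝ) :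
    ∃! w, ∀ v, A w v = ℓ v := by
  have hinj : Function.Injective A := (injective_iff_map_eq_zero A).2 fun v hv => by
    by_contra h
    have := hA v h
    rw [hv] at this
    simp at this
  have hsurj : Function.Surjective A :=
    (LinearMap.injective_iff_surjective_of_finrank_eq_finrank
      (Subspace.dual_finrank_eq (K := ℝ) (V := V)).symm).1 hinj
  obtain ⟨w, hw⟩ := hsurj ℓ
  refine ⟨w, fun v => by rw [hw], fun w' hw' => hinj ?_⟩
  rw [hw]
  ext v
  exact hw' v

namespace Problem

variable {d : ℕ} (P : Problem d)

/-! ### The memory form -/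

/-- Smooth coefficients on the closed cylinder are bounded there, and Lipschitz continuous. -/
lemma exists_bounds_of_contDiffOn (hP : P.Standing) {F : Pt d × ℝ × ℝ → ℝ}
    (hF : ContDiffOn ℝ ∞ F P.cylinder) :
    ∃ β : NNReal, (∀ p ∈ P.cylinder, |F p| ≤ β) ∧ LipschitzOnWith β F P.cylinder := by
  obtain ⟨_, _, hconv, hb, _, _, _⟩ := hP
  have hcomp : IsCompact P.cylinder := hb.isCompact_closure.prod (isCompact_Icc.prod isCompact_Icc)
  have hcv : Convex ℝ P.cylinder := hconv.closure.prod ((convex_Icc _ _).prod (convex_Icc _ _))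
  obtain ⟨C, hC⟩ := hcomp.exists_bound_of_continuousOn hF.continuousOn
  -- On the closed cylinder differentiability is meant within the set, so convexity is needed to
  -- turn it into a local Lipschitz bound; compactness then makes the constant global.
  have hloc : LocallyLipschitzOn P.cylinder F := fun p hp =>
    ((hF p hp).of_le (by exact_mod_cast le_top)).exists_lipschitzOnWith hcv
  obtain ⟨K, hK⟩ := hloc.exists_lipschitzOnWith_of_compact hcomp
  refine ⟨max C.toNNReal K, fun p hp => (hC p hp).trans ?_, hK.weaken (le_max_right _ _)⟩
  exact (Real.le_coe_toNNReal C).trans (by exact_mod_cast le_max_left _ _)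

/-- A common bound for all coefficients of the memory form on the closed cylinder, and a common
Lipschitz constant in space for `b₁`. -/
lemma exists_memory_bounds (hP : P.Standing) (h3 : P.H3) :
    ∃ β : NNReal, ∀ t ∈ Icc 0 P.T, ∀ s ∈ Icc 0 P.T,
      (∀ x ∈ closure P.Ω, (∀ i j, |P.b₂ x t s i j| ≤ β) ∧ (∀ j, |P.b₁ x t s j| ≤ β) ∧
        |P.b₀ x t s| ≤ β) ∧
      ∀ j, LipschitzOnWith β (fun x => P.b₁ x t s j) (closure P.Ω) := by
  obtain ⟨-, h2, h1, h0⟩ := h3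
  choose β₂ hβ₂ _ using fun i j => P.exists_bounds_of_contDiffOn hP (h2 i j)
  choose β₁ hβ₁ hL₁ using fun j => P.exists_bounds_of_contDiffOn hP (h1 j)
  obtain ⟨β₀, hβ₀, _⟩ := P.exists_bounds_of_contDiffOn hP h0
  let β : NNReal := (∑ i, ∑ j, β₂ i j) + (∑ j, β₁ j) + β₀
  have e2 : ∀ i j, β₂ i j ≤ β := fun i j =>
    ((Finset.single_le_sum (f := fun j => β₂ i j) (fun _ _ => zero_le) (Finset.mem_univ j)).trans
      (Finset.single_le_sum (f := fun i => ∑ j, β₂ i j) (fun _ _ => zero_le)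
        (Finset.mem_univ i))).trans (le_self_add.trans le_self_add)
  have e1 : ∀ j, β₁ j ≤ β := fun j =>
    (Finset.single_le_sum (f := fun j => β₁ j) (fun _ _ => zero_le) (Finset.mem_univ j)).trans
      (le_add_self.trans le_self_add)
  have e0 : β₀ ≤ β := le_add_self
  refine ⟨β, fun t ht s hs => ⟨fun x hx => ⟨fun i j => ?_, fun j => ?_, ?_⟩, fun j x hx y hy => ?_⟩⟩
  · exact (hβ₂ i j (x, t, s) ⟨hx, ht, hs⟩).trans (by exact_mod_cast e2 i j)
  · exact (hβ₁ j (x, t, s) ⟨hx, ht, hs⟩).trans (by exact_mod_cast e1 j)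
  · exact (hβ₀ (x, t, s) ⟨hx, ht, hs⟩).trans (by exact_mod_cast e0)
  · have := ((hL₁ j).weaken (e1 j)) (x := (x, t, s)) ⟨hx, ht, hs⟩ (y := (y, t, s)) ⟨hy, ht, hs⟩
    simpa [Prod.edist_eq] using this

/-- The integrands of the three terms of the memory form. -/
noncomputable def memoryIntegrand (t s : ℝ) (v w : Pt d → ℝ) : Fin 3 → Pt d → ℝ :=
  ![fun x => ∑ i, ∑ j, P.b₂ x t s i j * gradient v x j * gradient w x i,
    fun x => (∑ j, fderiv ℝ (fun y => P.b₁ y t s j * v y) x (EuclideanSpace.single j 1)) * w x,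
    fun x => P.b₀ x t s * v x * w x]

lemma B_eq (t s : ℝ) (v w : Pt d → ℝ) :
    P.B t s v w = ∑ i, ∫ x in P.Ω, P.memoryIntegrand t s v w i x := by
  simp [Fin.sum_univ_three, B, memoryIntegrand]

lemma aestronglyMeasurable_memoryIntegrand (hP : P.Standing) (h3 : P.H3) {t s : ℝ}
    (ht : t ∈ Icc 0 P.T) (hs : s ∈ Icc 0 P.T) {v w : Pt d → ℝ} (hv : Adm P.Ω v) (hw : Adm P.Ω w)
    (i : Fin 3) :
    AEStronglyMeasurable (P.memoryIntegrand t s v w i) (volume.restrict P.Ω) := by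
  have hm : MeasurableSet P.Ω := hP.2.1.measurableSet
  have slice : ∀ {F : Pt d × ℝ × ℝ → ℝ}, ContDiffOn ℝ ∞ F P.cylinder →
      AEStronglyMeasurable (fun x => F (x, t, s)) (volume.restrict P.Ω) := fun hF =>
    ContinuousOn.aestronglyMeasurable ((hF.continuousOn.comp (by fun_prop)
      fun x hx => ⟨subset_closure hx, ht, hs⟩)) hm
  have hg : ∀ (v : Pt d → ℝ) (i : Fin d),
      AEStronglyMeasurable (fun x => gradient v x i) (volume.restrict P.Ω) := fun v i =>
    ((EuclideanSpace.proj (𝕜 := ℝ) i).continuous.measurable.comp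
      (measurable_gradient v)).aestronglyMeasurable
  have hvm := hv.continuous.aestronglyMeasurable (μ := volume.restrict P.Ω)
  have hwm := hw.continuous.aestronglyMeasurable (μ := volume.restrict P.Ω)
  fin_cases i
  · change AEStronglyMeasurable
      (fun x => ∑ i, ∑ j, P.b₂ x t s i j * gradient v x j * gradient w x i) _
    refine Finset.aestronglyMeasurable_fun_sum _ fun i _ =>
      Finset.aestronglyMeasurable_fun_sum _ fun j _ => ?_
    exact ((slice (h3.2.1 i j)).mul (hg v j)).mul (hg w i)
  · refine AEStronglyMeasurable.mul (Finset.aestronglyMeasurable_fun_sum _ fun j _ => ?_) hwm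
    exact (measurable_fderiv_apply_const ℝ _ _).aestronglyMeasurable
  · exact ((slice h3.2.2.2).mul hvm).mul hwm

/-- The memory form is bounded on `H¹`, uniformly in time. -/
lemma exists_memory_le (hP : P.Standing) (h3 : P.H3) : ∃ C : ℝ, 0 ≤ C ∧ ∀ t ∈ Icc 0 P.T,
    ∀ s ∈ Icc 0 P.T, ∀ v w : Pt d → ℝ, Adm P.Ω v → Adm P.Ω w →
      (∀ i, Integrable (P.memoryIntegrand t s v w i) (volume.restrict P.Ω)) ∧
      |P.B t s v w| ≤ C * ((P.nr (gradient v) + P.nr v) * (P.nr (gradient w) + P.nr w)) := by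
  obtain ⟨β, hβ⟩ := P.exists_memory_bounds hP h3
  have ho := hP.2.1
  have hb := hP.2.2.2.1
  -- The three integrands need the constants d²β, dβ and β; their sum serves for all of them.
  have key : ∀ t ∈ Icc 0 P.T, ∀ s ∈ Icc 0 P.T, ∀ v w : Pt d → ℝ, Adm P.Ω v → Adm P.Ω w →
      ∀ i, ∀ᵐ x ∂(volume.restrict P.Ω), |P.memoryIntegrand t s v w i x| ≤
        ((d * d + d + 1) * β : ℝ) *
          (‖(‖gradient v x‖ + ‖v x‖)‖ * ‖(‖gradient w x‖ + ‖w x‖)‖) := by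
    intro t ht s hs v w hv hw i
    obtain ⟨hβ1, hβ2⟩ := hβ t ht s hs
    filter_upwards [ae_restrict_mem ho.measurableSet, ae_restrict_of_ae hv.ae_differentiableAt]
      with x hx hvx
    obtain ⟨hb2, hb1, hb0⟩ := hβ1 x (subset_closure hx)
    have nv := norm_nonneg (gradient v x)
    have nw := norm_nonneg (gradient w x)
    have nv' := norm_nonneg (v x)
    have nw' := norm_nonneg (w x)
    rw [Real.norm_of_nonneg (add_nonneg nv nv'), Real.norm_of_nonneg (add_nonneg nw nw')]
    have hd0 : (0 : ℝ) ≤ d := Nat.cast_nonneg d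
    have hβ0 : (0 : ℝ) ≤ β := β.2
    fin_cases i
    · change |∑ i, ∑ j, P.b₂ x t s i j * gradient v x j * gradient w x i| ≤ _
      calc _ ≤ ∑ i : Fin d, ∑ j : Fin d, |P.b₂ x t s i j * gradient v x j * gradient w x i| :=
            (Finset.abs_sum_le_sum_abs _ _).trans
              (Finset.sum_le_sum fun i _ => Finset.abs_sum_le_sum_abs _ _)
        _ ≤ ∑ i : Fin d, ∑ j : Fin d, β * ‖gradient v x‖ * ‖gradient w x‖ := by
            refine Finset.sum_le_sum fun i _ => Finset.sum_le_sum fun j _ => ?_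
            rw [abs_mul, abs_mul]
            gcongr
            · exact hb2 i j
            · exact abs_coord_le _ _
            · exact abs_coord_le _ _
        _ = (d * d * β) * (‖gradient v x‖ * ‖gradient w x‖) := by simp; ring
        _ ≤ _ := by
            gcongr
            · nlinarith
            · linarith
            · linarith
    · change |(∑ j, fderiv ℝ (fun y => P.b₁ y t s j * v y) x (EuclideanSpace.single j 1)) * w x| ≤ _
      -- At a point of Ω smoothness within Ω̄ is ordinary smoothness, so the product rule for ∂ⱼ(b₁ⱼ
      -- v) holds wherever v is differentiable.
      have hx' : closure P.Ω ∈ 𝓝 x := mem_of_superset (ho.mem_nhds hx) subset_closure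
      have hj : ∀ j, |fderiv ℝ (fun y => P.b₁ y t s j * v y) x (EuclideanSpace.single j 1)| ≤
          β * (‖gradient v x‖ + ‖v x‖) := by
        intro j
        have hbd : DifferentiableAt ℝ (fun y => P.b₁ y t s j) x := by
          have h4 : ContDiffOn ℝ ∞ (fun y => P.b₁ y t s j) (closure P.Ω) :=
            (h3.2.2.1 j).comp (f := fun y : Pt d => (y, t, s)) (by fun_prop)
              (fun y hy => ⟨hy, ht, hs⟩)
          exact (h4.contDiffAt hx').differentiableAt (by simp)
        rw [fderiv_fun_mul hbd hvx]
        simp only [add_apply, smul_apply, smul_eq_mul, ← gradient_apply]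
        have h5 : |gradient (fun y => P.b₁ y t s j) x j| ≤ β :=
          ((abs_coord_le _ j).trans_eq (norm_gradient _ _)).trans
            (norm_fderiv_le_of_lipschitzOn ℝ hx' (hβ2 j))
        refine (abs_add_le _ _).trans ?_
        rw [abs_mul, abs_mul, mul_add, mul_comm (β : ℝ) ‖v x‖]
        gcongr
        · exact hb1 j
        · exact abs_coord_le _ _
        · exact le_rfl
      rw [abs_mul]
      calc _ ≤ (∑ j : Fin d, β * (‖gradient v x‖ + ‖v x‖)) * |w x| := by
            gcongr
            exact (Finset.abs_sum_le_sum_abs _ _).trans (Finset.sum_le_sum fun j _ => hj j)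
        _ = (d * β) * ((‖gradient v x‖ + ‖v x‖) * ‖w x‖) := by
            simp; ring
        _ ≤ _ := by
            gcongr
            · nlinarith
            · linarith
    · change |P.b₀ x t s * v x * w x| ≤ _
      rw [abs_mul, abs_mul]
      calc _ ≤ β * |v x| * |w x| := by gcongr
        _ = β * (‖v x‖ * ‖w x‖) := by rw [mul_assoc]; rfl
        _ ≤ _ := by
            gcongr
            · nlinarith
            · linarith
            · linarith
  refine ⟨3 * ((d * d + d + 1) * β), by positivity, fun t ht s hs v w hv hw => ?_⟩
  have hL : ∀ {u : Pt d → ℝ}, Adm P.Ω u →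
      MemLp (fun x => ‖gradient u x‖ + ‖u x‖) 2 (volume.restrict P.Ω) := fun hu =>
    (hu.memLp_gradient hb).norm.add (hu.memLp hb).norm
  have hN : ∀ {u : Pt d → ℝ}, Adm P.Ω u →
      P.nr (fun x => ‖gradient u x‖ + ‖u x‖) ≤ P.nr (gradient u) + P.nr u := fun hu => by
    refine (nrm_add_le (hu.memLp_gradient hb).norm (hu.memLp hb).norm).trans (le_of_eq ?_)
    simp [nr, nrm]
  have hall := fun i => l2_bound (hL hv) (hL hw)
    (P.aestronglyMeasurable_memoryIntegrand hP h3 ht hs hv hw i) (by positivity)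
    (key t ht s hs v w hv hw i)
  refine ⟨fun i => (hall i).1, ?_⟩
  rw [B_eq]
  calc _ ≤ ∑ i : Fin 3, ((d * d + d + 1) * β : ℝ) *
        ((P.nr (gradient v) + P.nr v) * (P.nr (gradient w) + P.nr w)) := by
        refine (Finset.abs_sum_le_sum_abs _ _).trans (Finset.sum_le_sum fun i _ =>
          (hall i).2.trans ?_)
        refine mul_le_mul_of_nonneg_left (mul_le_mul (hN hv) (hN hw) (nrm_nonneg _)
          (add_nonneg (nrm_nonneg _) (nrm_nonneg _))) (by positivity)
    _ = _ := by simp; ring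

/-- The memory form as a linear functional of the test function. -/
noncomputable def memoryForm (𝓣 : Mesh P.Ω) (hP : P.Standing) (h3 : P.H3) {t s : ℝ}
    (ht : t ∈ Icc 0 P.T) (hs : s ∈ Icc 0 P.T) (v : 𝓣.space) : 𝓣.space →ₗ[ℝ] ℝ :=
  have hi (w : 𝓣.space) :=
    ((P.exists_memory_le hP h3).choose_spec.2 t ht s hs v w (𝓣.adm v) (𝓣.adm w)).1
  { toFun := fun w => P.B t s v w
    map_add' := fun u w => by
      simp only [B_eq]
      rw [← Finset.sum_add_distrib]
      refine Finset.sum_congr rfl fun i _ => ?_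
      rw [← integral_add (hi u i) (hi w i)]
      refine integral_congr_ae ?_
      filter_upwards [ae_restrict_of_ae ((𝓣.adm u).gradient_add (𝓣.adm w))] with x hx
      fin_cases i
      · simp [memoryIntegrand, hx, mul_add, Finset.sum_add_distrib]
      · simp [memoryIntegrand, mul_add]
      · simp [memoryIntegrand, mul_add]
    map_smul' := fun c w => by
      simp only [B_eq]
      rw [RingHom.id_apply, smul_eq_mul, Finset.mul_sum]
      refine Finset.sum_congr rfl fun i _ => ?_
      rw [← integral_const_mul]
      refine integral_congr_ae ?_
      filter_upwards [ae_restrict_of_ae ((𝓣.adm w).gradient_smul c)] with x hx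
      fin_cases i
      · simp [memoryIntegrand, hx, Finset.mul_sum, mul_left_comm]
      · simp [memoryIntegrand, mul_left_comm]
      · simp [memoryIntegrand, mul_left_comm] }

end Problem

namespace Problem

variable {d : ℕ} (P : Problem d)

/-! ### The diffusion coefficient -/

/-- Bounds for the diffusion coefficient on `Ω̄ × [0,T] × [0,∞)`. -/
structure Elliptic (m₀ L A : ℝ) : Prop where
  pos : 0 < m₀
  L_nonneg : 0 ≤ L
  A_nonneg : 0 ≤ A
  lower : ∀ x ∈ closure P.Ω, ∀ t ∈ Icc 0 P.T, ∀ s, 0 ≤ s → m₀ ≤ P.M x t s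
  lip_space : ∀ x ∈ closure P.Ω, ∀ x' ∈ closure P.Ω, ∀ t ∈ Icc 0 P.T, ∀ s, 0 ≤ s →
    |P.M x t s - P.M x' t s| ≤ L * ‖x - x'‖
  lip_arg : ∀ x ∈ closure P.Ω, ∀ t ∈ Icc 0 P.T, ∀ s, 0 ≤ s → ∀ s', 0 ≤ s' →
    |P.M x t s - P.M x t s'| ≤ L * |s - s'|
  upper : ∀ x ∈ closure P.Ω, ∀ t ∈ Icc 0 P.T, ∀ s, 0 ≤ s → |P.M x t s| ≤ A + L * s

lemma exists_elliptic (hP : P.Standing) (h2 : P.H2) :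
    ∃ m₀ L A : ℝ, P.Elliptic m₀ L A ∧ 0 < m₀ - 4 * L * P.K ^ 2 := by
  obtain ⟨m₀, L, hm, hL, hlow, hlip, hK⟩ := h2
  obtain ⟨_, _, _, hb, hT, _, _⟩ := hP
  have hsp : ∀ x ∈ closure P.Ω, ∀ x' ∈ closure P.Ω, ∀ t ∈ Icc 0 P.T, ∀ s, 0 ≤ s →
      |P.M x t s - P.M x' t s| ≤ L * ‖x - x'‖ := fun x hx x' hx' t ht s hs => by
    simpa using hlip x hx t ht s hs x' hx' t ht s hs
  have harg : ∀ x ∈ closure P.Ω, ∀ t ∈ Icc 0 P.T, ∀ s, 0 ≤ s → ∀ s', 0 ≤ s' →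
      |P.M x t s - P.M x t s'| ≤ L * |s - s'| := fun x hx t ht s hs s' hs' => by
    simpa using hlip x hx t ht s hs x hx t ht s' hs'
  obtain ⟨A, hA0, hA⟩ : ∃ A : ℝ, 0 ≤ A ∧ ∀ x ∈ closure P.Ω, ∀ t ∈ Icc 0 P.T, ∀ s, 0 ≤ s →
      |P.M x t s| ≤ A + L * s := by
    rcases (closure P.Ω).eq_empty_or_nonempty with he | ⟨y, hy⟩
    · exact ⟨0, le_rfl, by simp [he]⟩
    obtain ⟨R, _, hR⟩ := hb.closure.exists_pos_norm_le
    -- Comparison with the value at a fixed point (y, 0, 0); two points of Ω̄ are at most 2R apart.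
    refine ⟨|P.M y 0 0| + L * (2 * R + P.T), by positivity, fun x hx t ht s hs => ?_⟩
    have h1 := hlip x hx t ht s hs y hy 0 ⟨le_rfl, hT.le⟩ 0 (le_refl (0 : ℝ))
    rw [sub_zero, sub_zero, abs_of_nonneg ht.1, abs_of_nonneg hs] at h1
    have h2 : ‖x - y‖ ≤ 2 * R := (norm_sub_le _ _).trans (by linarith [hR x hx, hR y hy])
    have h3 : |P.M x t s| ≤ |P.M x t s - P.M y 0 0| + |P.M y 0 0| := by
      simpa using abs_add_le (P.M x t s - P.M y 0 0) (P.M y 0 0)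
    have h4 : L * (‖x - y‖ + t + s) ≤ L * (2 * R + P.T + s) := by
      gcongr
      exact ht.2
    linarith
  exact ⟨m₀, L, A, ⟨hm, hL, hA0, hlow, hsp, harg, hA⟩, hK⟩

variable {P} {m₀ L A : ℝ}

namespace Elliptic

lemma measurable (hE : P.Elliptic m₀ L A) (ho : IsOpen P.Ω) {t s : ℝ} (ht : t ∈ Icc 0 P.T)
    (hs : 0 ≤ s) : AEStronglyMeasurable (fun x => P.M x t s) (volume.restrict P.Ω) := by
  have : LipschitzOnWith ⟨L, hE.L_nonneg⟩ (fun x => P.M x t s) P.Ω :=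
    LipschitzOnWith.of_dist_le_mul fun x hx y hy => by
      rw [Real.dist_eq, dist_eq_norm]
      exact hE.lip_space x (subset_closure hx) y (subset_closure hy) t ht s hs
  exact this.continuousOn.aestronglyMeasurable ho.measurableSet

lemma isCoeff (hE : P.Elliptic m₀ L A) (ho : IsOpen P.Ω) {t s : ℝ} (ht : t ∈ Icc 0 P.T)
    (hs : 0 ≤ s) : P.IsCoeff (fun x => P.M x t s) (A + L * s) :=
  ⟨add_nonneg hE.A_nonneg (mul_nonneg hE.L_nonneg hs), hE.measurable ho ht hs,
    (ae_restrict_mem ho.measurableSet).mono fun x hx => hE.upper x (subset_closure hx) t ht s hs⟩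

lemma ae_lower (hE : P.Elliptic m₀ L A) (ho : IsOpen P.Ω) {t s : ℝ} (ht : t ∈ Icc 0 P.T)
    (hs : 0 ≤ s) : ∀ᵐ x ∂(volume.restrict P.Ω), m₀ ≤ P.M x t s :=
  (ae_restrict_mem ho.measurableSet).mono fun x hx => hE.lower x (subset_closure hx) t ht s hs

lemma abs_diffusion_sub_le (hE : P.Elliptic m₀ L A) (ho : IsOpen P.Ω)
    (hb : Bornology.IsBounded P.Ω) {t s s' : ℝ} (ht : t ∈ Icc 0 P.T) (hs : 0 ≤ s) (hs' : 0 ≤ s')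
    {v w : Pt d → ℝ} (hv : Adm P.Ω v) (hw : Adm P.Ω w) :
    |P.diffusion t s v w - P.diffusion t s' v w| ≤
      L * |s - s'| * (P.nr (gradient v) * P.nr (gradient w)) := by
  have h1 : P.IsCoeff (fun x => P.M x t s - P.M x t s') (L * |s - s'|) :=
    ⟨mul_nonneg hE.L_nonneg (abs_nonneg _), (hE.measurable ho ht hs).sub (hE.measurable ho ht hs'),
      (ae_restrict_mem ho.measurableSet).mono fun x hx =>
        hE.lip_arg x (subset_closure hx) t ht s hs s' hs'⟩
  have h2 := (h1.bound (hv.memLp_gradient hb) (hw.memLp_gradient hb)).2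
  rw [diffusion, diffusion, ← integral_sub
    ((hE.isCoeff ho ht hs).bound (hv.memLp_gradient hb) (hw.memLp_gradient hb)).1
    ((hE.isCoeff ho ht hs').bound (hv.memLp_gradient hb) (hw.memLp_gradient hb)).1]
  simpa only [sub_mul] using h2

end Elliptic

/-! ### The gradient seminorm on X_h -/

variable (P)

lemma nr_gradient_add_le (hb : Bornology.IsBounded P.Ω) {v w : Pt d → ℝ} (hv : Adm P.Ω v)
    (hw : Adm P.Ω w) :
    P.nr (gradient (v + w)) ≤ P.nr (gradient v) + P.nr (gradient w) := by
  refine le_trans (le_of_eq (nrm_congr (ae_restrict_of_ae (hv.gradient_add hw))))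
    (nrm_add_le (hv.memLp_gradient hb) (hw.memLp_gradient hb))

variable (𝓣 : Mesh P.Ω)

/-- `‖∇v‖` for finite element functions. -/
noncomputable def gn (v : 𝓣.space) : ℝ := P.nr (gradient (v : Pt d → ℝ))

lemma gn_nonneg (v : 𝓣.space) : 0 ≤ P.gn 𝓣 v := nrm_nonneg _

lemma gn_add_le (hb : Bornology.IsBounded P.Ω) (v w : 𝓣.space) :
    P.gn 𝓣 (v + w) ≤ P.gn 𝓣 v + P.gn 𝓣 w :=
  P.nr_gradient_add_le hb (𝓣.adm v) (𝓣.adm w)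

lemma gn_neg (v : 𝓣.space) : P.gn 𝓣 (-v) = P.gn 𝓣 v := by
  have h := (𝓣.adm v).gradient_smul (-1)
  have h2 : P.gn 𝓣 (-v) = P.nr (fun x => -gradient (v : Pt d → ℝ) x) :=
    nrm_congr (ae_restrict_of_ae (h.mono fun x hx => by simpa using hx))
  rw [h2]
  exact nrm_neg _

lemma gn_sub_comm (v w : 𝓣.space) : P.gn 𝓣 (v - w) = P.gn 𝓣 (w - v) := by
  rw [← gn_neg, neg_sub]

lemma gn_le_add_sub (hb : Bornology.IsBounded P.Ω) (v w : 𝓣.space) :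
    P.gn 𝓣 v ≤ P.gn 𝓣 w + P.gn 𝓣 (v - w) := by
  simpa using P.gn_add_le 𝓣 hb w (v - w)

lemma abs_gn_sub_le (hb : Bornology.IsBounded P.Ω) (v w : 𝓣.space) :
    |P.gn 𝓣 v - P.gn 𝓣 w| ≤ P.gn 𝓣 (v - w) := by
  have h1 := P.gn_le_add_sub 𝓣 hb v w
  have h2 := P.gn_le_add_sub 𝓣 hb w v
  rw [gn_sub_comm] at h2
  exact abs_sub_le_iff.2 ⟨by linarith, by linarith⟩

lemma gradSq_eq (v : 𝓣.space) : P.gradSq (v : Pt d → ℝ) = P.gn 𝓣 v ^ 2 := (P.sq_nr_gradient _).symm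

/-! ### Linear systems -/

/-- The unit coefficient. -/
lemma isCoeff_one : P.IsCoeff (fun _ => 1) 1 :=
  ⟨zero_le_one, aestronglyMeasurable_const, ae_of_all _ fun _ => by simp⟩

variable {P} {𝓣}

lemma gn_pos (hd : 0 < d) (hb : Bornology.IsBounded P.Ω) {v : 𝓣.space} (hv : v ≠ 0) :
    0 < P.gn 𝓣 v := by
  obtain ⟨C, -, hC⟩ := poincare hd hb
  refine (P.gn_nonneg 𝓣 v).lt_of_ne fun h => hv (P.eq_zero_of_nr_eq_zero hb v ?_)
  have := hC v (𝓣.adm v)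
  change P.nr _ ≤ C * P.gn 𝓣 v at this
  rw [← h, mul_zero] at this
  exact le_antisymm this (P.nr_nonneg _)

/-- The constant is ‖∇r‖, where r is the Riesz representative of ℓ for the inner product (∇·,∇·) on
X_h. -/
lemma exists_functional_bound (hd : 0 < d) (hb : Bornology.IsBounded P.Ω) (ℓ : 𝓣.space →ₗ[ℝ] ℝ) :
    ∃ C : ℝ, 0 ≤ C ∧ ∀ v, |ℓ v| ≤ C * P.gn 𝓣 v := by
  obtain ⟨r, hr, -⟩ := existsUnique_of_pos (P.gradForm 𝓣 hb P.isCoeff_one) (fun v hv =>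
    lt_of_lt_of_le (by have := gn_pos hd hb hv; rw [one_mul]; exact pow_pos this 2)
      (P.le_gradForm 𝓣 hb P.isCoeff_one (m := 1) (ae_of_all _ fun _ => le_rfl) v)) ℓ
  refine ⟨P.gn 𝓣 r, P.gn_nonneg 𝓣 r, fun v => ?_⟩
  rw [← hr]
  have := P.abs_gradForm_le 𝓣 hb P.isCoeff_one r v
  rwa [one_mul] at this

/-- `κ (v,w) + (M(·,t,s) ∇v, ∇w)` -/
noncomputable def stepForm (hE : P.Elliptic m₀ L A) (ho : IsOpen P.Ω) (hb : Bornology.IsBounded P.Ω)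
    (κ : ℝ) {t s : ℝ} (ht : t ∈ Icc 0 P.T) (hs : 0 ≤ s) : 𝓣.space →ₗ[ℝ] 𝓣.space →ₗ[ℝ] ℝ :=
  κ • P.ipForm 𝓣 hb + P.gradForm 𝓣 hb (hE.isCoeff ho ht hs)

lemma stepForm_apply (hE : P.Elliptic m₀ L A) (ho : IsOpen P.Ω) (hb : Bornology.IsBounded P.Ω)
    (κ : ℝ) {t s : ℝ} (ht : t ∈ Icc 0 P.T) (hs : 0 ≤ s) (v w : 𝓣.space) :
    stepForm hE ho hb κ ht hs v w = κ * P.ip v w + P.diffusion t s v w := rfl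

lemma le_stepForm (hE : P.Elliptic m₀ L A) (ho : IsOpen P.Ω) (hb : Bornology.IsBounded P.Ω)
    (κ : ℝ) {t s : ℝ} (ht : t ∈ Icc 0 P.T) (hs : 0 ≤ s) (v : 𝓣.space) :
    κ * P.nr (v : Pt d → ℝ) ^ 2 + m₀ * P.gn 𝓣 v ^ 2 ≤ stepForm hE ho hb κ ht hs v v := by
  rw [stepForm_apply, ip_self]
  gcongr
  exact P.le_gradForm 𝓣 hb (hE.isCoeff ho ht hs) (hE.ae_lower ho ht hs) v

lemma stepForm_pos (hE : P.Elliptic m₀ L A) (hd : 0 < d) (ho : IsOpen P.Ω)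
    (hb : Bornology.IsBounded P.Ω) {κ : ℝ} (hκ : 0 ≤ κ) {t s : ℝ} (ht : t ∈ Icc 0 P.T) (hs : 0 ≤ s)
    (v : 𝓣.space) (hv : v ≠ 0) : 0 < stepForm hE ho hb κ ht hs v v := by
  refine lt_of_lt_of_le ?_ (le_stepForm hE ho hb κ ht hs v)
  have := mul_pos hE.pos (pow_pos (gn_pos hd hb hv) 2)
  positivity

/-- The Kirchhoff-type problem `κ (u,v) + (M(·,t,‖∇u‖²) ∇u, ∇v) = ℓ v` is solvable. -/
lemma exists_kirchhoff (hE : P.Elliptic m₀ L A) (hd : 0 < d) (ho : IsOpen P.Ω)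
    (hb : Bornology.IsBounded P.Ω) {κ : ℝ} (hκ : 0 ≤ κ) {t : ℝ} (ht : t ∈ Icc 0 P.T)
    (ℓ : 𝓣.space →ₗ[ℝ] ℝ) :
    ∃ u : 𝓣.space, ∀ v : 𝓣.space, κ * P.ip u v + P.diffusion t (P.gradSq u) u v = ℓ v := by
  -- The linear problem with s frozen. For s < 0, where M is not controlled, the value is a dummy,
  -- so that w becomes a function on all of ℝ.
  have hex : ∀ s : ℝ, ∃ w : 𝓣.space, ∀ hs : 0 ≤ s, ∀ v, stepForm hE ho hb κ ht hs w v = ℓ v := by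
    intro s
    by_cases hs : 0 ≤ s
    · obtain ⟨w, hw, -⟩ := existsUnique_of_pos (stepForm hE ho hb κ ht hs)
        (stepForm_pos hE hd ho hb hκ ht hs) ℓ
      exact ⟨w, fun _ => hw⟩
    · exact ⟨0, fun h => absurd h hs⟩
  choose w hw using hex
  obtain ⟨C, hC0, hC⟩ := exists_functional_bound hd hb ℓ
  have hm := hE.pos
  have hlow : ∀ s (hs : 0 ≤ s) v, m₀ * P.gn 𝓣 v ^ 2 ≤ stepForm hE ho hb κ ht hs v v :=
    fun s hs v => le_trans (by have := P.nr_nonneg (v : Pt d → ℝ); nlinarith [mul_nonneg hκ (sq_nonneg (P.nr (v : Pt d → ℝ)))])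
      (le_stepForm hE ho hb κ ht hs v)
  -- Testing with w(s) itself gives a bound independent of s, because only the lower bound m₀
  -- enters.
  have hbd : ∀ s, 0 ≤ s → P.gn 𝓣 (w s) ≤ C / m₀ := by
    intro s hs
    rw [le_div_iff₀ hm]
    have h1 := hlow s hs (w s)
    rw [hw s hs] at h1
    have h2 := (h1.trans (le_abs_self _)).trans (hC (w s))
    rcases (P.gn_nonneg 𝓣 (w s)).eq_or_lt with h | h
    · rw [← h, zero_mul]; exact hC0
    · nlinarith
  have hlip : ∀ s, 0 ≤ s → ∀ s', 0 ≤ s' →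
      |P.gn 𝓣 (w s) - P.gn 𝓣 (w s')| ≤ L * C / m₀ ^ 2 * |s - s'| := by
    intro s hs s' hs'
    refine (P.abs_gn_sub_le 𝓣 hb _ _).trans ?_
    set e := w s - w s' with he
    have h1 := hlow s hs e
    -- Both w(s) and w(s') represent ℓ, so what remains is the change of the coefficient, applied to
    -- w(s').
    have h2 : stepForm hE ho hb κ ht hs e e =
        P.diffusion t s' (w s') e - P.diffusion t s (w s') e := by
      have h3 : stepForm hE ho hb κ ht hs e e =
          stepForm hE ho hb κ ht hs (w s) e - stepForm hE ho hb κ ht hs (w s') e := by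
        rw [← LinearMap.sub_apply, ← map_sub]
      rw [h3, hw s hs, ← hw s' hs', stepForm_apply, stepForm_apply]
      ring
    have h3 := hE.abs_diffusion_sub_le ho hb ht hs' hs (𝓣.adm (w s')) (𝓣.adm e)
    rw [abs_sub_comm s' s] at h3
    have h4 : m₀ * P.gn 𝓣 e ^ 2 ≤ L * |s - s'| * (C / m₀ * P.gn 𝓣 e) := by
      refine (h1.trans (h2.le.trans ((le_abs_self _).trans h3))).trans ?_
      refine mul_le_mul_of_nonneg_left ?_ (mul_nonneg hE.L_nonneg (abs_nonneg _))
      exact mul_le_mul_of_nonneg_right (hbd s' hs') (P.gn_nonneg 𝓣 e)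
    rcases (P.gn_nonneg 𝓣 e).eq_or_lt with h | h
    · rw [← h]; have := hE.L_nonneg; positivity
    · have h5 : m₀ * P.gn 𝓣 e ≤ L * |s - s'| * (C / m₀) := by
        refine le_of_mul_le_mul_right ?_ h
        linarith
      calc P.gn 𝓣 e ≤ L * |s - s'| * (C / m₀) / m₀ := by rw [le_div_iff₀ hm]; linarith
        _ = _ := by field_simp
  have hcont : ContinuousOn (fun s => P.gn 𝓣 (w s)) (Ici 0) := by
    have : LipschitzOnWith ⟨L * C / m₀ ^ 2, by have := hE.L_nonneg; positivity⟩
        (fun s => P.gn 𝓣 (w s)) (Ici 0) :=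
      LipschitzOnWith.of_dist_le_mul fun s hs s' hs' => hlip s hs s' hs'
    exact this.continuousOn
  have hS : (0 : ℝ) ≤ (C / m₀) ^ 2 := sq_nonneg _
  have hivt := intermediate_value_Icc' (f := fun s => P.gn 𝓣 (w s) ^ 2 - s) hS
    (((hcont.mono Icc_subset_Ici_self).pow 2).sub continuousOn_id)
  -- The function ‖∇w(s)‖² - s is nonnegative at s = 0 and nonpositive at s = (C/m₀)² by the uniform
  -- bound.
  obtain ⟨s, ⟨hs, -⟩, hs0⟩ := hivt (show (0 : ℝ) ∈ Icc _ _ from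
    ⟨by have := pow_le_pow_left₀ (P.gn_nonneg 𝓣 _) (hbd _ hS) 2; simpa using this,
      by simpa using sq_nonneg _⟩)
  have hs1 : P.gradSq (w s : Pt d → ℝ) = s := by
    rw [gradSq_eq]
    simpa [sub_eq_zero] using hs0
  exact ⟨w s, fun v => by rw [hs1]; exact hw s hs v⟩

end Problem

namespace Problem

variable {d : ℕ} {P : Problem d} {m₀ L A : ℝ}

/-! ### The steps of the scheme as variational problems -/

lemma step_pos (hP : P.Standing) {N : ℕ} (hN : 1 ≤ N) : 0 < P.step N :=
  div_pos hP.2.2.2.2.1 (by exact_mod_cast hN)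

lemma node_mem (hP : P.Standing) {N n : ℕ} (hN : 1 ≤ N) (hn : n ≤ N) :
    P.node N n ∈ Icc 0 P.T := by
  have h1 : (0 : ℝ) < N := by exact_mod_cast hN
  have h2 : (n : ℝ) ≤ N := by exact_mod_cast hn
  have hT := hP.2.2.2.2.1
  refine ⟨mul_nonneg (Nat.cast_nonneg n) (step_pos hP hN).le, ?_⟩
  rw [node, step, mul_div_assoc', div_le_iff₀ h1, mul_comm]
  gcongr

lemma a_zero (hP : P.Standing) : P.a 0 = 1 := by
  have : 1 - P.α ≠ 0 := by have := hP.2.2.2.2.2.2; linarith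
  simp [a, Real.zero_rpow this]

lemma l1Const_pos (hP : P.Standing) {N : ℕ} (hN : 1 ≤ N) : 0 < P.l1Const N :=
  div_pos (Real.rpow_pos_of_pos (step_pos hP hN) _)
    (Real.Gamma_pos_of_pos (by have := hP.2.2.2.2.2.2; linarith))

variable (P) in
/-- The part of the `L1` approximation that does not involve the value at the current node. -/
noncomputable def l1Rest (𝓣 : Mesh P.Ω) (N n : ℕ) (u : ℕ → 𝓣.space) : 𝓣.space :=
  P.l1Const N • (∑ j ∈ Finset.Icc 1 (n - 1), P.a (n - j) • (u j - u (j - 1)) - P.a 0 • u (n - 1))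

variable {𝓣 : Mesh P.Ω}

lemma l1Deriv_eq {N n : ℕ} (hn : 1 ≤ n) (u : ℕ → 𝓣.space) :
    (P.l1Deriv N n fun j => (u j : Pt d → ℝ)) =
      (((P.l1Const N * P.a 0) • u n + P.l1Rest 𝓣 N n u : 𝓣.space) : Pt d → ℝ) := by
  have h : (P.l1Deriv N n fun j => (u j : Pt d → ℝ)) =
      ((P.l1Const N • ∑ j ∈ Finset.Icc 1 n, P.a (n - j) • (u j - u (j - 1)) : 𝓣.space) :
        Pt d → ℝ) := by
    simp [l1Deriv]
  rw [h]
  congr 1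
  obtain ⟨m, rfl⟩ : ∃ m, n = m + 1 := ⟨n - 1, by omega⟩
  rw [Finset.sum_Icc_succ_top (by omega), l1Rest]
  simp only [Nat.add_sub_cancel, Nat.sub_self]
  module

lemma l1Rest_congr {N n : ℕ} (hn : 1 ≤ n) {u u' : ℕ → 𝓣.space} (h : ∀ j < n, u j = u' j) :
    P.l1Rest 𝓣 N n u = P.l1Rest 𝓣 N n u' := by
  unfold l1Rest
  rw [h (n - 1) (by omega)]
  congr 2
  refine Finset.sum_congr rfl fun j hj => ?_
  rw [Finset.mem_Icc] at hj
  rw [h j (by omega), h (j - 1) (by omega)]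

lemma ip_add_smul (hb : Bornology.IsBounded P.Ω) (c : ℝ) (v w z : 𝓣.space) :
    P.ip ((c • v + w : 𝓣.space) : Pt d → ℝ) z = c * P.ip v z + P.ip w z := by
  have := LinearMap.congr_fun ((P.ipForm 𝓣 hb).map_add (c • v) w) z
  rw [map_smul] at this
  exact this

lemma ip_sub (hb : Bornology.IsBounded P.Ω) (v w z : 𝓣.space) :
    P.ip ((v - w : 𝓣.space) : Pt d → ℝ) z = P.ip v z - P.ip w z :=
  LinearMap.congr_fun ((P.ipForm 𝓣 hb).map_sub v w) z

variable (𝓣) in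
/-- `(F, v)` as a linear functional of the test function. -/
noncomputable def loadForm (hb : Bornology.IsBounded P.Ω) {F : Pt d → ℝ}
    (hF : MemLp F 2 (volume.restrict P.Ω)) : 𝓣.space →ₗ[ℝ] ℝ where
  toFun v := P.ip F v
  map_add' v w := by
    rw [ip, ip, ip, ← integral_add (P.ip_bound hF ((𝓣.adm v).memLp hb)).1
      (P.ip_bound hF ((𝓣.adm w).memLp hb)).1]
    exact integral_congr_ae (ae_of_all _ fun x => by simp [mul_add])
  map_smul' c v := by
    rw [ip, ip, RingHom.id_apply, smul_eq_mul, ← integral_const_mul]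
    exact integral_congr_ae (ae_of_all _ fun x => by simp [mul_left_comm])

lemma loadForm_apply (hb : Bornology.IsBounded P.Ω) {F : Pt d → ℝ}
    (hF : MemLp F 2 (volume.restrict P.Ω)) (v : 𝓣.space) : loadForm 𝓣 hb hF v = P.ip F v := rfl

/-- The initial value is uniquely determined. -/
lemma existsUnique_initial (hE : P.Elliptic m₀ L A) (hP : P.Standing) (h1 : P.H1) :
    ∃! w : 𝓣.space, ∀ u : ℕ → 𝓣.space, u 0 = w → P.InitialStep 𝓣 u := by
  obtain ⟨hd, ho, -, hb, hT, -, -⟩ := hP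
  have ht : (0 : ℝ) ∈ Icc 0 P.T := ⟨le_rfl, hT.le⟩
  have hs : 0 ≤ P.initSq := integral_nonneg fun _ => by positivity
  have hc := hE.isCoeff ho ht hs
  have hG : MemLp P.G₀ 2 (volume.restrict P.Ω) := h1.1.1.2.1
  obtain ⟨w, hw, huniq⟩ := existsUnique_of_pos (P.gradForm 𝓣 hb hc) (fun v hv =>
    lt_of_lt_of_le (mul_pos hE.pos (pow_pos (gn_pos hd hb hv) 2))
      (P.le_gradForm 𝓣 hb hc (hE.ae_lower ho ht hs) v)) (P.fluxForm 𝓣 hb hc hG)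
  have key : ∀ u : ℕ → 𝓣.space, P.InitialStep 𝓣 u ↔
      ∀ v, P.gradForm 𝓣 hb hc (u 0) v = P.fluxForm 𝓣 hb hc hG v := by
    intro u
    refine forall_congr' fun v => ?_
    have h := integral_sub (hc.bound hG ((𝓣.adm v).memLp_gradient hb)).1
      (hc.bound ((𝓣.adm (u 0)).memLp_gradient hb) ((𝓣.adm v).memLp_gradient hb)).1
    simp only [← mul_sub, ← inner_sub_left] at h
    rw [h, sub_eq_zero, eq_comm]
    rfl
  exact ⟨w, fun u hu => (key u).2 fun v => by rw [hu]; exact hw v,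
    fun w' hw' => huniq w' ((key fun _ => w').1 (hw' _ rfl))⟩

lemma initialStep_congr {u u' : ℕ → 𝓣.space} (h : u 0 = u' 0) :
    P.InitialStep 𝓣 u ↔ P.InitialStep 𝓣 u' := by
  unfold InitialStep
  rw [h]

lemma initialStep_unique (hE : P.Elliptic m₀ L A) (hP : P.Standing) (h1 : P.H1)
    {u u' : ℕ → 𝓣.space} (hu : P.InitialStep 𝓣 u) (hu' : P.InitialStep 𝓣 u') : u 0 = u' 0 :=
  (existsUnique_initial hE hP h1).unique (fun _ h => (initialStep_congr h).2 hu)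
    (fun _ h => (initialStep_congr h).2 hu')

/-- For n = 1 the L1 sum is the single difference u¹ - u⁰, with weight a₀ = 1. This puts the step
into the form on which all energy estimates below rest. -/
lemma firstStep_iff (hP : P.Standing) {N : ℕ} (u : ℕ → 𝓣.space) :
    P.FirstStep 𝓣 N u ↔ ∀ v : 𝓣.space,
      P.l1Const N * P.ip ((u 1 - u 0 : 𝓣.space) : Pt d → ℝ) v +
        P.diffusion (P.node N 1) (P.gradSq (u 1)) (u 1) v =
      P.ip (P.f (P.node N 1)) v + P.step N * P.B (P.node N 1) (P.node N 0) (u 0) v := by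
  have hb := hP.2.2.2.1
  refine forall_congr' fun v => ?_
  have : (P.l1Deriv N 1 fun j => (u j : Pt d → ℝ)) =
      ((P.l1Const N • (u 1 - u 0) + 0 : 𝓣.space) : Pt d → ℝ) := by
    rw [l1Deriv_eq le_rfl, l1Rest, a_zero hP]
    congr 1
    simp
    module
  rw [this, ip_add_smul hb]
  have h0 : P.ip ((0 : 𝓣.space) : Pt d → ℝ) v = 0 := by simp [ip]
  rw [h0, add_zero]

/-- With u⁰ known, load, memory term and κu⁰ form one linear functional, and a Kirchhoff-type
problem for u¹ is left. -/
lemma exists_firstStep (hE : P.Elliptic m₀ L A) (hP : P.Standing) (h3 : P.H3) {N : ℕ} (hN : 1 ≤ N)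
    (u₀ : 𝓣.space) : ∃ u₁ : 𝓣.space, ∀ u : ℕ → 𝓣.space, u 0 = u₀ → u 1 = u₁ →
      P.FirstStep 𝓣 N u := by
  obtain ⟨hd, ho, -, hb, hT, -, -⟩ := id hP
  obtain ⟨u₁, h⟩ := exists_kirchhoff hE hd ho hb (l1Const_pos hP hN).le (node_mem hP hN hN)
    (loadForm 𝓣 hb (Lp.memLp (P.f (P.node N 1))) +
      P.step N • P.memoryForm 𝓣 hP h3 (node_mem hP hN hN) (node_mem hP hN (Nat.zero_le N)) u₀ +
      P.l1Const N • P.ipForm 𝓣 hb u₀)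
  refine ⟨u₁, fun u h0 h1 => (firstStep_iff hP u).2 fun v => ?_⟩
  have hv := h v
  change _ = P.ip _ _ + P.step N * P.B _ _ _ _ + P.l1Const N * P.ip _ _ at hv
  rw [h0, h1, ip_sub hb]
  linarith

lemma laterStep_congr {N n : ℕ} (hn : 2 ≤ n) {u u' : ℕ → 𝓣.space} (h : ∀ j ≤ n, u j = u' j) :
    P.LaterStep 𝓣 N n u ↔ P.LaterStep 𝓣 N n u' := by
  refine forall_congr' fun v => ?_
  rw [l1Deriv_eq (by omega), l1Deriv_eq (by omega), h n le_rfl,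
    l1Rest_congr (by omega) fun j hj => h j hj.le, extrapolatedSq, extrapolatedSq,
    h (n - 1) (by omega), h (n - 2) (by omega)]
  have : ∀ j ∈ Finset.Icc 1 (n - 1),
      simpsonWeight (P.step N) n j * P.B (P.node N n) (P.node N j) (u j) v =
      simpsonWeight (P.step N) n j * P.B (P.node N n) (P.node N j) (u' j) v := fun j hj => by
    rw [h j (by rw [Finset.mem_Icc] at hj; omega)]
  rw [Finset.sum_congr rfl this]

lemma extrapolatedSq_congr {n : ℕ} (hn : 2 ≤ n) {u u' : ℕ → 𝓣.space} (h : ∀ j < n, u j = u' j) :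
    P.extrapolatedSq 𝓣 n u = P.extrapolatedSq 𝓣 n u' := by
  rw [extrapolatedSq, extrapolatedSq, h (n - 1) (by omega), h (n - 2) (by omega)]

/-- For `n ≥ 2` the scheme is a linear system for `u^n`. -/
lemma exists_laterStep_iff (hP : P.Standing) (h3 : P.H3) {N n : ℕ} (hn : 2 ≤ n) (hnN : n ≤ N)
    (u : ℕ → 𝓣.space) : ∃ ℓ : 𝓣.space →ₗ[ℝ] ℝ, ∀ w : 𝓣.space,
      P.LaterStep 𝓣 N n (Function.update u n w) ↔ ∀ v, P.systemForm 𝓣 N n u w v = ℓ v := by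
  have hb := hP.2.2.2.1
  have hN : 1 ≤ N := by omega
  have hmem : ∀ j ∈ Finset.Icc 1 (n - 1), ∃ ℓ : 𝓣.space →ₗ[ℝ] ℝ, ∀ v : 𝓣.space,
      ℓ v = P.B (P.node N n) (P.node N j) (u j) v := fun j hj => by
    rw [Finset.mem_Icc] at hj
    exact ⟨P.memoryForm 𝓣 hP h3 (node_mem hP hN hnN) (node_mem hP hN (by omega)) (u j),
      fun v => rfl⟩
  choose! ℓ hℓ using hmem
  refine ⟨loadForm 𝓣 hb (Lp.memLp (P.f (P.node N n))) +
    ∑ j ∈ Finset.Icc 1 (n - 1), simpsonWeight (P.step N) n j • ℓ j -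
    P.ipForm 𝓣 hb (P.l1Rest 𝓣 N n u), fun w => forall_congr' fun v => ?_⟩
  have hu : ∀ j < n, Function.update u n w j = u j := fun j hj =>
    Function.update_of_ne hj.ne _ _
  have hsum : ∑ j ∈ Finset.Icc 1 (n - 1), simpsonWeight (P.step N) n j *
        P.B (P.node N n) (P.node N j) (Function.update u n w j) v =
      (∑ j ∈ Finset.Icc 1 (n - 1), simpsonWeight (P.step N) n j • ℓ j) v := by
    rw [LinearMap.sum_apply]
    refine Finset.sum_congr rfl fun j hj => ?_
    rw [LinearMap.smul_apply, hℓ j hj v, smul_eq_mul, hu j (by rw [Finset.mem_Icc] at hj; omega)]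
  rw [hsum, l1Deriv_eq (by omega), ip_add_smul hb, l1Rest_congr (by omega) hu,
    extrapolatedSq_congr hn hu, Function.update_self, LinearMap.sub_apply, LinearMap.add_apply,
    loadForm_apply, systemForm]
  change _ ↔ _ = _ + _ - P.ip _ _
  constructor <;> intro h <;> linarith

lemma systemForm_eq (hE : P.Elliptic m₀ L A) (hP : P.Standing) {N n : ℕ} (hN : 1 ≤ N) (hnN : n ≤ N)
    (u : ℕ → 𝓣.space) (v w : 𝓣.space) : P.systemForm 𝓣 N n u v w =
      stepForm hE hP.2.1 hP.2.2.2.1 (P.l1Const N * P.a 0) (node_mem hP hN hnN)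
        (P.gradSq_nonneg (2 • u (n - 1) - u (n - 2) : 𝓣.space)) v w := rfl

lemma existsUnique_laterStep (hE : P.Elliptic m₀ L A) (hP : P.Standing) (h3 : P.H3) {N n : ℕ}
    (hn : 2 ≤ n) (hnN : n ≤ N) (u : ℕ → 𝓣.space) :
    ∃! w : 𝓣.space, P.LaterStep 𝓣 N n (Function.update u n w) := by
  have hN : 1 ≤ N := by omega
  obtain ⟨ℓ, hℓ⟩ := exists_laterStep_iff hP h3 hn hnN u
  simp only [hℓ, systemForm_eq hE hP hN hnN]
  exact existsUnique_of_pos _ (stepForm_pos hE hP.1 _ _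
    (by rw [a_zero hP, mul_one]; exact (l1Const_pos hP hN).le) _ _) ℓ

/-- For a coefficient vector x the quadratic form of the matrix is the system form on the diagonal
at w = ∑ xᵢφᵢ, and w ≠ 0 by linear independence. -/
lemma posDef_systemForm (hE : P.Elliptic m₀ L A) (hP : P.Standing) {N n : ℕ}
    (hn : 2 ≤ n) (hnN : n ≤ N) (u : ℕ → 𝓣.space) {m : ℕ} (φ : Module.Basis (Fin m) ℝ 𝓣.space) :
    (Matrix.of fun i j => P.systemForm 𝓣 N n u (φ j) (φ i)).PosDef := by
  have hN : 1 ≤ N := by omega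
  let S := stepForm (𝓣 := 𝓣) hE hP.2.1 hP.2.2.2.1 (P.l1Const N * P.a 0) (node_mem hP hN hnN)
    (P.gradSq_nonneg (2 • u (n - 1) - u (n - 2) : 𝓣.space))
  have hS : ∀ v w, P.systemForm 𝓣 N n u v w = S v w := systemForm_eq hE hP hN hnN u
  have hpos : ∀ v, v ≠ 0 → 0 < S v v := stepForm_pos hE hP.1 _ _
    (by rw [a_zero hP, mul_one]; exact (l1Const_pos hP hN).le) _ _
  have hsymm : ∀ v w, S v w = S w v := fun v w => by
    simp only [S, stepForm, LinearMap.add_apply, LinearMap.smul_apply, gradForm_comm P 𝓣 _ _ v w]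
    congr 2
    exact P.ip_comm v w
  refine Matrix.PosDef.of_dotProduct_mulVec_pos ?_ fun x hx => ?_
  · ext i j
    simp [hS, hsymm (φ i) (φ j)]
  · have hw : ∑ i, x i • φ i ≠ 0 := fun h =>
      hx (funext fun i => Fintype.linearIndependent_iff.1 φ.linearIndependent x h i)
    refine lt_of_lt_of_eq (hpos _ hw) ?_
    simp only [dotProduct, Matrix.mulVec, Matrix.of_apply, hS, star_trivial, map_sum, map_smul,
      LinearMap.sum_apply, LinearMap.smul_apply, smul_eq_mul, Finset.mul_sum]
    rw [Finset.sum_comm]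
    refine Finset.sum_congr rfl fun i _ => Finset.sum_congr rfl fun j _ => ?_
    rw [hsymm (φ i) (φ j)]
    ring

end Problem

namespace Problem

variable {d : ℕ} {P : Problem d} {m₀ L A : ℝ} {𝓣 : Mesh P.Ω}

/-! ### Solutions of the scheme -/

lemma firstStep_congr {N : ℕ} {u u' : ℕ → 𝓣.space} (h0 : u 0 = u' 0) (h1 : u 1 = u' 1) :
    P.FirstStep 𝓣 N u ↔ P.FirstStep 𝓣 N u' := by
  refine forall_congr' fun v => ?_
  rw [l1Deriv_eq le_rfl, l1Deriv_eq le_rfl, h0, h1,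
    l1Rest_congr le_rfl fun j hj => by rw [Nat.lt_one_iff.1 hj, h0]]

lemma extend_of_le {N : ℕ} {X : Type*} [Zero X] (u : Fin (N + 1) → X) {n : ℕ} (hn : n ≤ N) :
    extend u n = u ⟨n, Nat.lt_succ_of_le hn⟩ := dif_pos _

/-- The scheme is solvable. -/
lemma exists_isSolution (hE : P.Elliptic m₀ L A) (hP : P.Standing) (h1 : P.H1) (h3 : P.H3) {N : ℕ}
    (hN : 1 ≤ N) : ∃ u : Fin (N + 1) → 𝓣.space, P.IsSolution 𝓣 N u := by
  -- The solution is built as an infinite sequence whose entries are overwritten one by one; steps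
  -- already solved persist, since each step involves no later entry.
  have hind : ∀ m, ∃ u : ℕ → 𝓣.space, P.InitialStep 𝓣 u ∧ P.FirstStep 𝓣 N u ∧
      ∀ n, 2 ≤ n → n ≤ m → n ≤ N → P.LaterStep 𝓣 N n u := by
    intro m
    induction m with
    | zero =>
      obtain ⟨w₀, hw₀, -⟩ := existsUnique_initial (𝓣 := 𝓣) hE hP h1
      obtain ⟨w₁, hw₁⟩ := exists_firstStep hE hP h3 hN w₀
      exact ⟨fun n => if n = 0 then w₀ else w₁, hw₀ _ (by simp), hw₁ _ (by simp) (by simp),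
        fun n h2 h0 => by omega⟩
    | succ m ih =>
      obtain ⟨u, hu0, hu1, hu⟩ := ih
      by_cases hm : 2 ≤ m + 1 ∧ m + 1 ≤ N
      · obtain ⟨w, hw, -⟩ := existsUnique_laterStep hE hP h3 hm.1 hm.2 u
        have hne : ∀ j ≤ m, u j = Function.update u (m + 1) w j := fun j hj =>
          (Function.update_of_ne (by omega) _ _).symm
        refine ⟨Function.update u (m + 1) w, (initialStep_congr (hne 0 (by omega))).1 hu0,
          (firstStep_congr (hne 0 (by omega)) (hne 1 (by omega))).1 hu1, fun n h2 hn hnN => ?_⟩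
        rcases hn.eq_or_lt with rfl | hlt
        · exact hw
        · exact (laterStep_congr h2 fun j hj => hne j (by omega)).1 (hu n h2 (by omega) hnN)
      · exact ⟨u, hu0, hu1, fun n h2 hn hnN => hu n h2 (by omega) hnN⟩
  obtain ⟨u, hu0, hu1, hu⟩ := hind N
  have hext : ∀ j ≤ N, u j = extend (fun i : Fin (N + 1) => u i) j := fun j hj => by
    rw [extend_of_le _ hj]
  refine ⟨fun i => u i, (initialStep_congr (hext 0 (by omega))).1 hu0,
    (firstStep_congr (hext 0 (by omega)) (hext 1 hN)).1 hu1, fun n h2 hn => ?_⟩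
  exact (laterStep_congr h2 fun j hj => hext j (by omega)).1 (hu n h2 hn hn)

/-- The solution is unique if the first step determines `u¹`. -/
lemma isSolution_unique (hE : P.Elliptic m₀ L A) (hP : P.Standing) (h1 : P.H1) (h3 : P.H3) {N : ℕ}
    (hfirst : ∀ u u' : ℕ → 𝓣.space, P.InitialStep 𝓣 u → u 0 = u' 0 → P.FirstStep 𝓣 N u →
      P.FirstStep 𝓣 N u' → u 1 = u' 1)
    {u u' : Fin (N + 1) → 𝓣.space} (hu : P.IsSolution 𝓣 N u) (hu' : P.IsSolution 𝓣 N u') :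
    u = u' := by
  have h : ∀ n, n ≤ N → extend u n = extend u' n := by
    intro n
    induction n using Nat.strong_induction_on with
    | _ n ih =>
      intro hn
      have h0 : extend u 0 = extend u' 0 := initialStep_unique hE hP h1 hu.1 hu'.1
      rcases Nat.lt_or_ge n 2 with hlt | hge
      · interval_cases n
        · exact h0
        · exact hfirst _ _ hu.1 h0 hu.2.1 hu'.2.1
      -- As all earlier values agree, the value of u' at n solves the linear system set up from u.
      · refine (existsUnique_laterStep hE hP h3 hge hn (extend u)).unique ?_ ?_
        · rw [Function.update_eq_self]
          exact hu.2.2 n hge hn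
        · refine (laterStep_congr hge fun j hj => ?_).1 (hu'.2.2 n hge hn)
          rcases hj.eq_or_lt with rfl | hlt
          · rw [Function.update_self]
          · rw [Function.update_of_ne hlt.ne, ih j hlt (by omega)]
  funext i
  have := h i (Nat.le_of_lt_succ i.2)
  rwa [extend_of_le _ (Nat.le_of_lt_succ i.2), extend_of_le _ (Nat.le_of_lt_succ i.2)] at this

end Problem

variable {d : ℕ}

/-! ### Affine functions -/

/-- The gradient of an affine function. -/
noncomputable def affGrad (a : Pt d →ᵃ[ℝ] ℝ) : Pt d :=
  (InnerProductSpace.toDual ℝ (Pt d)).symm (LinearMap.toContinuousLinearMap a.linear)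

lemma inner_affGrad (a : Pt d →ᵃ[ℝ] ℝ) (y : Pt d) : inner ℝ (affGrad a) y = a.linear y := by
  rw [affGrad, InnerProductSpace.toDual_symm_apply]
  rfl

lemma affine_add (a : Pt d →ᵃ[ℝ] ℝ) (x y : Pt d) : a (x + y) = a x + inner ℝ (affGrad a) y := by
  rw [inner_affGrad, add_comm x y]
  have := a.map_vadd x y
  simp only [vadd_eq_add] at this
  rw [this, add_comm]

lemma gradient_eq_affGrad {v : Pt d → ℝ} {s : Set (Pt d)} {a : Pt d →ᵃ[ℝ] ℝ} (h : EqOn v a s)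
    {x : Pt d} (hx : x ∈ interior s) : gradient v x = affGrad a := by
  have h1 : v =ᶠ[𝓝 x] a := by
    filter_upwards [isOpen_interior.mem_nhds hx] with y hy using h (interior_subset hy)
  have h2 : HasFDerivAt a (LinearMap.toContinuousLinearMap a.linear) x := by
    have h3 : (a : Pt d → ℝ) = fun y => LinearMap.toContinuousLinearMap a.linear y + a 0 := by
      ext y
      have := affine_add a 0 y
      rw [zero_add, inner_affGrad] at this
      rw [this, add_comm]
      rfl
    rw [h3]
    exact (ContinuousLinearMap.hasFDerivAt _).add_const _
  rw [gradient, (h2.congr_of_eventuallyEq h1).fderiv, affGrad]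

/-- The gradient of an affine function is controlled by its values on a ball. -/
lemma norm_affGrad_mul_le (a : Pt d →ᵃ[ℝ] ℝ) {c : Pt d} {r ε : ℝ} (hr : 0 < r)
    (ha : ∀ x ∈ Metric.ball c r, |a x| ≤ ε) : ‖affGrad a‖ * r ≤ 4 * ε := by
  have hε : 0 ≤ ε := (abs_nonneg _).trans (ha c (Metric.mem_ball_self hr))
  rcases eq_or_ne (affGrad a) 0 with h0 | h0
  · rw [h0, norm_zero, zero_mul]; positivity
  have hn : 0 < ‖affGrad a‖ := norm_pos_iff.2 h0
  let y : Pt d := (r / 2 / ‖affGrad a‖) • affGrad a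
  have hy : ‖y‖ = r / 2 := by
    rw [norm_smul, Real.norm_of_nonneg (by positivity), div_mul_cancel₀ _ hn.ne']
  have h1 := affine_add a c y
  have h2 : inner ℝ (affGrad a) y = ‖affGrad a‖ * r / 2 := by
    rw [inner_smul_right, real_inner_self_eq_norm_sq]
    field_simp
  have h3 := ha c (Metric.mem_ball_self hr)
  have h4 := ha (c + y) (by rw [Metric.mem_ball, dist_eq_norm, add_sub_cancel_left, hy]; linarith)
  rw [abs_le] at h3 h4
  linarith

/-- The mean square of an affine function on a ball controls its gradient. -/
lemma sq_norm_affGrad_le (a : Pt d →ᵃ[ℝ] ℝ) {c : Pt d} {r : ℝ} (hr : 0 < r) {s : Set (Pt d)}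
    (hs : Metric.ball c r ⊆ s) (hsc : IsCompact s) :
    ‖affGrad a‖ ^ 2 * r ^ 2 * volume.real (Metric.ball (0 : Pt d) (r / 4)) ≤
      4 * ∫ x in s, a x ^ 2 := by
  have hac : Continuous a := a.continuous_of_finiteDimensional
  have hint : IntegrableOn (fun x => a x ^ 2) s := (hac.pow 2).continuousOn.integrableOn_compact hsc
  have hpos : 0 ≤ ∫ x in s, a x ^ 2 := integral_nonneg fun _ => sq_nonneg _
  rcases eq_or_ne (affGrad a) 0 with h0 | h0
  · rw [h0, norm_zero]; simpa using hpos
  have hn : 0 < ‖affGrad a‖ := norm_pos_iff.2 h0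
  let y : Pt d := (r / 2 / ‖affGrad a‖) • affGrad a
  have hy : ‖y‖ = r / 2 := by
    rw [norm_smul, Real.norm_of_nonneg (by positivity), div_mul_cancel₀ _ hn.ne']
  have h2 : inner ℝ (affGrad a) y = ‖affGrad a‖ * r / 2 := by
    rw [inner_smul_right, real_inner_self_eq_norm_sq]
    field_simp
  have hball : ∀ p : Pt d, ‖p - c‖ = r / 2 → Metric.ball p (r / 4) ⊆ s := fun p hp =>
    (Metric.ball_subset_ball' (by rw [dist_eq_norm, hp]; linarith)).trans hs
  have htr : ∀ p : Pt d, ‖p - c‖ = r / 2 →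
      ∫ x in Metric.ball (0 : Pt d) (r / 4), a (p + x) ^ 2 ≤ ∫ x in s, a x ^ 2 := fun p hp => by
    have h := (measurePreserving_add_left (volume : Measure (Pt d)) p).setIntegral_preimage_emb
      (measurableEmbedding_addLeft p) (fun x => a x ^ 2) (Metric.ball p (r / 4))
    have h5 : (fun x => p + x) ⁻¹' Metric.ball p (r / 4) = Metric.ball 0 (r / 4) := by
      ext x; simp
    rw [h5] at h
    rw [h]
    exact setIntegral_mono_set hint (ae_of_all _ fun _ => sq_nonneg _)
      (LE.le.eventuallyLE (hball p hp))
  have hi : ∀ p : Pt d, IntegrableOn (fun x => a (p + x) ^ 2) (Metric.ball 0 (r / 4)) := fun p =>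
    (((hac.comp (continuous_const.add continuous_id)).pow 2).continuousOn.integrableOn_compact
      (isCompact_closedBall 0 (r / 4))).mono_set Metric.ball_subset_closedBall
  have hp1 := htr (c + y) (by rw [add_sub_cancel_left, hy])
  have hp2 := htr (c - y) (by rw [sub_sub_cancel_left, norm_neg, hy])
  have key : ‖affGrad a‖ ^ 2 * r ^ 2 * volume.real (Metric.ball (0 : Pt d) (r / 4)) ≤
      ∫ x in Metric.ball (0 : Pt d) (r / 4), (2 * a (c + y + x) ^ 2 + 2 * a (c - y + x) ^ 2) := by
    have h6 : ‖affGrad a‖ ^ 2 * r ^ 2 * volume.real (Metric.ball (0 : Pt d) (r / 4)) =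
        ∫ x in Metric.ball (0 : Pt d) (r / 4), ‖affGrad a‖ ^ 2 * r ^ 2 := by
      rw [setIntegral_const, smul_eq_mul, mul_comm]
    rw [h6]
    refine setIntegral_mono_on (integrableOn_const measure_ball_lt_top.ne)
      (((hi _).const_mul 2).add ((hi _).const_mul 2)) measurableSet_ball fun x _ => ?_
    -- The shift 2y has length r in the direction of the gradient, so a grows by ‖∇a‖r between the
    -- two translated balls. Then ‖∇a‖²r² ≤ 2a₊² + 2a₋², where a₊ and a₋ are the values at
    -- corresponding points; both balls lie in `Metric.ball c r`.
    have h7 : a (c + y + x) = a (c - y + x) + ‖affGrad a‖ * r := by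
      have : c + y + x = c - y + x + (y + y) := by abel
      rw [this, affine_add, inner_add_right, h2]
      ring
    rw [h7]
    nlinarith [sq_nonneg (2 * a (c - y + x) + ‖affGrad a‖ * r)]
  rw [integral_add ((hi _).const_mul 2) ((hi _).const_mul 2), integral_const_mul,
    integral_const_mul] at key
  linarith

/-! ### Elements of a mesh -/

namespace Mesh

variable {Ω : Set (Pt d)} (𝓣 : Mesh Ω)

lemma isCompact_hull (t : Finset (Pt d)) : IsCompact (convexHull ℝ (t : Set (Pt d))) :=
  t.finite_toSet.isCompact_convexHull ℝ

lemma affineSpan_eq_top {t : Finset (Pt d)} (ht : t ∈ 𝓣.elements) :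
    affineSpan ℝ (range ((↑) : t → Pt d)) = ⊤ :=
  (𝓣.K.indep ht.1).affineSpan_eq_top_iff_card_eq_finrank_add_one.2 (by simp [ht.2])

/-- Affine interpolation at the vertices of an element. -/
lemma exists_affine {t : Finset (Pt d)} (ht : t ∈ 𝓣.elements) (φ : Pt d → ℝ) :
    ∃ a : Pt d →ᵃ[ℝ] ℝ, ∀ p ∈ t, a p = φ p := by
  classical
  let b : AffineBasis t ℝ (Pt d) := ⟨(↑), 𝓣.K.indep ht.1, 𝓣.affineSpan_eq_top ht⟩
  refine ⟨∑ i : t, φ i • b.coord i, fun p hp => ?_⟩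
  have h : ∀ i : t, b.coord i p = if i = ⟨p, hp⟩ then 1 else 0 := fun i => b.coord_apply i ⟨p, hp⟩
  have h2 : (∑ i : t, φ i • b.coord i : Pt d →ᵃ[ℝ] ℝ) p = ∑ i : t, φ i * b.coord i p := by
    induction (Finset.univ : Finset t) using Finset.induction_on with
    | empty => simp
    | insert i s hi ih => rw [Finset.sum_insert hi, Finset.sum_insert hi, ← ih]; simp
  rw [h2]
  simp [h]

/-- Elements with equally many vertices are distinct only if some vertex p of t is not in t'. The
hulls meet inside the hull of the common vertices, whose affine span misses p by affine
independence; it is a proper subspace, hence a null set. -/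
lemma aedisjoint {t t' : Finset (Pt d)} (ht : t ∈ 𝓣.elements) (ht' : t' ∈ 𝓣.elements)
    (hne : t ≠ t') :
    AEDisjoint volume (convexHull ℝ (t : Set (Pt d))) (convexHull ℝ (t' : Set (Pt d))) := by
  obtain ⟨p, hp, hp'⟩ : ∃ p ∈ t, p ∉ t' := by
    by_contra! h
    exact hne (Finset.eq_of_subset_of_card_le h (by rw [ht.2, ht'.2]))
  have hnt : affineSpan ℝ ((t : Set (Pt d)) ∩ t') ≠ ⊤ := by
    intro htop
    have h1 := (𝓣.K.indep ht.1).notMem_affineSpan_sdiff ⟨p, hp⟩ univ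
    refine h1 (affineSpan_mono ℝ ?_ (htop ▸ AffineSubspace.mem_top ℝ (Pt d) p))
    rintro q ⟨hq, hq'⟩
    refine ⟨⟨q, hq⟩, ⟨mem_univ _, fun h => ?_⟩, rfl⟩
    simp only [mem_singleton_iff, Subtype.mk.injEq] at h
    exact hp' (h ▸ hq')
  refine measure_mono_null ((𝓣.K.inter_subset_convexHull ht.1 ht'.1).trans
    (convexHull_subset_affineSpan _)) (Measure.addHaar_affineSubspace volume _ hnt)

lemma hull_ae_eq_interior (t : Finset (Pt d)) : ∀ᵐ x, x ∈ convexHull ℝ (t : Set (Pt d)) →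
    x ∈ interior (convexHull ℝ (t : Set (Pt d))) := by
  have h := (convex_convexHull ℝ (t : Set (Pt d))).addHaar_frontier volume
  filter_upwards [compl_mem_ae_iff.2 h] with x hx hxt
  by_contra hxi
  exact hx ⟨subset_closure hxt, hxi⟩

/-- Almost every point lies in the interior of an element or outside of the mesh. -/
lemma ae_mem_interior : ∀ᵐ x, ∀ t ∈ 𝓣.elements, x ∈ convexHull ℝ (t : Set (Pt d)) →
    x ∈ interior (convexHull ℝ (t : Set (Pt d))) :=
  (ae_ball_iff 𝓣.elements_finite.countable).2 fun t _ => hull_ae_eq_interior t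

lemma gradient_eq_zero {v : Pt d → ℝ} (hv : ∀ y, y ∉ 𝓣.K.space → v y = 0) {x : Pt d}
    (hx : x ∉ 𝓣.K.space) : gradient v x = 0 := by
  have h : v =ᶠ[𝓝 x] fun _ => (0 : ℝ) := by
    filter_upwards [𝓣.isClosed_space.isOpen_compl.mem_nhds hx] with y hy using hv y hy
  rw [h.gradient_eq, gradient_fun_const]

/-- The integral of a function that vanishes outside of the mesh, as a sum over the elements. -/
lemma integral_eq_sum [Fintype 𝓣.elements] {F : Pt d → ℝ} (hF : Integrable F)
    (h0 : ∀ x, x ∉ 𝓣.K.space → F x = 0) :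
    ∫ x, F x = ∑ t : 𝓣.elements, ∫ x in convexHull ℝ (t.1 : Set (Pt d)), F x := by
  have hU : 𝓣.K.space = ⋃ t : 𝓣.elements, convexHull ℝ (t.1 : Set (Pt d)) := by
    ext x
    simp [𝓣.mem_space_iff]
  have hd : Pairwise (Function.onFun (AEDisjoint volume)
      fun t : 𝓣.elements => convexHull ℝ (t.1 : Set (Pt d))) :=
    fun t t' hne => 𝓣.aedisjoint t.2 t'.2 fun h => hne (Subtype.ext h)
  have hm : ∀ t : 𝓣.elements, NullMeasurableSet (convexHull ℝ (t.1 : Set (Pt d))) volume :=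
    fun t => (isClosed_hull t.1).measurableSet.nullMeasurableSet
  have hsum := integral_iUnion_ae (f := F) hm hd hF.integrableOn
  rw [tsum_fintype, ← hU] at hsum
  rw [← hsum]
  exact (setIntegral_eq_integral_of_forall_compl_eq_zero h0).symm

/-- The element lies in a ball of radius h, and the balls used in `sq_norm_affGrad_le` have radius
h/(4γ). The ratio of volumes gives (4γ)^d, the factor (h/γ)² in that estimate gives γ². -/
lemma hull_inverse_inequality {t : Finset (Pt d)} (htc : t.Nonempty) {γ h : ℝ} (hγ : 0 < γ)
    (hh : 0 < h) (hdiam : Metric.diam (convexHull ℝ (t : Set (Pt d))) ≤ h) {c : Pt d}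
    (hc : Metric.ball c (h / γ) ⊆ convexHull ℝ (t : Set (Pt d))) (a : Pt d →ᵃ[ℝ] ℝ) :
    h ^ 2 * (volume.real (convexHull ℝ (t : Set (Pt d))) * ‖affGrad a‖ ^ 2) ≤
      4 * γ ^ 2 * (4 * γ) ^ d * ∫ x in convexHull ℝ (t : Set (Pt d)), a x ^ 2 := by
  obtain ⟨p, hp⟩ := htc
  have hpt : p ∈ convexHull ℝ (t : Set (Pt d)) := subset_convexHull ℝ _ hp
  have hcomp := isCompact_hull t
  have e3 : volume.real (convexHull ℝ (t : Set (Pt d))) ≤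
      h ^ d * volume.real (Metric.ball (0 : Pt d) 1) := by
    have h1 : convexHull ℝ (t : Set (Pt d)) ⊆ Metric.closedBall p h := fun x hx =>
      (Metric.dist_le_diam_of_mem hcomp.isBounded hx hpt).trans hdiam
    refine (measureReal_mono h1 (isCompact_closedBall p h).measure_lt_top.ne).trans (le_of_eq ?_)
    rw [Measure.addHaar_real_closedBall _ _ hh.le, finrank_euclideanSpace_fin]
  have e4 := sq_norm_affGrad_le a (div_pos hh hγ) hc hcomp
  have e5 : volume.real (Metric.ball (0 : Pt d) (h / γ / 4)) =
      (h / γ / 4) ^ d * volume.real (Metric.ball (0 : Pt d) 1) := by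
    rw [measureReal_def, Measure.addHaar_ball_of_pos _ _ (by positivity),
      finrank_euclideanSpace_fin, ENNReal.toReal_mul, ENNReal.toReal_ofReal (by positivity),
      measureReal_def]
  rw [e5] at e4
  set V := volume.real (Metric.ball (0 : Pt d) 1)
  have hpow : h ^ d = (4 * γ) ^ d * (h / γ / 4) ^ d := by
    rw [← mul_pow]; congr 1; field_simp
  calc h ^ 2 * (volume.real (convexHull ℝ (t : Set (Pt d))) * ‖affGrad a‖ ^ 2)
      ≤ h ^ 2 * (h ^ d * V * ‖affGrad a‖ ^ 2) := by gcongr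
    _ = γ ^ 2 * (4 * γ) ^ d * (‖affGrad a‖ ^ 2 * (h / γ) ^ 2 * ((h / γ / 4) ^ d * V)) := by
        rw [hpow, div_pow h γ 2]
        field_simp
    _ ≤ γ ^ 2 * (4 * γ) ^ d * (4 * ∫ x in convexHull ℝ (t : Set (Pt d)), a x ^ 2) :=
        mul_le_mul_of_nonneg_left e4 (by positivity)
    _ = _ := by ring

/-- The inverse inequality on shape regular, quasi-uniform meshes. -/
lemma inverse_inequality (hb : Bornology.IsBounded Ω) {γ h : ℝ} (hγ : 0 < γ)
    (hreg : 𝓣.Regular γ h) (v : 𝓣.space) :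
    h ^ 2 * ∫ x in Ω, ‖gradient (v : Pt d → ℝ) x‖ ^ 2 ≤
      4 * γ ^ 2 * (4 * γ) ^ d * ∫ x in Ω, (v : Pt d → ℝ) x ^ 2 := by
  obtain ⟨hh, helem, -⟩ := hreg
  have hfin : Finite 𝓣.elements := 𝓣.elements_finite
  have := Fintype.ofFinite 𝓣.elements
  have hv := 𝓣.adm v
  have hgz : ∀ x, x ∉ 𝓣.K.space → ‖gradient (v : Pt d → ℝ) x‖ ^ 2 = 0 := fun x hx => by
    rw [𝓣.gradient_eq_zero (fun y hy => v.2.2.2 y (Or.inr hy)) hx]; simp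
  have hgi : Integrable fun x => ‖gradient (v : Pt d → ℝ) x‖ ^ 2 := by
    have hvK : Adm 𝓣.K.space v := ⟨hv.1, fun x hx => v.2.2.2 x (Or.inr hx)⟩
    have h1 : IntegrableOn (fun x => ‖gradient (v : Pt d → ℝ) x‖ ^ 2) 𝓣.K.space :=
      integrable_sq_norm (hvK.memLp_gradient (hb.closure.subset 𝓣.subset))
    exact (integrableOn_iff_integrable_of_support_subset
      fun x hx => by_contra fun hx' => hx (hgz x hx')).1 h1
  have hvc : Continuous fun x => (v : Pt d → ℝ) x ^ 2 := hv.continuous.pow 2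
  have hvs : HasCompactSupport fun x => (v : Pt d → ℝ) x ^ 2 :=
    (hv.hasCompactSupport hb).comp_left (g := fun t : ℝ => t ^ 2) (by simp)
  have hvi : Integrable fun x => (v : Pt d → ℝ) x ^ 2 := hvc.integrable_of_hasCompactSupport hvs
  have e0 : ∫ x in Ω, (v : Pt d → ℝ) x ^ 2 =
      ∑ t : 𝓣.elements, ∫ x in convexHull ℝ (t.1 : Set (Pt d)), (v : Pt d → ℝ) x ^ 2 := by
    rw [setIntegral_eq_integral_of_forall_compl_eq_zero fun x hx => by simp [hv.2 x hx]]
    exact 𝓣.integral_eq_sum hvi fun x hx => by simp [v.2.2.2 x (Or.inr hx)]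
  -- An inequality suffices: enlarging the domain to the whole space avoids comparing Ω with the
  -- meshed region.
  have e1 : ∫ x in Ω, ‖gradient (v : Pt d → ℝ) x‖ ^ 2 ≤
      ∑ t : 𝓣.elements, ∫ x in convexHull ℝ (t.1 : Set (Pt d)),
        ‖gradient (v : Pt d → ℝ) x‖ ^ 2 := by
    rw [← 𝓣.integral_eq_sum hgi hgz]
    exact setIntegral_le_integral hgi (ae_of_all _ fun x => sq_nonneg _)
  have e2 : ∀ t : 𝓣.elements,
      h ^ 2 * ∫ x in convexHull ℝ (t.1 : Set (Pt d)), ‖gradient (v : Pt d → ℝ) x‖ ^ 2 ≤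
        4 * γ ^ 2 * (4 * γ) ^ d *
          ∫ x in convexHull ℝ (t.1 : Set (Pt d)), (v : Pt d → ℝ) x ^ 2 := by
    rintro ⟨t, ht⟩
    obtain ⟨hdiam, c, hc⟩ := helem t ht
    obtain ⟨a, ha⟩ := v.2.2.1 t ht
    have hcomp := isCompact_hull t
    have e3 : ∫ x in convexHull ℝ (t : Set (Pt d)), ‖gradient (v : Pt d → ℝ) x‖ ^ 2 =
        volume.real (convexHull ℝ (t : Set (Pt d))) * ‖affGrad a‖ ^ 2 := by
      rw [← smul_eq_mul, ← setIntegral_const]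
      refine setIntegral_congr_ae hcomp.measurableSet
        ((hull_ae_eq_interior t).mono fun x hx hxt => ?_)
      rw [gradient_eq_affGrad ha (hx hxt)]
    have e4 : ∫ x in convexHull ℝ (t : Set (Pt d)), (v : Pt d → ℝ) x ^ 2 =
        ∫ x in convexHull ℝ (t : Set (Pt d)), a x ^ 2 :=
      setIntegral_congr_fun hcomp.measurableSet fun x hx => by
        beta_reduce
        rw [ha hx]
    dsimp only
    rw [e3, e4]
    exact hull_inverse_inequality (Finset.card_pos.1 (by rw [ht.2]; omega)) hγ hh hdiam hc a
  calc h ^ 2 * ∫ x in Ω, ‖gradient (v : Pt d → ℝ) x‖ ^ 2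
      ≤ h ^ 2 * ∑ t : 𝓣.elements, ∫ x in convexHull ℝ (t.1 : Set (Pt d)),
        ‖gradient (v : Pt d → ℝ) x‖ ^ 2 := mul_le_mul_of_nonneg_left e1 (sq_nonneg h)
    _ ≤ _ := by
      rw [e0, Finset.mul_sum, Finset.mul_sum]
      exact Finset.sum_le_sum fun t _ => e2 t

end Mesh

variable {d : ℕ}

/-! ### Nodal interpolation of test functions -/

/-- Second order Taylor estimate with a uniform constant. -/
lemma IsTest.exists_taylor {Ω : Set (Pt d)} {φ : Pt d → ℝ} (hφ : IsTest Ω φ) :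
    ∃ H : ℝ, 0 ≤ H ∧ ∀ x y, |φ y - φ x - fderiv ℝ φ x (y - x)| ≤ H * ‖y - x‖ ^ 2 := by
  have h1 : ContDiff ℝ 1 (fderiv ℝ φ) := hφ.1.fderiv_right (m := 1) (by norm_cast)
  obtain ⟨K, hK⟩ := h1.lipschitzWith_of_hasCompactSupport (hφ.2.1.fderiv (𝕜 := ℝ)) (by norm_num)
  refine ⟨K, K.2, fun x y => ?_⟩
  have hd : Differentiable ℝ φ := hφ.1.differentiable (by simp)
  have := (convex_closedBall x ‖y - x‖).norm_image_sub_le_of_norm_fderiv_le' (𝕜 := ℝ) (f := φ)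
    (φ := fderiv ℝ φ x) (C := K * ‖y - x‖) (x := x) (y := y) (fun z _ => hd z)
    (fun z hz => by
      rw [← dist_eq_norm]
      refine (hK.dist_le_mul z x).trans ?_
      gcongr
      exact hz)
    (Metric.mem_closedBall_self (norm_nonneg _)) (by simp [dist_eq_norm])
  rw [Real.norm_eq_abs] at this
  exact this.trans (le_of_eq (by ring))

/-- Error of affine interpolation on a shape regular simplex. -/
lemma norm_gradient_sub_affGrad_le {φ : Pt d → ℝ} {H : ℝ} (hH : 0 ≤ H)
    (hT : ∀ x y, |φ y - φ x - fderiv ℝ φ x (y - x)| ≤ H * ‖y - x‖ ^ 2) {t : Finset (Pt d)}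
    {γ h : ℝ} (hγ : 0 < γ) (hh : 0 < h) (hdiam : Metric.diam (convexHull ℝ (t : Set (Pt d))) ≤ h)
    {c : Pt d} (hc : Metric.ball c (h / γ) ⊆ convexHull ℝ (t : Set (Pt d)))
    {a : Pt d →ᵃ[ℝ] ℝ} (ha : ∀ p ∈ t, a p = φ p) {x : Pt d}
    (hx : x ∈ convexHull ℝ (t : Set (Pt d))) :
    ‖gradient φ x - affGrad a‖ ≤ 4 * H * γ * h := by
  -- T is the tangent of φ at x. By Taylor, |a - T| ≤ Hh² at the vertices, hence on the whole
  -- element by convexity, and the inscribed ball of radius h/γ turns this into a gradient bound.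
  let T : Pt d →ᵃ[ℝ] ℝ := (fderiv ℝ φ x : Pt d →ₗ[ℝ] ℝ).toAffineMap +
    AffineMap.const ℝ (Pt d) (φ x - fderiv ℝ φ x x)
  have hTv : ∀ y, T y = φ x + fderiv ℝ φ x (y - x) := fun y => by
    simp [T]; ring
  have hb : ∀ y ∈ convexHull ℝ (t : Set (Pt d)), |(a - T) y| ≤ H * h ^ 2 := by
    have hconv : Convex ℝ {y | (a - T) y ∈ Icc (-(H * h ^ 2)) (H * h ^ 2)} :=
      (convex_Icc _ _).affine_preimage (a - T)
    intro y hy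
    refine abs_le.2 (convexHull_min (fun p hp => ?_) hconv hy)
    have h1 : (a - T) p = φ p - φ x - fderiv ℝ φ x (p - x) := by
      have : (a - T) p = a p - T p := rfl
      rw [this, ha p hp, hTv]
      ring
    show (a - T) p ∈ Icc _ _
    rw [mem_Icc, ← abs_le, h1]
    refine (hT x p).trans ?_
    have h2 : ‖p - x‖ ≤ h := by
      rw [← dist_eq_norm]
      exact (Metric.dist_le_diam_of_mem (Mesh.isCompact_hull t).isBounded
        (subset_convexHull ℝ _ hp) hx).trans hdiam
    gcongr
  have hg : gradient φ x - affGrad a = -affGrad (a - T) := by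
    have h3 : (a - T).linear = a.linear - (fderiv ℝ φ x : Pt d →ₗ[ℝ] ℝ) := by
      ext y; simp [T]
    rw [affGrad, affGrad, h3, map_sub, map_sub, neg_sub]
    rfl
  rw [hg, norm_neg]
  have h4 := norm_affGrad_mul_le (a - T) (div_pos hh hγ) (fun y hy => hb y (hc hy))
  rw [mul_div_assoc', div_le_iff₀ hγ] at h4
  refine le_of_mul_le_mul_right ?_ hh
  linarith

/-! ### The nodal interpolant as a function in X_h -/

namespace Mesh

variable {Ω : Set (Pt d)} (𝓣 : Mesh Ω)

open Classical in
/-- Gluing of affine functions on the elements, extended by zero. -/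
noncomputable def glue (a : Finset (Pt d) → Pt d →ᵃ[ℝ] ℝ) (x : Pt d) : ℝ :=
  if h : ∃ t ∈ 𝓣.elements, x ∈ convexHull ℝ (t : Set (Pt d)) then a h.choose x else 0

/-- The choice of the element is immaterial: two elements meet inside the hull of their common
vertices, where affine functions with the same vertex values agree. This is where the mesh must be
face-to-face. -/
lemma glue_eq {φ : Pt d → ℝ} {a : Finset (Pt d) → Pt d →ᵃ[ℝ] ℝ}
    (ha : ∀ t ∈ 𝓣.elements, ∀ p ∈ t, a t p = φ p) {t : Finset (Pt d)} (ht : t ∈ 𝓣.elements)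
    {x : Pt d} (hx : x ∈ convexHull ℝ (t : Set (Pt d))) : 𝓣.glue a x = a t x := by
  have h : ∃ t ∈ 𝓣.elements, x ∈ convexHull ℝ (t : Set (Pt d)) := ⟨t, ht, hx⟩
  obtain ⟨h1, h2⟩ := h.choose_spec
  rw [glue, dif_pos h]
  refine eq_of_eq_on_vertices _ (fun p hp => ?_) (𝓣.K.inter_subset_convexHull h1.1 ht.1 ⟨h2, hx⟩)
  rw [ha _ h1 p hp.1, ha t ht p hp.2]

lemma glue_eq_zero (a : Finset (Pt d) → Pt d →ᵃ[ℝ] ℝ) {x : Pt d} (hx : x ∉ 𝓣.K.space) :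
    𝓣.glue a x = 0 :=
  dif_neg fun h => hx (𝓣.mem_space_iff.2 h)

lemma continuous_glue {φ : Pt d → ℝ} {a : Finset (Pt d) → Pt d →ᵃ[ℝ] ℝ}
    (ha : ∀ t ∈ 𝓣.elements, ∀ p ∈ t, a t p = φ p)
    (h0 : ∀ x ∈ closure 𝓣.K.spaceᶜ, 𝓣.glue a x = 0) : Continuous (𝓣.glue a) := by
  have : Finite 𝓣.elements := 𝓣.elements_finite
  refine (locallyFinite_of_finite 𝓣.pieces).continuous
    (eq_univ_of_forall fun x => mem_iUnion.2 (𝓣.exists_mem_pieces x)) 𝓣.isClosed_pieces ?_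
  rintro (_ | ⟨t, ht⟩)
  · exact continuousOn_const.congr h0
  · exact ((a t).continuous_of_finiteDimensional.continuousOn).congr fun x hx => 𝓣.glue_eq ha ht hx

/-- On a sufficiently fine regular mesh, all points near the support of a test function are
meshed. -/
lemma Regular.ball_subset {𝓣 : Mesh Ω} (hd : 0 < d) (hb : Bornology.IsBounded Ω) (ho : IsOpen Ω)
    {γ h δ : ℝ} (hγ : 0 < γ) (hreg : 𝓣.Regular γ h) {p : Pt d}
    (hp : Metric.ball p δ ⊆ Ω) : Metric.ball p (δ - γ * h) ⊆ 𝓣.K.space := by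
  intro y hy
  obtain ⟨hh, -, hcov⟩ := hreg
  rw [Metric.mem_ball] at hy
  by_contra hys
  have hyΩ : y ∈ Ω := hp (by rw [Metric.mem_ball]; nlinarith)
  have : Nonempty (Fin d) := ⟨⟨0, hd⟩⟩
  -- Needed because the distance to the empty set is 0 by convention; Ω is not the whole space,
  -- being bounded with d > 0.
  have hfr : (frontier Ω).Nonempty := nonempty_frontier_iff.2
    ⟨⟨y, hyΩ⟩, fun h => NormedSpace.unbounded_univ ℝ (Pt d) (h ▸ hb)⟩
  have h1 : δ - dist y p ≤ Metric.infDist y (frontier Ω) := by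
    refine (Metric.le_infDist hfr).2 fun z hz => ?_
    have h2 : δ ≤ dist z p := by
      by_contra! hlt
      rw [ho.frontier_eq] at hz
      exact hz.2 (hp hlt)
    have := dist_triangle_left z p y
    linarith
  have := hcov y hyΩ hys
  linarith

/-- Test functions are approximated by finite element functions, uniformly over regular meshes. -/
lemma exists_interpolation (hd : 0 < d) (hb : Bornology.IsBounded Ω) (ho : IsOpen Ω)
    {φ : Pt d → ℝ} (hφ : IsTest Ω φ) {γ : ℝ} (hγ : 0 < γ) :
    ∃ h₀ C : ℝ, 0 < h₀ ∧ 0 ≤ C ∧ ∀ (h : ℝ) (𝓣 : Mesh Ω), h < h₀ → 𝓣.Regular γ h →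
      ∃ v : 𝓣.space, ∀ᵐ x ∂(volume.restrict Ω),
        ‖gradient φ x - gradient (v : Pt d → ℝ) x‖ ≤ C * h := by
  obtain ⟨H, hH, hT⟩ := hφ.exists_taylor
  obtain ⟨δ, hδ, hδΩ⟩ := hφ.2.1.isCompact.exists_cthickening_subset_open ho hφ.2.2
  have hball : ∀ p ∈ tsupport φ, Metric.ball p δ ⊆ Ω := fun p hp =>
    (Metric.ball_subset_thickening hp δ).trans ((Metric.thickening_subset_cthickening _ _).trans hδΩ)
  -- For (1 + γ)h < δ, an element with a vertex where φ ≠ 0 lies within h < δ - γh of that vertex,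
  -- inside the region guaranteed to be meshed.
  refine ⟨δ / (1 + γ), 4 * H * γ, by positivity, by positivity, fun h 𝓣 hh₀ hreg => ?_⟩
  rw [lt_div_iff₀ (by positivity), mul_comm] at hh₀
  obtain ⟨hh, helem, -⟩ := id hreg
  have hin : ∀ p ∈ tsupport φ, Metric.ball p (δ - γ * h) ⊆ 𝓣.K.space := fun p hp =>
    hreg.ball_subset hd hb ho hγ (hball p hp)
  choose! a ha using fun (t : Finset (Pt d)) (ht : t ∈ 𝓣.elements) => 𝓣.exists_affine ht φ
  have hsupp : ∀ x, 𝓣.glue a x ≠ 0 → ∃ p ∈ tsupport φ, x ∈ Metric.ball p (δ - γ * h) := by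
    intro x hx
    have hxs : x ∈ 𝓣.K.space := by_contra fun hxs => hx (𝓣.glue_eq_zero a hxs)
    obtain ⟨t, ht, hxt⟩ := 𝓣.mem_space_iff.1 hxs
    rw [𝓣.glue_eq ha ht hxt] at hx
    have hex : ∃ p ∈ t, φ p ≠ 0 := by
      by_contra! hall
      refine hx ?_
      have := eq_of_eq_on_vertices (a := a t) (b := 0) (t : Set (Pt d))
        (fun p hp => by rw [ha t ht p hp, hall p hp]; rfl) hxt
      simpa using this
    obtain ⟨p, hp, hφp⟩ := hex
    refine ⟨p, subset_tsupport _ hφp, ?_⟩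
    have h1 : dist x p ≤ h := (Metric.dist_le_diam_of_mem (isCompact_hull t).isBounded hxt
      (subset_convexHull ℝ _ hp)).trans (helem t ht).1
    rw [Metric.mem_ball]
    linarith
  -- Vanishing on the closure of the unmeshed region, not just on the region itself, is what makes
  -- the extension by zero continuous.
  have hcl : ∀ x ∈ closure 𝓣.K.spaceᶜ, 𝓣.glue a x = 0 := by
    intro x hx
    by_contra hne
    obtain ⟨p, hp, hxp⟩ := hsupp x hne
    obtain ⟨y, hy1, hy2⟩ := mem_closure_iff.1 hx _ Metric.isOpen_ball hxp
    exact hy2 (hin p hp hy1)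
  refine ⟨⟨𝓣.glue a, 𝓣.continuous_glue ha hcl,
    fun t ht => ⟨a t, fun x hx => 𝓣.glue_eq ha ht hx⟩, ?_⟩, ?_⟩
  · rintro x (hx | hx)
    · by_contra hne
      obtain ⟨p, hp, hxp⟩ := hsupp x hne
      exact hx (hball p hp (Metric.ball_subset_ball (by nlinarith) hxp))
    · exact 𝓣.glue_eq_zero a hx
  · filter_upwards [ae_restrict_of_ae 𝓣.ae_mem_interior] with x hx
    by_cases hxs : x ∈ 𝓣.K.space
    · obtain ⟨t, ht, hxt⟩ := 𝓣.mem_space_iff.1 hxs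
      obtain ⟨hdiam, c, hc⟩ := helem t ht
      have h1 : EqOn (𝓣.glue a) (a t) (convexHull ℝ (t : Set (Pt d))) :=
        fun x hx => 𝓣.glue_eq ha ht hx
      rw [gradient_eq_affGrad h1 (hx t ht hxt)]
      exact norm_gradient_sub_affGrad_le hH hT hγ hh hdiam hc (ha t ht) hxt
    · have h1 : x ∉ tsupport φ := fun hxφ =>
        hxs (hin x hxφ (Metric.mem_ball_self (by nlinarith)))
      rw [𝓣.gradient_eq_zero (fun y hy => 𝓣.glue_eq_zero a hy) hxs, (notMem_tsupport_iff_eventuallyEq.1 h1).gradient_eq, sub_zero,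
        show (0 : Pt d → ℝ) = fun _ => 0 from rfl, gradient_fun_const, norm_zero]
      positivity

end Mesh

lemma IsTest.adm {d : ℕ} {Ω : Set (Pt d)} {φ : Pt d → ℝ} (hφ : IsTest Ω φ) : Adm Ω φ :=
  ⟨hφ.1.lipschitzWith_of_hasCompactSupport hφ.2.1 (by simp),
    fun _ hx => image_eq_zero_of_notMem_tsupport fun h => hx (hφ.2.2 h)⟩

namespace Problem

variable {d : ℕ} {P : Problem d} {m₀ L A : ℝ}

/-! ### Estimates for the initial value -/

lemma nr_G₀ : P.nr P.G₀ = √P.initSq := rfl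

lemma nr_G₀_le_K : P.nr P.G₀ ≤ P.K := by
  rw [nr_G₀, K]
  exact le_add_of_nonneg_right ENNReal.toReal_nonneg

lemma initSq_nonneg : 0 ≤ P.initSq := integral_nonneg fun _ => by positivity

/-- The Ritz projection is quasi-optimal. -/
lemma initial_quasi_optimal (hE : P.Elliptic m₀ L A) (hP : P.Standing) (h1 : P.H1) {𝓣 : Mesh P.Ω}
    {u : ℕ → 𝓣.space} (hu : P.InitialStep 𝓣 u) (v : 𝓣.space) :
    P.nr (fun x => P.G₀ x - gradient (u 0 : Pt d → ℝ) x) ≤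
      (A + L * P.initSq) / m₀ * P.nr (fun x => P.G₀ x - gradient (v : Pt d → ℝ) x) := by
  obtain ⟨hd, ho, -, hb, hT, -, -⟩ := hP
  have ht : (0 : ℝ) ∈ Icc 0 P.T := ⟨le_rfl, hT.le⟩
  have hs : 0 ≤ P.initSq := initSq_nonneg
  have hc := hE.isCoeff ho ht hs
  have hG : MemLp P.G₀ 2 (volume.restrict P.Ω) := h1.1.1.2.1
  have hu0 := (𝓣.adm (u 0)).memLp_gradient hb
  have hv := (𝓣.adm v).memLp_gradient hb
  have hEu := hG.sub hu0
  have hEv := hG.sub hv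
  have e1 := hc.le_integral (hE.ae_lower ho ht hs) hEu
  have e2 := (hc.bound hEu hEv).2
  -- Galerkin orthogonality, tested with v - u⁰, as in Céa's lemma.
  have e3 : ∫ x in P.Ω, P.M x 0 P.initSq * inner ℝ ((P.G₀ - gradient (u 0 : Pt d → ℝ)) x)
        ((P.G₀ - gradient (u 0 : Pt d → ℝ)) x) =
      ∫ x in P.Ω, P.M x 0 P.initSq * inner ℝ ((P.G₀ - gradient (u 0 : Pt d → ℝ)) x)
        ((P.G₀ - gradient (v : Pt d → ℝ)) x) := by
    rw [← sub_eq_zero, ← integral_sub (hc.bound hEu hEu).1 (hc.bound hEu hEv).1]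
    refine (integral_congr_ae ?_).trans (hu (v - u 0))
    filter_upwards [ae_restrict_of_ae ((𝓣.adm v).gradient_sub (𝓣.adm (u 0)))] with x hx
    rw [Submodule.coe_sub, hx, ← mul_sub, ← inner_sub_right]
    simp
  rw [e3] at e1
  have e4 := e1.trans ((le_abs_self _).trans e2)
  have hm := hE.pos
  change _ ≤ _ * P.nr (P.G₀ - gradient (v : Pt d → ℝ))
  change P.nr (P.G₀ - gradient (u 0 : Pt d → ℝ)) ≤ _
  rcases (P.nr_nonneg (P.G₀ - gradient (u 0 : Pt d → ℝ))).eq_or_lt with h | h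
  · rw [← h]
    exact mul_nonneg (div_nonneg hc.1 hm.le) (P.nr_nonneg _)
  · rw [div_mul_eq_mul_div, le_div_iff₀ hm]
    refine le_of_mul_le_mul_left ?_ h
    linarith

lemma gn_initial_le (hP : P.Standing) (h1 : P.H1) {𝓣 : Mesh P.Ω}
    (u : ℕ → 𝓣.space) :
    P.gn 𝓣 (u 0) ≤ P.nr P.G₀ + P.nr (fun x => P.G₀ x - gradient (u 0 : Pt d → ℝ) x) := by
  have hb := hP.2.2.2.1
  have hG : MemLp P.G₀ 2 (volume.restrict P.Ω) := h1.1.1.2.1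
  have hu0 := (𝓣.adm (u 0)).memLp_gradient hb
  have := nrm_add_le hG (hu0.sub hG)
  simp only [Pi.sub_apply, add_sub_cancel] at this
  refine this.trans (add_le_add_right (le_of_eq ?_) _)
  exact nrm_sub_comm _ _

/-- Quasi-optimality against v = 0; this needs no regularity of the mesh. -/
lemma gn_initial_le_const (hE : P.Elliptic m₀ L A) (hP : P.Standing) (h1 : P.H1) {𝓣 : Mesh P.Ω}
    {u : ℕ → 𝓣.space} (hu : P.InitialStep 𝓣 u) :
    P.gn 𝓣 (u 0) ≤ P.nr P.G₀ + (A + L * P.initSq) / m₀ * P.nr P.G₀ := by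
  refine (gn_initial_le hP h1 u).trans
    (add_le_add_right ((initial_quasi_optimal hE hP h1 hu 0).trans (le_of_eq ?_)) _)
  have : gradient ((0 : 𝓣.space) : Pt d → ℝ) = fun _ => 0 := by
    exact gradient_const' 0
  simp only [this, sub_zero]

/-- The initial values converge in `H¹`, uniformly over regular meshes. -/
lemma exists_test_close (hE : P.Elliptic m₀ L A) (hP : P.Standing) (h1 : P.H1) {γ : ℝ} (hγ : 0 < γ)
    {η : ℝ} (hη : 0 < η) : ∃ φ : Pt d → ℝ, IsTest P.Ω φ ∧ ∃ h₀ : ℝ, 0 < h₀ ∧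
      ∀ (h : ℝ) (𝓣 : Mesh P.Ω), h < h₀ → 𝓣.Regular γ h → ∀ u : ℕ → 𝓣.space, P.InitialStep 𝓣 u →
        P.nr (fun x => P.G₀ x - gradient (u 0 : Pt d → ℝ) x) ≤ η ∧
        P.nr (fun x => gradient (u 0 : Pt d → ℝ) x - gradient φ x) ≤ η := by
  obtain ⟨hd, ho, -, hb, hT, -, -⟩ := id hP
  have hG : MemLp P.G₀ 2 (volume.restrict P.Ω) := h1.1.1.2.1
  have : IsFiniteMeasure (volume.restrict P.Ω) := isFiniteMeasure_restrict.2 hb.measure_lt_top.ne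
  set q := (A + L * P.initSq) / m₀ with hq
  have hq0 : 0 ≤ q := div_nonneg (add_nonneg hE.A_nonneg (mul_nonneg hE.L_nonneg initSq_nonneg))
    hE.pos.le
  -- The test function is within η' of u₀ and its interpolant within η' of it, so the projection
  -- error is at most 2qη'; one more η' leads back to φ, and the total is η.
  set η' := η / (2 * q + 1) with hη'
  have hη'0 : 0 < η' := by positivity
  have hηq : q * (2 * η') + η' = η := by rw [hη']; field_simp
  obtain ⟨-, φs, hφs, -, hlim⟩ := h1.2.1
  obtain ⟨n, hn⟩ := (hlim.eventually_lt_const (ENNReal.ofReal_pos.2 hη'0)).exists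
  have hφ := hφs n
  set φ := φs n
  have hφL := hφ.adm.memLp_gradient hb
  have e1 : P.nr (fun x => P.G₀ x - gradient φ x) ≤ η' := by
    have e2 : P.nr (gradient φ - P.G₀) ≤ η' := by
      unfold nr
      rw [nrm_eq_eLpNorm (hφL.sub hG)]
      exact ENNReal.toReal_le_of_le_ofReal hη'0.le hn.le
    exact (nrm_sub_comm _ _).trans_le e2
  obtain ⟨h₁, C, hh₁, hC, hint⟩ := Mesh.exists_interpolation hd hb ho hφ hγ
  set V := √((volume.restrict P.Ω).real univ)
  refine ⟨φ, hφ, min h₁ (η' / (C * V + 1)), by positivity, fun h 𝓣 hh hreg u hu => ?_⟩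
  obtain ⟨v, hv⟩ := hint h 𝓣 (hh.trans_le (min_le_left _ _)) hreg
  have hh0 : 0 < h := hreg.1
  have hvL := (𝓣.adm v).memLp_gradient hb
  have huL := (𝓣.adm (u 0)).memLp_gradient hb
  have e3 : P.nr (fun x => gradient φ x - gradient (v : Pt d → ℝ) x) ≤ η' := by
    refine (nrm_le_of_bound (by positivity) hv).trans ?_
    have h2 := (hh.trans_le (min_le_right _ _)).le
    rw [le_div_iff₀ (by positivity)] at h2
    change C * h * V ≤ η'
    nlinarith
  have e4 : P.nr (fun x => P.G₀ x - gradient (v : Pt d → ℝ) x) ≤ 2 * η' :=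
    (nrm_sub_le hG hφL hvL).trans (by change P.nr _ + P.nr _ ≤ _; linarith)
  have e5 : P.nr (fun x => P.G₀ x - gradient (u 0 : Pt d → ℝ) x) ≤ q * (2 * η') :=
    (initial_quasi_optimal hE hP h1 hu v).trans (mul_le_mul_of_nonneg_left e4 hq0)
  refine ⟨by linarith, (nrm_sub_le huL hG hφL).trans ?_⟩
  change P.nr _ + P.nr _ ≤ η
  have e6 : P.nr (fun x => gradient (u 0 : Pt d → ℝ) x - P.G₀ x) =
      P.nr (fun x => P.G₀ x - gradient (u 0 : Pt d → ℝ) x) := nrm_sub_comm _ _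
  linarith

/-! ### Estimates for the first step -/

lemma exists_load_le (h1 : P.H1) : ∃ C : ℝ, 0 ≤ C ∧ ∀ t ∈ Icc 0 P.T, P.nr (P.f t) ≤ C := by
  obtain ⟨-, -, -, C, hC⟩ := h1
  refine ⟨max C 0, le_max_right _ _, fun t ht => le_trans (le_of_eq ?_) ((hC t ht).trans (le_max_left _ _))⟩
  rw [Lp.norm_def]
  exact nrm_eq_eLpNorm (Lp.memLp _)

/-- The right-hand side of the first step is bounded, uniformly in the mesh and the time step. -/
lemma exists_firstStep_rhs_le (hP : P.Standing) (h1 : P.H1) (h3 : P.H3) :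
    ∃ F Q : ℝ, 0 ≤ F ∧ 0 ≤ Q ∧ ∀ (𝓣 : Mesh P.Ω) (N : ℕ), 1 ≤ N → ∀ u v : 𝓣.space,
      P.ip (P.f (P.node N 1)) v + P.step N * P.B (P.node N 1) (P.node N 0) u v ≤
        F * P.nr (v : Pt d → ℝ) +
          P.step N * (Q * P.gn 𝓣 u * (P.gn 𝓣 v + P.nr (v : Pt d → ℝ))) := by
  obtain ⟨hd, ho, -, hb, hT, -, -⟩ := id hP
  obtain ⟨F, hF0, hF⟩ := exists_load_le h1
  obtain ⟨Cp, hCp0, hCp⟩ := poincare hd hb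
  obtain ⟨CB, hCB0, hCB⟩ := P.exists_memory_le hP h3
  refine ⟨F, CB * (1 + Cp), hF0, by positivity, fun 𝓣 N hN u v => ?_⟩
  have ht1 : P.node N 1 ∈ Icc 0 P.T := node_mem hP hN hN
  have ht0 : P.node N 0 ∈ Icc 0 P.T := node_mem hP hN (Nat.zero_le N)
  have hk := step_pos hP hN
  have e1 : P.ip (P.f (P.node N 1)) v ≤ F * P.nr (v : Pt d → ℝ) :=
    ((le_abs_self _).trans (P.ip_bound (Lp.memLp _) ((𝓣.adm v).memLp hb)).2).trans
      (mul_le_mul_of_nonneg_right (hF _ ht1) (P.nr_nonneg _))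
  have e2 : P.B (P.node N 1) (P.node N 0) u v ≤
      CB * (1 + Cp) * P.gn 𝓣 u * (P.gn 𝓣 v + P.nr (v : Pt d → ℝ)) := by
    refine ((le_abs_self _).trans (hCB _ ht1 _ ht0 u v (𝓣.adm u) (𝓣.adm v)).2).trans ?_
    have h4 : P.gn 𝓣 u + P.nr (u : Pt d → ℝ) ≤ (1 + Cp) * P.gn 𝓣 u := by
      have : P.nr (u : Pt d → ℝ) ≤ Cp * P.gn 𝓣 u := hCp u (𝓣.adm u)
      linarith
    have h5 : 0 ≤ P.gn 𝓣 v + P.nr (v : Pt d → ℝ) := add_nonneg (P.gn_nonneg 𝓣 v) (P.nr_nonneg _)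
    calc CB * ((P.gn 𝓣 u + P.nr (u : Pt d → ℝ)) * (P.gn 𝓣 v + P.nr (v : Pt d → ℝ)))
        ≤ CB * (((1 + Cp) * P.gn 𝓣 u) * (P.gn 𝓣 v + P.nr (v : Pt d → ℝ))) := by gcongr
      _ = _ := by ring
  gcongr

variable {𝓣 : Mesh P.Ω}

lemma gradForm_add_coeff (hb : Bornology.IsBounded P.Ω) {g g' : Pt d → ℝ} {B B' B'' : ℝ}
    (hg : P.IsCoeff g B) (hg' : P.IsCoeff g' B') (hgg : P.IsCoeff (fun x => g x + g' x) B'')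
    (v w : 𝓣.space) :
    P.gradForm 𝓣 hb hgg v w = P.gradForm 𝓣 hb hg v w + P.gradForm 𝓣 hb hg' v w := by
  simp only [gradForm_apply]
  rw [← integral_add (hg.bound ((𝓣.adm v).memLp_gradient hb) ((𝓣.adm w).memLp_gradient hb)).1
    (hg'.bound ((𝓣.adm v).memLp_gradient hb) ((𝓣.adm w).memLp_gradient hb)).1]
  exact integral_congr_ae (ae_of_all _ fun x => add_mul _ _ _)

/-- If `‖∇u‖ ≥ ‖∇(u - δ)‖`, then `(M ∇u, ∇δ)` controls `‖∇δ‖`, with constants that depend on the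
lower bound and the oscillation of `M(·,t,s)` only. -/
lemma le_diffusion_of_le (hE : P.Elliptic m₀ L A) (ho : IsOpen P.Ω) (hb : Bornology.IsBounded P.Ω)
    {ρ : ℝ} (hρ : ∀ x ∈ closure P.Ω, ‖x‖ ≤ ρ) {t s : ℝ} (ht : t ∈ Icc 0 P.T) (hs : 0 ≤ s)
    (hne : P.Ω.Nonempty) (u₀ u₁ : 𝓣.space) (hle : P.gn 𝓣 u₀ ≤ P.gn 𝓣 u₁) :
    m₀ / 2 * P.gn 𝓣 (u₁ - u₀) ^ 2 - L * (2 * ρ) * (P.gn 𝓣 u₀ * P.gn 𝓣 (u₁ - u₀)) ≤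
      P.diffusion t s u₁ (u₁ - u₀ : 𝓣.space) := by
  have hcont : ContinuousOn (fun x => P.M x t s) (closure P.Ω) := by
    have : LipschitzOnWith ⟨L, hE.L_nonneg⟩ (fun x => P.M x t s) (closure P.Ω) :=
      LipschitzOnWith.of_dist_le_mul fun x hx y hy => by
        rw [Real.dist_eq, dist_eq_norm]
        exact hE.lip_space x hx y hy t ht s hs
    exact this.continuousOn
  obtain ⟨x₀, hx₀, hmin⟩ := hb.isCompact_closure.exists_isMinOn hne.closure hcont
  -- With c the minimum of M(·,t,s) over Ω̄, M splits into a constant and a remainder between 0 and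
  -- 2Lρ, a bound that does not see s.
  set c := P.M x₀ t s
  have hcm : m₀ ≤ c := hE.lower x₀ hx₀ t ht s hs
  have hρ0 : 0 ≤ ρ := (norm_nonneg _).trans (hρ x₀ hx₀)
  set δ := u₁ - u₀ with hδ
  have hcc : P.IsCoeff (fun _ => c) |c| :=
    ⟨abs_nonneg _, aestronglyMeasurable_const, ae_of_all _ fun _ => le_rfl⟩
  have hr : P.IsCoeff (fun x => P.M x t s - c) (L * (2 * ρ)) := by
    refine ⟨mul_nonneg hE.L_nonneg (by positivity),
      (hE.measurable ho ht hs).sub aestronglyMeasurable_const,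
      (ae_restrict_mem ho.measurableSet).mono fun x hx => ?_⟩
    refine (hE.lip_space x (subset_closure hx) x₀ hx₀ t ht s hs).trans
      (mul_le_mul_of_nonneg_left ?_ hE.L_nonneg)
    exact (norm_sub_le _ _).trans (by linarith [hρ x (subset_closure hx), hρ x₀ hx₀])
  have hr0 : ∀ᵐ x ∂(volume.restrict P.Ω), 0 ≤ P.M x t s - c :=
    (ae_restrict_mem ho.measurableSet).mono fun x hx => sub_nonneg.2 (hmin (subset_closure hx))
  have hsum : P.IsCoeff (fun x => c + (P.M x t s - c)) (A + L * s) := by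
    simpa using hE.isCoeff ho ht hs
  have e0 : P.diffusion t s u₁ (δ : Pt d → ℝ) = P.gradForm 𝓣 hb hsum u₁ δ := by
    simp only [gradForm_apply, add_sub_cancel]
    rfl
  have e1 : P.gradForm 𝓣 hb hcc u₁ δ = c * P.gradForm 𝓣 hb P.isCoeff_one u₁ δ := by
    simp only [gradForm_apply, one_mul, integral_const_mul]
  have hself : ∀ v : 𝓣.space, P.gradForm 𝓣 hb P.isCoeff_one v v = P.gn 𝓣 v ^ 2 := fun v => by
    simp only [gradForm_apply, one_mul, real_inner_self_eq_norm_sq]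
    exact (sq_nrm _).symm
  have hu0 : u₀ = u₁ - δ := by rw [hδ]; abel
  clear_value δ
  -- Polarization: as ‖∇u₁‖ ≥ ‖∇u₀‖, the constant part contributes at least c‖∇δ‖²/2. In the
  -- remainder u₁ = u₀ + δ, and the δ-part is nonnegative.
  have e2 : 2 * P.gradForm 𝓣 hb P.isCoeff_one u₁ δ =
      P.gn 𝓣 u₁ ^ 2 - P.gn 𝓣 u₀ ^ 2 + P.gn 𝓣 δ ^ 2 := by
    have := P.gradForm_comm 𝓣 hb P.isCoeff_one δ u₁
    rw [← hself, ← hself, ← hself, hu0]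
    simp only [map_sub, LinearMap.sub_apply, this]
    ring
  have e3 : P.gn 𝓣 δ ^ 2 / 2 ≤ P.gradForm 𝓣 hb P.isCoeff_one u₁ δ := by
    have := pow_le_pow_left₀ (P.gn_nonneg 𝓣 u₀) hle 2
    linarith
  have e4 : P.gradForm 𝓣 hb hr u₁ δ = P.gradForm 𝓣 hb hr u₀ δ + P.gradForm 𝓣 hb hr δ δ := by
    rw [← LinearMap.add_apply, ← map_add]
    rw [hu0, sub_add_cancel]
  have e5 := P.le_gradForm 𝓣 hb hr hr0 δ
  have e6 : -(L * (2 * ρ) * (P.gn 𝓣 u₀ * P.gn 𝓣 δ)) ≤ P.gradForm 𝓣 hb hr u₀ δ :=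
    (abs_le.1 (P.abs_gradForm_le 𝓣 hb hr u₀ δ)).1
  rw [e0, P.gradForm_add_coeff hb hcc hr hsum, e1, e4]
  have e7 : m₀ * (P.gn 𝓣 δ ^ 2 / 2) ≤ c * P.gradForm 𝓣 hb P.isCoeff_one u₁ δ :=
    mul_le_mul hcm e3 (by positivity) (hE.pos.le.trans hcm)
  linarith

end Problem

/-! ### Gradient bounds and uniqueness for the first step -/

namespace Problem

variable {d : ℕ} {P : Problem d} {m₀ L A : ℝ}

/-- By Young's inequality κl² absorbs cl up to mε²/16. What remains, y² ≤ εy/4 + ε²/16, fails for y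
> ε/2. -/
lemma le_half_of_energy_le {κ m ε c l y : ℝ} (hκ : 0 < κ) (hm : 0 < m) (hε : 0 < ε)
    (h : κ * l ^ 2 + m * y ^ 2 ≤ m * ε / 4 * y + c * l) (hc : c ^ 2 ≤ κ * (m * ε ^ 2 / 4)) :
    y ≤ ε / 2 := by
  have e1 : c * l ≤ κ * l ^ 2 + m * ε ^ 2 / 16 := by
    refine le_of_mul_le_mul_left ?_ hκ
    have h2 := sq_nonneg (κ * l - c / 2)
    have h3 : (κ * l - c / 2) ^ 2 = κ * (κ * l ^ 2) - κ * (c * l) + c ^ 2 / 4 := by ring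
    rw [mul_add]
    linarith
  by_contra! hlt
  have h2 : m * y ^ 2 ≤ m * (ε / 4 * y + ε ^ 2 / 16) := by linarith
  have h3 := le_of_mul_le_mul_left h2 hm
  nlinarith [mul_pos (sub_pos.2 hlt) (show 0 < y + ε / 4 by linarith), pow_pos hε 2]

/-- The first approximations are bounded, uniformly in the mesh and the time step. -/
lemma exists_firstStep_bound (hE : P.Elliptic m₀ L A) (hP : P.Standing) (h1 : P.H1) (h3 : P.H3) :
    ∃ R : ℝ, 0 ≤ R ∧ ∀ (𝓣 : Mesh P.Ω) (N : ℕ), 1 ≤ N → P.step N ≤ 1 → ∀ u : ℕ → 𝓣.space,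
      P.InitialStep 𝓣 u → P.FirstStep 𝓣 N u → P.gn 𝓣 (u 0) ≤ R ∧ P.gn 𝓣 (u 1) ≤ R := by
  obtain ⟨hd, ho, -, hb, hT, -, -⟩ := id hP
  -- The standing assumptions allow Ω = ∅, where M has no minimum to compare with; all norms are
  -- then 0.
  rcases P.Ω.eq_empty_or_nonempty with he | hne
  · refine ⟨0, le_rfl, fun 𝓣 N _ _ u _ _ => ?_⟩
    have : ∀ v : 𝓣.space, P.gn 𝓣 v ≤ 0 := fun v => by
      simp [gn, nr, nrm, he]
    exact ⟨this _, this _⟩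
  obtain ⟨F, Q, hF0, hQ0, hFQ⟩ := exists_firstStep_rhs_le hP h1 h3
  obtain ⟨Cp, hCp0, hCp⟩ := poincare hd hb
  obtain ⟨ρ, -, hρ⟩ := hb.closure.exists_pos_norm_le
  have hL0 := hE.L_nonneg
  have hm := hE.pos
  have hρ0 : 0 ≤ ρ := (norm_nonneg _).trans (hρ _ hne.closure.some_mem)
  set C₀ := P.nr P.G₀ + (A + L * P.initSq) / m₀ * P.nr P.G₀
  have hC₀ : 0 ≤ C₀ := add_nonneg (P.nr_nonneg _) (mul_nonneg
    (div_nonneg (add_nonneg hE.A_nonneg (mul_nonneg hL0 initSq_nonneg)) hm.le) (P.nr_nonneg _))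
  set C₁ := F * Cp + Q * C₀ * (1 + Cp) + L * (2 * ρ) * C₀
  have hC₁ : 0 ≤ C₁ := by positivity
  refine ⟨C₀ + 2 * C₁ / m₀, by positivity, fun 𝓣 N hN hk u hu0 hu1 => ?_⟩
  have h0 : P.gn 𝓣 (u 0) ≤ C₀ := gn_initial_le_const hE hP h1 hu0
  have hnn : 0 ≤ 2 * C₁ / m₀ := by positivity
  refine ⟨by linarith, ?_⟩
  rcases le_total (P.gn 𝓣 (u 1)) (P.gn 𝓣 (u 0)) with hle | hle
  · linarith
  -- Testing with u¹ - u⁰ rather than u¹ keeps the κ-term nonnegative; with u¹ there would remain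
  -- κ‖u⁰‖², which is unbounded as k tends to 0.
  have e1 := (firstStep_iff hP u).1 hu1 (u 1 - u 0)
  have e2 := hFQ 𝓣 N hN (u 0) (u 1 - u 0)
  have e3 := le_diffusion_of_le hE ho hb hρ (node_mem hP hN hN) (P.gradSq_nonneg (u 1 : Pt d → ℝ))
    hne (u 0) (u 1) hle
  have e4 : P.nr ((u 1 - u 0 : 𝓣.space) : Pt d → ℝ) ≤ Cp * P.gn 𝓣 (u 1 - u 0) :=
    hCp _ (𝓣.adm (u 1 - u 0))
  have e5 := P.gn_le_add_sub 𝓣 hb (u 1) (u 0)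
  have hκ := (l1Const_pos hP hN).le
  have hk0 := (step_pos hP hN).le
  have e6 : 0 ≤ P.l1Const N * P.ip ((u 1 - u 0 : 𝓣.space) : Pt d → ℝ) (u 1 - u 0 : 𝓣.space) := by
    rw [ip_self]
    positivity
  set y := P.gn 𝓣 (u 1 - u 0)
  set l := P.nr ((u 1 - u 0 : 𝓣.space) : Pt d → ℝ)
  have hy0 : 0 ≤ y := P.gn_nonneg 𝓣 _
  have hl0 : 0 ≤ l := P.nr_nonneg _
  have hg0 := P.gn_nonneg 𝓣 (u 0)
  have e7 : F * l + P.step N * (Q * P.gn 𝓣 (u 0) * (y + l)) ≤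
      F * (Cp * y) + 1 * (Q * C₀ * (y + Cp * y)) := by gcongr
  have e8 : L * (2 * ρ) * (P.gn 𝓣 (u 0) * y) ≤ L * (2 * ρ) * (C₀ * y) := by gcongr
  have e9 : m₀ / 2 * y ^ 2 ≤ C₁ * y := by
    have : C₁ * y = F * (Cp * y) + 1 * (Q * C₀ * (y + Cp * y)) + L * (2 * ρ) * (C₀ * y) := by
      ring
    linarith
  have e10 : y ≤ 2 * C₁ / m₀ := by
    rw [le_div_iff₀ hm]
    rcases hy0.eq_or_lt with h | h
    · rw [← h]; linarith
    · nlinarith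
  linarith

/-- On fine meshes and for small time steps, `‖∇u¹‖` exceeds `‖∇u₀‖` by little. -/
lemma exists_gn_firstStep_le (hE : P.Elliptic m₀ L A) (hP : P.Standing) (h1 : P.H1) (h3 : P.H3)
    {γ : ℝ} (hγ : 0 < γ) {ε : ℝ} (hε : 0 < ε) :
    ∃ h₀ k₀ κ₀ : ℝ, 0 < h₀ ∧ 0 < k₀ ∧ ∀ (h : ℝ) (𝓣 : Mesh P.Ω), h < h₀ → 𝓣.Regular γ h →
      ∀ N : ℕ, 1 ≤ N → P.step N ≤ 1 → P.step N < k₀ → κ₀ < P.l1Const N → ∀ u : ℕ → 𝓣.space,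
        P.InitialStep 𝓣 u → P.FirstStep 𝓣 N u → P.gn 𝓣 (u 1) ≤ P.nr P.G₀ + ε := by
  obtain ⟨hd, ho, -, hb, hT, -, -⟩ := id hP
  have hL0 := hE.L_nonneg
  have hm := hE.pos
  obtain ⟨F, Q, hF0, hQ0, hFQ⟩ := exists_firstStep_rhs_le hP h1 h3
  obtain ⟨R, hR0, hR⟩ := exists_firstStep_bound hE hP h1 h3
  set Λ := A + L * R ^ 2
  have hΛ0 : 0 ≤ Λ := add_nonneg hE.A_nonneg (by positivity)
  -- The first entry pays for ‖∇u⁰‖ ≤ ‖∇u₀‖ + ε/2. The second keeps the error of replacing ∇u⁰ by ∇φ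
  -- below (m₀ε/8)‖∇δ‖; the step size bound does the same for the memory term.
  set η := min (ε / 2) (m₀ * ε / (8 * (Λ + 1)))
  have hη0 : 0 < η := by positivity
  have hΛη : Λ * η ≤ m₀ * ε / 8 := by
    have h2 : η ≤ m₀ * ε / (8 * (Λ + 1)) := min_le_right _ _
    rw [le_div_iff₀ (by positivity)] at h2
    linarith
  obtain ⟨φ, hφ, h₀, hh₀, hclose⟩ := exists_test_close hE hP h1 hγ hη0
  obtain ⟨Cφ, hCφ0, hCφ⟩ := hφ.flux_bound hb ho.measurableSet ⟨Λ, hΛ0⟩ ⟨L, hL0⟩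
  set C₂ := Cφ + F + Q * R
  have hC₂ : 0 ≤ C₂ := by positivity
  refine ⟨h₀, m₀ * ε / (8 * (Q * R + 1)), 4 * C₂ ^ 2 / (m₀ * ε ^ 2), hh₀, by positivity,
    fun h 𝓣 hh hreg N hN hk hk' hκ u hu0 hu1 => ?_⟩
  obtain ⟨c1, c2⟩ := hclose h 𝓣 hh hreg u hu0
  obtain ⟨r0, r1⟩ := hR 𝓣 N hN hk u hu0 hu1
  have ht := node_mem hP hN hN
  have hs := P.gradSq_nonneg (u 1 : Pt d → ℝ)
  have hsR : P.gradSq (u 1 : Pt d → ℝ) ≤ R ^ 2 := by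
    rw [gradSq_eq]
    exact pow_le_pow_left₀ (P.gn_nonneg 𝓣 _) r1 2
  have hc : P.IsCoeff (fun x => P.M x (P.node N 1) (P.gradSq (u 1 : Pt d → ℝ))) Λ := by
    refine ⟨hΛ0, hE.measurable ho ht hs, (hE.isCoeff ho ht hs).2.2.mono fun x hx => hx.trans ?_⟩
    change _ ≤ A + L * R ^ 2
    gcongr
  have e1 := (firstStep_iff hP u).1 hu1 (u 1 - u 0)
  have e2 := hFQ 𝓣 N hN (u 0) (u 1 - u 0)
  obtain ⟨δ, hδ⟩ : ∃ δ, δ = u 1 - u 0 := ⟨_, rfl⟩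
  rw [← hδ] at e1 e2
  have hu1δ : u 1 = δ + u 0 := by rw [hδ, sub_add_cancel]
  have hδL := (𝓣.adm δ).memLp_gradient hb
  have hφL := hφ.adm.memLp_gradient hb
  have hu0L := (𝓣.adm (u 0)).memLp_gradient hb
  have e3 : P.diffusion (P.node N 1) (P.gradSq (u 1 : Pt d → ℝ)) (u 1) δ =
      P.gradForm 𝓣 hb hc δ δ + P.gradForm 𝓣 hb hc (u 0) δ := by
    rw [← LinearMap.add_apply, ← map_add, ← hu1δ]
    rfl
  -- ∇u⁰ is split into a small error and ∇φ. Only the second part can be integrated by parts with a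
  -- mesh-independent constant, as ∇u⁰ jumps across faces.
  have e4 : P.gradForm 𝓣 hb hc (u 0) δ =
      (∫ x in P.Ω, P.M x (P.node N 1) (P.gradSq (u 1 : Pt d → ℝ)) *
        inner ℝ ((gradient (u 0 : Pt d → ℝ) - gradient φ) x) (gradient (δ : Pt d → ℝ) x)) +
      ∫ x in P.Ω, P.M x (P.node N 1) (P.gradSq (u 1 : Pt d → ℝ)) *
        inner ℝ (gradient φ x) (gradient (δ : Pt d → ℝ) x) := by
    rw [gradForm_apply, ← integral_add (hc.bound (hu0L.sub hφL) hδL).1 (hc.bound hφL hδL).1]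
    refine integral_congr_ae (ae_of_all _ fun x => ?_)
    simp only [← mul_add, ← inner_add_left, Pi.sub_apply, sub_add_cancel]
  have e5 := (abs_le.1 (hc.bound (hu0L.sub hφL) hδL).2).1
  have e6 := (abs_le.1 (hCφ (fun x => P.M x (P.node N 1) (P.gradSq (u 1 : Pt d → ℝ)))
    (fun x hx => (hE.upper x (subset_closure hx) _ ht _ hs).trans (by
      change _ ≤ A + L * R ^ 2
      gcongr))
    (LipschitzOnWith.of_dist_le_mul fun x hx y hy => by
      rw [Real.dist_eq, dist_eq_norm]
      exact hE.lip_space x (subset_closure hx) y (subset_closure hy) _ ht _ hs) δ (𝓣.adm δ))).1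
  have e7 : m₀ * P.gn 𝓣 δ ^ 2 ≤ P.gradForm 𝓣 hb hc δ δ :=
    P.le_gradForm 𝓣 hb hc (hE.ae_lower ho ht hs) δ
  have e8 : Λ * (P.nr (gradient (u 0 : Pt d → ℝ) - gradient φ) * P.nr (gradient (δ : Pt d → ℝ))) ≤
      Λ * (η * P.gn 𝓣 δ) :=
    mul_le_mul_of_nonneg_left (mul_le_mul_of_nonneg_right c2 (P.gn_nonneg 𝓣 δ)) hΛ0
  have e9 := P.gn_le_add_sub 𝓣 hb (u 1) (u 0)
  have e10 := gn_initial_le hP h1 u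
  rw [← hδ] at e9
  rw [ip_self, e3, e4] at e1
  have hk0 := (step_pos hP hN).le
  have hg0 := P.gn_nonneg 𝓣 (u 0)
  have hy0 : 0 ≤ P.gn 𝓣 δ := P.gn_nonneg 𝓣 _
  have hl0 : 0 ≤ P.nr (δ : Pt d → ℝ) := P.nr_nonneg _
  change -(Cφ * P.nr (δ : Pt d → ℝ)) ≤ _ at e6
  set y := P.gn 𝓣 δ
  set l := P.nr (δ : Pt d → ℝ)
  have e11 : P.step N * (Q * P.gn 𝓣 (u 0) * (y + l)) ≤ m₀ * ε / 8 * y + Q * R * l := by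
    have h2 : P.step N * (Q * P.gn 𝓣 (u 0) * (y + l)) ≤ P.step N * (Q * R * (y + l)) := by gcongr
    have h3 : P.step N * (Q * R) ≤ m₀ * ε / 8 := by
      rw [lt_div_iff₀ (by positivity)] at hk'
      linarith
    have h4 := mul_le_mul_of_nonneg_right h3 hy0
    have h5 : P.step N * (Q * R * l) ≤ 1 * (Q * R * l) := by gcongr
    linarith
  have hκ0 := l1Const_pos hP hN
  have e12 : P.l1Const N * l ^ 2 + m₀ * y ^ 2 ≤ m₀ * ε / 4 * y + C₂ * l := by
    have h2 := mul_le_mul_of_nonneg_right hΛη hy0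
    have h3 : C₂ * l = Cφ * l + F * l + Q * R * l := by ring
    linarith
  have e13 : C₂ ^ 2 ≤ P.l1Const N * (m₀ * ε ^ 2 / 4) := by
    rw [div_lt_iff₀ (by positivity)] at hκ
    linarith
  have e15 : y ≤ ε / 2 := le_half_of_energy_le hκ0 hm hε e12 e13
  have e16 : η ≤ ε / 2 := min_le_left _ _
  linarith

variable {𝓣 : Mesh P.Ω}

/-- Two solutions of the first step with the same initial value. -/
lemma firstStep_sub_le (hE : P.Elliptic m₀ L A) (hP : P.Standing) {N : ℕ} (hN : 1 ≤ N)
    {u u' : ℕ → 𝓣.space} (h0 : u 0 = u' 0) (hu : P.FirstStep 𝓣 N u) (hu' : P.FirstStep 𝓣 N u')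
    {ρ : ℝ} (hr : P.gn 𝓣 (u 1) ≤ ρ) (hr' : P.gn 𝓣 (u' 1) ≤ ρ) :
    P.l1Const N * P.nr ((u 1 - u' 1 : 𝓣.space) : Pt d → ℝ) ^ 2 +
      m₀ * P.gn 𝓣 (u 1 - u' 1) ^ 2 ≤ 2 * L * ρ ^ 2 * P.gn 𝓣 (u 1 - u' 1) ^ 2 := by
  obtain ⟨hd, ho, -, hb, hT, -, -⟩ := id hP
  have ht := node_mem hP hN hN
  have hs := P.gradSq_nonneg (u 1 : Pt d → ℝ)
  have hs' := P.gradSq_nonneg (u' 1 : Pt d → ℝ)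
  obtain ⟨e, he⟩ : ∃ e, e = u 1 - u' 1 := ⟨_, rfl⟩
  have e1 := (firstStep_iff hP u).1 hu e
  have e2 := (firstStep_iff hP u').1 hu' e
  rw [← h0, ← e1] at e2
  have e3 := le_stepForm hE ho hb (P.l1Const N) ht hs e
  have e4 : stepForm hE ho hb (P.l1Const N) ht hs e e =
      P.diffusion (P.node N 1) (P.gradSq (u' 1 : Pt d → ℝ)) (u' 1) e -
        P.diffusion (P.node N 1) (P.gradSq (u 1 : Pt d → ℝ)) (u' 1) e := by
    have h2 : stepForm hE ho hb (P.l1Const N) ht hs e e =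
        stepForm hE ho hb (P.l1Const N) ht hs (u 1) e -
          stepForm hE ho hb (P.l1Const N) ht hs (u' 1) e := by
      rw [← LinearMap.sub_apply, ← map_sub, ← he]
    rw [h2, stepForm_apply, stepForm_apply]
    rw [ip_sub hb, ip_sub hb] at e2
    linarith
  have e5 := (le_abs_self _).trans
    (hE.abs_diffusion_sub_le ho hb ht hs' hs (𝓣.adm (u' 1)) (𝓣.adm e))
  rw [← he]
  refine (e3.trans (e4.le.trans e5)).trans ?_
  -- |s - s'| factors as a sum, at most 2ρ, times a difference of norms, at most ‖∇e‖; the third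
  -- ρ-factor bounds ‖∇u'¹‖. Together they give 2Lρ².
  rw [abs_sub_comm, gradSq_eq, gradSq_eq, sq_sub_sq, abs_mul]
  change L * _ * (P.gn 𝓣 (u' 1) * P.gn 𝓣 e) ≤ _
  have h2 := P.gn_nonneg 𝓣 (u 1)
  have h3 := P.gn_nonneg 𝓣 (u' 1)
  have h4 := P.gn_nonneg 𝓣 e
  have hL0 := hE.L_nonneg
  have h5 := P.abs_gn_sub_le 𝓣 hb (u 1) (u' 1)
  rw [← he] at h5
  rw [abs_of_nonneg (add_nonneg h2 h3)]
  have hρ0 := h2.trans hr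
  calc L * ((P.gn 𝓣 (u 1) + P.gn 𝓣 (u' 1)) * |P.gn 𝓣 (u 1) - P.gn 𝓣 (u' 1)|) *
        (P.gn 𝓣 (u' 1) * P.gn 𝓣 e) ≤ L * ((ρ + ρ) * P.gn 𝓣 e) * (ρ * P.gn 𝓣 e) := by gcongr
    _ = _ := by ring

/-- The factor `k^{-α} / Γ(2-α)` is large for small time steps. -/
lemma exists_lt_l1Const (hP : P.Standing) (κ₀ : ℝ) :
    ∃ k₀ : ℝ, 0 < k₀ ∧ ∀ N : ℕ, 1 ≤ N → P.step N < k₀ → κ₀ < P.l1Const N := by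
  have hα := hP.2.2.2.2.2.1
  have hΓ : 0 < Real.Gamma (2 - P.α) :=
    Real.Gamma_pos_of_pos (by have := hP.2.2.2.2.2.2; linarith)
  have hlim : Tendsto (fun k : ℝ => k ^ (-P.α) / Real.Gamma (2 - P.α)) (𝓝[>] 0) atTop :=
    (tendsto_rpow_neg_nhdsGT_zero (by linarith)).atTop_div_const hΓ
  obtain ⟨k₀, hk₀, hsub⟩ := mem_nhdsGT_iff_exists_Ioo_subset.1 (hlim.eventually_gt_atTop κ₀)
  exact ⟨k₀, hk₀, fun N hN hk => hsub ⟨step_pos hP hN, hk⟩⟩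

/-- The first step has at most one solution if the time step is small, uniformly over regular
meshes. -/
lemma exists_firstStep_unique (hE : P.Elliptic m₀ L A) (hP : P.Standing) (h1 : P.H1) (h3 : P.H3)
    (hK : 0 < m₀ - 4 * L * P.K ^ 2) {γ : ℝ} (hγ : 0 < γ) :
    ∃ k₀ : ℝ, 0 < k₀ ∧ k₀ ≤ 1 ∧ ∀ (h : ℝ) (𝓣 : Mesh P.Ω), 𝓣.Regular γ h → ∀ N : ℕ, 1 ≤ N →
      P.step N < k₀ → ∀ u u' : ℕ → 𝓣.space, P.InitialStep 𝓣 u → u 0 = u' 0 →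
        P.FirstStep 𝓣 N u → P.FirstStep 𝓣 N u' → u 1 = u' 1 := by
  obtain ⟨hd, ho, -, hb, hT, -, -⟩ := id hP
  have hL0 := hE.L_nonneg
  have hm := hE.pos
  obtain ⟨R, hR0, hR⟩ := exists_firstStep_bound hE hP h1 h3
  -- ‖∇u₀‖ ≤ K and 4LK² < m₀ leave a strict inequality at ε = 0, which persists for small ε by
  -- continuity.
  obtain ⟨ε, hε, hε'⟩ : ∃ ε : ℝ, 0 < ε ∧ 2 * L * (P.nr P.G₀ + ε) ^ 2 < m₀ := by
    have hlt : 2 * L * (P.nr P.G₀ + 0) ^ 2 < m₀ := by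
      have h2 := pow_le_pow_left₀ (P.nr_nonneg P.G₀) P.nr_G₀_le_K 2
      have h3 := mul_le_mul_of_nonneg_left h2 hL0
      have h4 : 0 ≤ L * P.nr P.G₀ ^ 2 := by positivity
      rw [add_zero]
      linarith
    have hc : Continuous fun ε : ℝ => 2 * L * (P.nr P.G₀ + ε) ^ 2 := by fun_prop
    have hev : ∀ᶠ ε in 𝓝[>] (0 : ℝ), 2 * L * (P.nr P.G₀ + ε) ^ 2 < m₀ :=
      nhdsWithin_le_nhds ((hc.tendsto 0).eventually_lt_const hlt)
    obtain ⟨ε, h2, h3⟩ := (hev.and self_mem_nhdsWithin).exists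
    exact ⟨ε, h3, h2⟩
  obtain ⟨h₀, k₁, κ₁, hh₀, hk₁, hfine⟩ := exists_gn_firstStep_le hE hP h1 h3 hγ hε
  set c := 4 * γ ^ 2 * (4 * γ) ^ d with hc
  have hc0 : 0 < c := by positivity
  -- Two demands on κ: the sharp bound on fine meshes requires κ > κ₁, and absorption on coarse
  -- meshes requires κ > 2LR²c/h₀².
  obtain ⟨k₂, hk₂, hκ⟩ := exists_lt_l1Const hP (max κ₁ (2 * L * R ^ 2 * (c / h₀ ^ 2)))
  refine ⟨min 1 (min k₁ k₂), by positivity, min_le_left _ _,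
    fun h 𝓣 hreg N hN hk u u' hu0 h0 hu hu' => ?_⟩
  obtain ⟨hk1, hk⟩ := lt_min_iff.1 hk
  obtain ⟨hk3, hk2⟩ := lt_min_iff.1 hk
  obtain ⟨hκ1, hκ2⟩ := max_lt_iff.1 (hκ N hN hk2)
  have hu0' : P.InitialStep 𝓣 u' := (initialStep_congr h0).1 hu0
  rw [← sub_eq_zero]
  rcases lt_or_ge h h₀ with hlt | hge
  · have e1 := firstStep_sub_le hE hP hN h0 hu hu'
      (hfine h 𝓣 hlt hreg N hN hk1.le hk3 hκ1 u hu0 hu)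
      (hfine h 𝓣 hlt hreg N hN hk1.le hk3 hκ1 u' hu0' hu')
    by_contra hne
    have e2 := pow_pos (gn_pos hd hb hne) 2
    have e3 := mul_lt_mul_of_pos_right hε' e2
    have e4 : 0 ≤ P.l1Const N * P.nr ((u 1 - u' 1 : 𝓣.space) : Pt d → ℝ) ^ 2 :=
      mul_nonneg (l1Const_pos hP hN).le (sq_nonneg _)
    linarith
  · have e1 := firstStep_sub_le hE hP hN h0 hu hu' (hR 𝓣 N hN hk1.le u hu0 hu).2
      (hR 𝓣 N hN hk1.le u' hu0' hu').2
    refine P.eq_zero_of_nr_eq_zero hb _ ?_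
    have e2 := 𝓣.inverse_inequality hb hγ hreg (u 1 - u' 1)
    have e3 : ∫ x in P.Ω, ‖gradient ((u 1 - u' 1 : 𝓣.space) : Pt d → ℝ) x‖ ^ 2 =
        P.gn 𝓣 (u 1 - u' 1) ^ 2 := P.gradSq_eq 𝓣 (u 1 - u' 1)
    have e4 : ∫ x in P.Ω, ((u 1 - u' 1 : 𝓣.space) : Pt d → ℝ) x ^ 2 =
        P.nr ((u 1 - u' 1 : 𝓣.space) : Pt d → ℝ) ^ 2 := by
      rw [← ip_self]
      exact integral_congr_ae (ae_of_all _ fun x => sq _)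
    rw [e3, e4, ← hc] at e2
    set y := P.gn 𝓣 (u 1 - u' 1) ^ 2
    have hy0 : 0 ≤ y := sq_nonneg _
    by_contra hne
    have hl : 0 < P.nr ((u 1 - u' 1 : 𝓣.space) : Pt d → ℝ) ^ 2 :=
      pow_pos ((P.nr_nonneg _).lt_of_ne (Ne.symm hne)) 2
    set l := P.nr ((u 1 - u' 1 : 𝓣.space) : Pt d → ℝ) ^ 2
    -- The inverse inequality, with h replaced by its lower bound h₀ in this case.
    have e5 : y ≤ c / h₀ ^ 2 * l := by
      rw [div_mul_eq_mul_div, le_div_iff₀ (by positivity), mul_comm]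
      refine le_trans ?_ e2
      gcongr
    have e6 : 2 * L * R ^ 2 * y ≤ 2 * L * R ^ 2 * (c / h₀ ^ 2 * l) := by gcongr
    have e7 := mul_lt_mul_of_pos_right hκ2 hl
    have e8 := mul_nonneg hm.le hy0
    linarith

end Problem

end KirchhoffFEM

/-! ### Solvability and uniqueness for the full scheme -/

open KirchhoffFEM in
theorem theorem6p4 {d : ℕ} (P : Problem d) (hP : P.Standing) (h1 : P.H1) (h2 : P.H2) (h3 : P.H3) :
    -- for every mesh and every time step `k ≤ 1`, the scheme is solvable, and each step `n ≥ 2`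
    -- is a uniquely solvable linear system with positive definite matrix
    (∀ (𝓣 : Mesh P.Ω) (N : ℕ), 1 ≤ N → P.step N ≤ 1 →
      (∃ u : Fin (N + 1) → 𝓣.space, P.IsSolution 𝓣 N u) ∧
      ∀ n, 2 ≤ n → n ≤ N → ∀ u : ℕ → 𝓣.space,
        (∃! w : 𝓣.space, P.LaterStep 𝓣 N n (Function.update u n w)) ∧
        (∃ ℓ : 𝓣.space →ₗ[ℝ] ℝ, ∀ w : 𝓣.space,
          P.LaterStep 𝓣 N n (Function.update u n w) ↔
            ∀ v : 𝓣.space, P.systemForm 𝓣 N n u w v = ℓ v) ∧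
        ∀ (m : ℕ) (φ : Module.Basis (Fin m) ℝ 𝓣.space),
          (Matrix.of fun i j => P.systemForm 𝓣 N n u (φ j) (φ i)).PosDef) ∧
    -- for all sufficiently small `k`, uniformly in the mesh size, the solution is unique
    ∀ γ : ℝ, 0 < γ → ∃ k₀ : ℝ, 0 < k₀ ∧ k₀ ≤ 1 ∧
      ∀ (h : ℝ) (𝓣 : Mesh P.Ω), 𝓣.Regular γ h → ∀ N : ℕ, 1 ≤ N → P.step N < k₀ →
        ∃! u : Fin (N + 1) → 𝓣.space, P.IsSolution 𝓣 N u := by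
  obtain ⟨m₀, L, A, hE, hK⟩ := Problem.exists_elliptic P hP h2
  refine ⟨fun 𝓣 N hN _ => ⟨Problem.exists_isSolution hE hP h1 h3 hN, fun n hn hnN u =>
    ⟨Problem.existsUnique_laterStep hE hP h3 hn hnN u,
      Problem.exists_laterStep_iff hP h3 hn hnN u,
      fun m φ => Problem.posDef_systemForm hE hP hn hnN u φ⟩⟩, fun γ hγ => ?_⟩
  obtain ⟨k₀, hk₀, hk₁, hfirst⟩ := Problem.exists_firstStep_unique hE hP h1 h3 hK hγ
  refine ⟨k₀, hk₀, hk₁, fun h 𝓣 hreg N hN hk => ?_⟩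
  obtain ⟨u, hu⟩ := Problem.exists_isSolution (𝓣 := 𝓣) hE hP h1 h3 hN
  exact ⟨u, hu, fun u' hu' =>
    Problem.isSolution_unique hE hP h1 h3 (hfirst h 𝓣 hreg N hN hk) hu' hu⟩
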